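/- For an open set $\Omega\subset\mathbb C^n$ and $1\le p<\infty$ let $A^p(\Omega)$ be the Bergman space of holomorphic functions on $\Omega$ that lie in $L^p(\Omega)$ (Lebesgue measure $dV$), with the $L^p$ norm, and let $A^p(\Omega)'$ be its dual, the space of bounded linear functionals with the dual norm. For conjugate exponents $p,q\in(1,\infty)$ let $\Phi_p:A^q(\Omega)\to A^p(\Omega)'$ be the bounded conjugate-linear map $\Phi_p(g)(f)=\int_\Omega f\,\overline g\,dV$. Let $\mathcal R\subset\mathbb C^n$ be a bounded Reinhardt domain, that is, a bounded, connected, nonempty open set that is invariant under $(z_1,\dots,z_n)\mapsto(e^{i\theta_1}z_1,\dots,e^{i\theta_n}z_n)$ for all $\theta\in\mathbb R^n$. For $\alpha\in\mathbb Z^n$ let $e_\alpha(z)=z_1^{\alpha_1}\cdots z_n^{\alpha_n}$, and let $\mathcal S(\mathcal R,L^p)=\{\alpha\in\mathbb Z^n: e_\alpha\in A^p(\mathcal R)\}$. Every holomorphic $f$ on $\mathcal R$ has a unique Laurent expansion $f=\sum_{\alpha\in\mathbb Z^n}a_\alpha(f)e_\alpha$ converging uniformly on compact subsets of $\mathcal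 R$; the maps $f\mapsto a_\alpha(f)$ are the coefficient functionals. Let $2\le p<\infty$, and let $q$ be the conjugate exponent, $\frac1p+\frac1q=1$. Let $G^{2,p}(\mathcal R)$ be the closure of $A^p(\mathcal R)$ in $A^2(\mathcal R)$, and let $\widetilde{B^p}(z,w)$ be the kernel that represents the orthogonal projection $\widetilde{\boldsymbol B^p}:L^2(\mathcal R)\to G^{2,p}(\mathcal R)$, i.e. $\widetilde{\boldsymbol B^p}f(z)=\int_{\mathcal R}\widetilde{B^p}(z,w)f(w)\,dV(w)$. Suppose that the operator $|\widetilde{\boldsymbol B^p}|f(z)=\int_{\mathcal R}|\widetilde{B^p}(z,w)|f(w)\,dV(w)$ is bounded on $L^p(\mathcal R)$. Let $G^{q,p}(\mathcal R)$ and $N^{q,p}(\mathcal R)$ be the closed linear spans in $A^q(\mathcal R)$ of $\{e_\alpha:\alpha\in\mathcal S(\mathcal R,L^p)\}$ and of $\{e_\alpha:\alpha\in\mathcal S(\mathcal R,L^q)\setminus\mathcal S(\mathcal R,L^p)\}$. Then: (i) The map $\Phi_p:A^q(\mathcal R)\to A^p(\mathcal R)'$ is surjective, and $\ker\Phi_p=N^{q,p}(\mathcal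 R)$. (ii) The restriction of $\Phi_p$ to $G^{q,p}(\mathcal R)$ is a conjugate-linear homeomorphism onto $A^p(\mathcal R)'$, and $g\mapsto\big(f\mapsto\int_{\mathcal R}f(z)\,g(\overline z)\,dV(z)\big)$ is a (complex) linear homeomorphism of $G^{q,p}(\mathcal R)$ onto $A^p(\mathcal R)'$. In particular $A^p(\mathcal R)'\cong G^{q,p}(\mathcal R)$. (iii) For every $\alpha\in\mathcal S(\mathcal R,L^q)$ the coefficient functional $a_\alpha$ is bounded on $A^q(\mathcal R)$, and there is a topological direct sum decomposition $$A^q(\mathcal R)'=\Phi_q(A^p(\mathcal R))\oplus\overline{\operatorname{span}}_{A^q(\mathcal R)'}\{a_\alpha:\alpha\in\mathcal S(\mathcal R,L^q)\setminus\mathcal S(\mathcal R,L^p)\}.$$ -/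

import Mathlib

open MeasureTheory Metric Filter Topology
open scoped ENNReal ComplexConjugate

namespace ReinhardtDuality

/-- Mean value property over the balls of the maximum norm. -/
theorem setIntegral_ball_eq {n : ℕ} {F : (Fin n → ℂ) → ℂ} {z : Fin n → ℂ} {r : ℝ}
    (hF : DifferentiableOn ℂ F (closedBall z r)) :
    ∫ w in ball (0 : Fin n → ℂ) r, F (z + w) = (volume.real (ball (0 : Fin n → ℂ) r)) • F z := by
  classical
  set B := ball (0 : Fin n → ℂ) r with hB
  have hpos : (0 : ℝ) < 2 * Real.pi := by positivity
  have hmaps : ∀ (t : ℝ) (w : Fin n → ℂ), w ∈ closedBall (0 : Fin n → ℂ) r →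
      z + circleMap 0 1 t • w ∈ closedBall z r := by
    intro t w hw
    simp only [mem_closedBall, dist_zero_right, dist_self_add_left] at hw ⊢
    simpa [norm_smul] using hw
  -- each rotation leaves the integral unchanged
  have hrot : ∀ t : ℝ, ∫ w in B, F (z + circleMap 0 1 t • w) = ∫ w in B, F (z + w) := by
    intro t
    have hc : ‖circleMap 0 1 t‖ = 1 := by simp
    have mp : MeasurePreserving (fun w : Fin n → ℂ => circleMap 0 1 t • w) volume volume := by
      have h1 : MeasurePreserving (fun x : ℂ => circleMap 0 1 t * x) volume volume := by
        have := (rotation ⟨circleMap 0 1 t, by simp [Submonoid.unitSphere]⟩).measurePreserving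
        exact this
      exact volume_preserving_pi (fun _ : Fin n => h1)
    have hpre : (fun w : Fin n → ℂ => circleMap 0 1 t • w) ⁻¹' B = B := by
      ext w
      simp [hB, norm_smul]
    have hne : circleMap 0 1 t ≠ 0 := by
      rw [← norm_pos_iff, hc]; exact one_pos
    have hemb : MeasurableEmbedding (fun w : Fin n → ℂ => circleMap 0 1 t • w) :=
      measurableEmbedding_const_smul₀ hne
    have := mp.setIntegral_preimage_emb hemb (fun w => F (z + w)) B
    rwa [hpre] at this
  -- each complex line satisfies the one-variable mean value property
  have hline : ∀ w ∈ B, ∫ t in (0 : ℝ)..2 * Real.pi, F (z + circleMap 0 1 t • w)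
      = (2 * Real.pi) • F z := by
    intro w hw
    have hd : DiffContOnCl ℂ (fun x : ℂ => F (z + x • w)) (ball 0 |(1 : ℝ)|) := by
      apply DifferentiableOn.diffContOnCl
      refine hF.comp (by fun_prop) ?_
      intro x hx
      have hx' : ‖x‖ ≤ 1 := by
        have := closure_ball_subset_closedBall hx
        simpa using this
      have hw' : ‖w‖ < r := by simpa [hB] using hw
      simp only [mem_closedBall, dist_self_add_left, norm_smul]
      nlinarith [norm_nonneg w, norm_nonneg x]
    have := hd.circleAverage
    rw [Real.circleAverage_def] at this
    simp only [zero_smul, add_zero] at this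
    rw [← this, smul_smul, mul_inv_cancel₀ hpos.ne', one_smul]
  have hcont : ContinuousOn (fun x : ℝ × (Fin n → ℂ) => F (z + circleMap 0 1 x.1 • x.2))
      (Set.Icc 0 (2 * Real.pi) ×ˢ closedBall (0 : Fin n → ℂ) r) := by
    refine hF.continuousOn.comp ?_ ?_
    · exact (by fun_prop : Continuous fun x : ℝ × (Fin n → ℂ) =>
        z + circleMap 0 1 x.1 • x.2).continuousOn
    · rintro ⟨t, w⟩ ⟨_, hw⟩
      exact hmaps t w hw
  have hint : Integrable (Function.uncurry fun (t : ℝ) (w : Fin n → ℂ) =>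
      F (z + circleMap 0 1 t • w))
      ((volume.restrict (Set.Ioc 0 (2 * Real.pi))).prod (volume.restrict B)) := by
    rw [Measure.prod_restrict]
    have h1 := hcont.integrableOn_compact (μ := (volume : Measure ℝ).prod (volume : Measure (Fin n → ℂ)))
      (isCompact_Icc.prod (isCompact_closedBall _ _))
    exact h1.mono_set (Set.prod_mono Set.Ioc_subset_Icc_self ball_subset_closedBall)
  have hswap := integral_integral_swap hint
  have hL : ∫ t in Set.Ioc 0 (2 * Real.pi), ∫ w in B, F (z + circleMap 0 1 t • w)
      = (2 * Real.pi) • ∫ w in B, F (z + w) := by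
    rw [setIntegral_congr_fun measurableSet_Ioc (fun t _ => hrot t)]
    simp [hpos.le]
  have hR : ∫ w in B, ∫ t in Set.Ioc 0 (2 * Real.pi), F (z + circleMap 0 1 t • w)
      = (volume.real B) • ((2 * Real.pi) • F z) := by
    rw [setIntegral_congr_fun (g := fun _ => (2 * Real.pi) • F z) measurableSet_ball]
    · rw [setIntegral_const]
    · intro w hw
      simp only
      rw [← intervalIntegral.integral_of_le hpos.le, hline w hw]
  rw [hL, hR, smul_comm] at hswap
  exact (smul_right_injective ℂ hpos.ne') hswap

/-- Point evaluations are dominated by every `L^p` norm, uniformly over the points whose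
distance to the complement is larger than a given number. -/
theorem exists_norm_le_eLpNorm (n : ℕ) {p : ENNReal} (hp : 1 ≤ p) {r : ℝ} (hr : 0 < r) :
    ∃ C : ℝ, 0 ≤ C ∧ ∀ (s : Set (Fin n → ℂ)) (F : (Fin n → ℂ) → ℂ) (z : Fin n → ℂ),
      closedBall z r ⊆ s → DifferentiableOn ℂ F s → MemLp F p (volume.restrict s) →
      ‖F z‖ ≤ C * (eLpNorm F p (volume.restrict s)).toReal := by
  set B := ball (0 : Fin n → ℂ) r with hB
  have hBpos : 0 < volume B := measure_ball_pos _ _ hr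
  have hBfin : volume B ≠ ⊤ := measure_ball_lt_top.ne
  have hV : 0 < volume.real B := ENNReal.toReal_pos hBpos.ne' hBfin
  set D : ENNReal := volume B ^ (1 / (1 : ENNReal).toReal - 1 / p.toReal) with hD
  have hDfin : D ≠ ⊤ := ENNReal.rpow_ne_top_of_ne_zero hBpos.ne' hBfin
  refine ⟨(volume.real B)⁻¹ * D.toReal, by positivity, ?_⟩
  intro s F z hzs hF hmem
  have hbs : ball z r ⊆ s := ball_subset_closedBall.trans hzs
  have hmean := setIntegral_ball_eq (hF.mono hzs)
  have htr : ∫ w in B, ‖F (z + w)‖ = ∫ w in ball z r, ‖F w‖ := by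
    have mp := (measurePreserving_add_left (volume : Measure (Fin n → ℂ)) z)
    have := mp.setIntegral_preimage_emb (measurableEmbedding_addLeft z) (fun w => ‖F w‖) (ball z r)
    rw [← this]
    congr 2
    ext w; simp [hB]
  have hmemB : MemLp F p (volume.restrict (ball z r)) :=
    hmem.mono_measure (Measure.restrict_mono hbs le_rfl)
  have hvol : volume (ball z r) = volume B := by
    rw [hB, Measure.addHaar_ball_center]
  have h1 : eLpNorm F 1 (volume.restrict (ball z r))
      ≤ eLpNorm F p (volume.restrict s) * D := by
    have := eLpNorm_le_eLpNorm_mul_rpow_measure_univ hp hmemB.1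
    rw [Measure.restrict_apply_univ, hvol] at this
    exact this.trans (mul_le_mul_left (eLpNorm_mono_measure F
      (Measure.restrict_mono hbs le_rfl)) _)
  have h2 : ∫ w in ball z r, ‖F w‖ ≤ (eLpNorm F p (volume.restrict s)).toReal * D.toReal := by
    rw [integral_norm_eq_lintegral_enorm hmemB.1, ← eLpNorm_one_eq_lintegral_enorm,
      ← ENNReal.toReal_mul]
    exact ENNReal.toReal_mono (ENNReal.mul_ne_top hmem.2.ne hDfin) h1
  have h3 : volume.real B * ‖F z‖ ≤ ∫ w in ball z r, ‖F w‖ := by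
    rw [← htr]
    calc volume.real B * ‖F z‖ = ‖∫ w in B, F (z + w)‖ := by
          rw [hmean, norm_smul, Real.norm_of_nonneg hV.le]
      _ ≤ _ := norm_integral_le_integral_norm _
  have h4 : ‖F z‖ ≤ (volume.real B)⁻¹ * ∫ w in ball z r, ‖F w‖ := by
    rw [le_inv_mul_iff₀ hV]; exact h3
  calc ‖F z‖ ≤ (volume.real B)⁻¹ * ∫ w in ball z r, ‖F w‖ := h4
    _ ≤ (volume.real B)⁻¹ * ((eLpNorm F p (volume.restrict s)).toReal * D.toReal) := by gcongr
    _ = _ := by ring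

/-- The same for the derivative, by the Cauchy estimate on complex lines. -/
theorem exists_norm_fderiv_le_eLpNorm (n : ℕ) {p : ENNReal} (hp : 1 ≤ p) {r : ℝ} (hr : 0 < r) :
    ∃ C : ℝ, 0 ≤ C ∧ ∀ (s : Set (Fin n → ℂ)) (F : (Fin n → ℂ) → ℂ) (z : Fin n → ℂ),
      IsOpen s → closedBall z (2 * r) ⊆ s → DifferentiableOn ℂ F s →
      MemLp F p (volume.restrict s) →
      ‖fderiv ℂ F z‖ ≤ C * (eLpNorm F p (volume.restrict s)).toReal := by
  obtain ⟨C, hC0, hC⟩ := exists_norm_le_eLpNorm n hp hr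
  refine ⟨C / r, by positivity, ?_⟩
  intro s F z hs hzs hF hmem
  set M := (eLpNorm F p (volume.restrict s)).toReal with hM
  have hM0 : 0 ≤ M := ENNReal.toReal_nonneg
  have hbd : ∀ w ∈ closedBall z r, ‖F w‖ ≤ C * M := by
    intro w hw
    refine hC s F w (Set.Subset.trans (closedBall_subset_closedBall' ?_) hzs) hF hmem
    rw [mem_closedBall] at hw
    linarith
  have hzmem : z ∈ s := hzs (mem_closedBall_self (by positivity))
  have hdz : DifferentiableAt ℂ F z := (hF z hzmem).differentiableAt (hs.mem_nhds hzmem)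
  refine ContinuousLinearMap.opNorm_le_bound _ (by positivity) fun v => ?_
  rcases eq_or_ne v 0 with rfl | hv
  · simp
  have hv' : 0 < ‖v‖ := norm_pos_iff.2 hv
  have hline : ∀ x ∈ closedBall (0 : ℂ) (r / ‖v‖), z + x • v ∈ closedBall z r := by
    intro x hx
    rw [mem_closedBall, dist_zero_right, le_div_iff₀ hv'] at hx
    simpa [norm_smul] using hx
  have hrs : closedBall z r ⊆ s :=
    (closedBall_subset_closedBall (by linarith)).trans hzs
  have hd : DiffContOnCl ℂ (fun x : ℂ => F (z + x • v)) (ball 0 (r / ‖v‖)) := by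
    apply DifferentiableOn.diffContOnCl
    refine hF.comp (by fun_prop) fun x hx => hrs (hline x ?_)
    exact closure_ball_subset_closedBall hx
  have hder : HasDerivAt (fun x : ℂ => F (z + x • v)) (fderiv ℂ F z v) 0 := by
    have h1 : HasDerivAt (fun x : ℂ => z + x • v) v 0 := by
      simpa using ((hasDerivAt_id (0 : ℂ)).smul_const v).const_add z
    have h2 : HasFDerivAt F (fderiv ℂ F z) (z + (0 : ℂ) • v) := by
      simpa using hdz.hasFDerivAt
    exact h2.comp_hasDerivAt 0 h1
  have := Complex.norm_deriv_le_of_forall_mem_sphere_norm_le (div_pos hr hv') hd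
    (fun x hx => hbd _ (hline x (sphere_subset_closedBall hx)))
  rw [hder.deriv] at this
  calc ‖fderiv ℂ F z v‖ ≤ C * M / (r / ‖v‖) := this
    _ = C / r * M * ‖v‖ := by field_simp
/-- The Bergman space `A^p(Ω)`: the elements of `L^p(Ω)` that are (represented by) holomorphic
functions on `Ω`, with the `L^p` norm. -/
def bergman {n : ℕ} (Ω : TopologicalSpace.Opens (Fin n → ℂ)) (p : ℝ≥0∞) :
    Submodule ℂ (Lp ℂ p (volume.restrict (Ω : Set (Fin n → ℂ)))) where
  carrier := {f | ∃ F : (Fin n → ℂ) → ℂ, DifferentiableOn ℂ F Ω ∧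
    f =ᵐ[volume.restrict (Ω : Set (Fin n → ℂ))] F}
  add_mem' := by
    rintro f g ⟨F, hF, hfF⟩ ⟨G, hG, hgG⟩
    exact ⟨F + G, hF.add hG, (Lp.coeFn_add f g).trans (hfF.add hgG)⟩
  zero_mem' := ⟨0, differentiableOn_const 0, Lp.coeFn_zero _ _ _⟩
  smul_mem' := by
    rintro c f ⟨F, hF, hfF⟩
    exact ⟨c • F, hF.const_smul c, (Lp.coeFn_smul c f).trans (hfF.const_smul c)⟩

section

variable {n : ℕ} {Ω : TopologicalSpace.Opens (Fin n → ℂ)} {p : ℝ≥0∞}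

/-- The holomorphic function on `Ω` that an element of `A^p(Ω)` is, extended by `0` off `Ω`. -/
noncomputable def holoFn (f : bergman Ω p) : (Fin n → ℂ) → ℂ :=
  Set.indicator (Ω : Set (Fin n → ℂ)) f.2.choose

theorem differentiableOn_holoFn (f : bergman Ω p) : DifferentiableOn ℂ (holoFn f) Ω :=
  f.2.choose_spec.1.congr fun _ hz => Set.indicator_of_mem hz _

theorem coeFn_ae_eq_holoFn (f : bergman Ω p) :
    f.1 =ᵐ[volume.restrict (Ω : Set (Fin n → ℂ))] holoFn f :=
  f.2.choose_spec.2.trans (indicator_ae_eq_restrict Ω.isOpen.measurableSet).symm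

theorem holoFn_eq_of_ae_eq {f : bergman Ω p} {F : (Fin n → ℂ) → ℂ} (hF : DifferentiableOn ℂ F Ω)
    (h : f.1 =ᵐ[volume.restrict (Ω : Set (Fin n → ℂ))] F) :
    holoFn f = Set.indicator (Ω : Set (Fin n → ℂ)) F := by
  have h1 : Set.EqOn (holoFn f) F Ω := Measure.eqOn_open_of_ae_eq
    ((coeFn_ae_eq_holoFn f).symm.trans h) Ω.isOpen (differentiableOn_holoFn f).continuousOn
    hF.continuousOn
  ext z
  by_cases hz : z ∈ (Ω : Set (Fin n → ℂ))
  · rw [Set.indicator_of_mem hz, h1 hz]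
  · rw [Set.indicator_of_notMem hz, holoFn, Set.indicator_of_notMem hz]

theorem holoFn_add (f g : bergman Ω p) : holoFn (f + g) = holoFn f + holoFn g := by
  rw [holoFn_eq_of_ae_eq ((differentiableOn_holoFn f).add (differentiableOn_holoFn g))
    ((Lp.coeFn_add f.1 g.1).trans ((coeFn_ae_eq_holoFn f).add (coeFn_ae_eq_holoFn g)))]
  rw [Set.indicator_eq_self]
  intro z hz
  by_contra hz'
  exact hz (by simp [holoFn, Set.indicator_of_notMem hz'])

theorem holoFn_smul (c : ℂ) (f : bergman Ω p) : holoFn (c • f) = c • holoFn f := by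
  rw [holoFn_eq_of_ae_eq ((differentiableOn_holoFn f).const_smul c)
    ((Lp.coeFn_smul c f.1).trans ((coeFn_ae_eq_holoFn f).const_smul c))]
  rw [Set.indicator_eq_self]
  intro z hz
  by_contra hz'
  exact hz (by simp [holoFn, Set.indicator_of_notMem hz'])

theorem memLp_holoFn (f : bergman Ω p) :
    MemLp (holoFn f) p (volume.restrict (Ω : Set (Fin n → ℂ))) :=
  (memLp_congr_ae (coeFn_ae_eq_holoFn f)).1 (Lp.memLp f.1)

theorem norm_eq_eLpNorm_holoFn [Fact (1 ≤ p)] (f : bergman Ω p) :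
    ‖f‖ = (eLpNorm (holoFn f) p (volume.restrict (Ω : Set (Fin n → ℂ)))).toReal := by
  rw [← eLpNorm_congr_ae (coeFn_ae_eq_holoFn f)]
  rfl

theorem exists_norm_holoFn_le [Fact (1 ≤ p)] (z : Fin n → ℂ) :
    ∃ C : ℝ, ∀ f : bergman Ω p, ‖holoFn f z‖ ≤ C * ‖f‖ := by
  by_cases hz : z ∈ (Ω : Set (Fin n → ℂ))
  · obtain ⟨r, hr, hrΩ⟩ := nhds_basis_closedBall.mem_iff.1 (Ω.isOpen.mem_nhds hz)
    obtain ⟨C, -, hC⟩ := exists_norm_le_eLpNorm n (Fact.out : 1 ≤ p) hr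
    refine ⟨C, fun f => ?_⟩
    rw [norm_eq_eLpNorm_holoFn]
    exact hC _ _ z hrΩ (differentiableOn_holoFn f) (memLp_holoFn f)
  · exact ⟨0, fun f => by simp [holoFn, Set.indicator_of_notMem hz]⟩

/-- Evaluation at `z` (which is `0` if `z ∉ Ω`), a bounded functional on `A^p(Ω)`. -/
noncomputable def evalL (Ω : TopologicalSpace.Opens (Fin n → ℂ)) (p : ℝ≥0∞) [Fact (1 ≤ p)]
    (z : Fin n → ℂ) : StrongDual ℂ (bergman Ω p) :=
  LinearMap.mkContinuousOfExistsBound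
    { toFun := fun f => holoFn f z
      map_add' := fun f g => by rw [holoFn_add]; rfl
      map_smul' := fun c f => by rw [holoFn_smul]; rfl }
    (exists_norm_holoFn_le z)

theorem holoFn_sub (f g : bergman Ω p) : holoFn (f - g) = holoFn f - holoFn g := by
  have : f - g = f + (-1 : ℂ) • g := by simp [sub_eq_add_neg]
  rw [this, holoFn_add, holoFn_smul]
  simp [sub_eq_add_neg]

theorem fderiv_holoFn_sub (f g : bergman Ω p) {z : Fin n → ℂ} (hz : z ∈ Ω) :
    fderiv ℂ (holoFn (f - g)) z = fderiv ℂ (holoFn f) z - fderiv ℂ (holoFn g) z := by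
  rw [holoFn_sub]
  exact fderiv_sub ((differentiableOn_holoFn f z hz).differentiableAt (Ω.isOpen.mem_nhds hz))
    ((differentiableOn_holoFn g z hz).differentiableAt (Ω.isOpen.mem_nhds hz))

/-- `A^p(Ω)` is closed in `L^p(Ω)`. -/
theorem isClosed_bergman (Ω : TopologicalSpace.Opens (Fin n → ℂ)) (p : ℝ≥0∞) [hp : Fact (1 ≤ p)] :
    IsClosed (bergman Ω p : Set (Lp ℂ p (volume.restrict (Ω : Set (Fin n → ℂ))))) := by
  refine IsSeqClosed.isClosed ?_
  intro u g hu hug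
  let f : ℕ → bergman Ω p := fun k => ⟨u k, hu k⟩
  have hcau : ∀ ε > 0, ∃ N, ∀ k ≥ N, ∀ l ≥ N, ‖f k - f l‖ < ε := by
    intro ε hε
    obtain ⟨N, hN⟩ := Metric.cauchySeq_iff.1 hug.cauchySeq ε hε
    refine ⟨N, fun k hk l hl => ?_⟩
    have := hN k hk l hl
    rwa [dist_eq_norm] at this
  -- the derivatives are locally uniformly Cauchy
  have hder : ∀ z ∈ Ω, ∃ r > 0, ∃ C : ℝ, 0 ≤ C ∧ ball z r ⊆ Ω ∧ ∀ w ∈ ball z r, ∀ k l,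
      ‖fderiv ℂ (holoFn (f k)) w - fderiv ℂ (holoFn (f l)) w‖ ≤ C * ‖f k - f l‖ := by
    intro z hz
    obtain ⟨r, hr, hrΩ⟩ := nhds_basis_closedBall.mem_iff.1 (Ω.isOpen.mem_nhds hz)
    obtain ⟨C, hC0, hC⟩ := exists_norm_fderiv_le_eLpNorm n hp.out (r := r / 4) (by positivity)
    have hb : ball z (r / 2) ⊆ (Ω : Set (Fin n → ℂ)) :=
      (ball_subset_closedBall.trans (closedBall_subset_closedBall (by linarith))).trans hrΩ
    refine ⟨r / 2, by positivity, C, hC0, hb, fun w hw k l => ?_⟩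
    rw [← fderiv_holoFn_sub _ _ (hb hw), norm_eq_eLpNorm_holoFn]
    refine hC _ _ w Ω.isOpen ((closedBall_subset_closedBall' ?_).trans hrΩ)
      (differentiableOn_holoFn _) (memLp_holoFn _)
    rw [mem_ball] at hw
    linarith
  have hlim' : ∀ z, ∃ L : (Fin n → ℂ) →L[ℂ] ℂ, z ∈ Ω →
      Tendsto (fun k => fderiv ℂ (holoFn (f k)) z) atTop (𝓝 L) := by
    intro z
    by_cases hz : z ∈ Ω
    · obtain ⟨r, hr, C, hC0, -, hC⟩ := hder z hz
      have : CauchySeq fun k => fderiv ℂ (holoFn (f k)) z := by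
        refine Metric.cauchySeq_iff.2 fun ε hε => ?_
        obtain ⟨N, hN⟩ := hcau (ε / (C + 1)) (by positivity)
        refine ⟨N, fun k hk l hl => ?_⟩
        rw [dist_eq_norm]
        have h1 := hC z (mem_ball_self hr) k l
        have h2 := hN k hk l hl
        rw [lt_div_iff₀ (by positivity)] at h2
        nlinarith [norm_nonneg (f k - f l)]
      obtain ⟨L, hL⟩ := cauchySeq_tendsto_of_complete this
      exact ⟨L, fun _ => hL⟩
    · exact ⟨0, fun h => absurd h hz⟩
  choose G' hG' using hlim'
  have hlim : ∀ z, ∃ L : ℂ, z ∈ Ω → Tendsto (fun k => holoFn (f k) z) atTop (𝓝 L) := by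
    intro z
    obtain ⟨L, hL⟩ := cauchySeq_tendsto_of_complete
      (((evalL Ω p z).uniformContinuous.comp_cauchySeq
        (show CauchySeq f from Metric.cauchySeq_iff.2 fun ε hε => by
          obtain ⟨N, hN⟩ := hcau ε hε
          exact ⟨N, fun k hk l hl => by rw [dist_eq_norm]; exact hN k hk l hl⟩)))
    exact ⟨L, fun _ => hL⟩
  choose G hG using hlim
  have hunif : TendstoLocallyUniformlyOn (fun k => fderiv ℂ (holoFn (f k))) G' atTop
      (Ω : Set (Fin n → ℂ)) := by
    rw [Metric.tendstoLocallyUniformlyOn_iff]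
    intro ε hε z hz
    obtain ⟨r, hr, C, hC0, hb, hC⟩ := hder z hz
    refine ⟨ball z r, mem_nhdsWithin_of_mem_nhds (ball_mem_nhds z hr), ?_⟩
    obtain ⟨N, hN⟩ := hcau (ε / (2 * (C + 1))) (by positivity)
    filter_upwards [eventually_ge_atTop N] with k hk w hw
    have h1 : ∀ l ≥ N, ‖fderiv ℂ (holoFn (f l)) w - fderiv ℂ (holoFn (f k)) w‖ ≤ ε / 2 := by
      intro l hl
      have h1 := hC w hw l k
      have h2 := hN l hl k hk
      rw [lt_div_iff₀ (by positivity)] at h2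
      nlinarith [norm_nonneg (f l - f k)]
    have h2 : ‖G' w - fderiv ℂ (holoFn (f k)) w‖ ≤ ε / 2 := by
      refine le_of_tendsto ((hG' w (hb hw)).sub_const _).norm ?_
      filter_upwards [eventually_ge_atTop N] with l hl using h1 l hl
    rw [dist_eq_norm]
    linarith
  have hdiff : DifferentiableOn ℂ G Ω := fun z hz =>
    (hasFDerivAt_of_tendsto_locally_uniformly_on' Ω.isOpen hunif
      (fun k => differentiableOn_holoFn (f k)) (fun z hz => hG z hz) hz
      ).differentiableAt.differentiableWithinAt
  refine ⟨G, hdiff, ?_⟩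
  obtain ⟨φ, hφ, hφae⟩ := (tendstoInMeasure_of_tendsto_Lp hug).exists_seq_tendsto_ae
  have hall : ∀ᵐ z ∂(volume.restrict (Ω : Set (Fin n → ℂ))), ∀ k, u k z = holoFn (f k) z :=
    ae_all_iff.2 fun k => coeFn_ae_eq_holoFn (f k)
  filter_upwards [hφae, hall, ae_restrict_mem Ω.isOpen.measurableSet] with z h1 h2 h3
  refine tendsto_nhds_unique h1 ?_
  simp only [h2]
  exact (hG z h3).comp hφ.tendsto_atTop

end

/-- The closure in `A^2(Ω)` of the functions of `A^2(Ω)` that lie in `A^p(Ω)` (of all of `A^p(Ω)`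
if `Ω` is bounded and `p ≥ 2`). As `A^2(Ω)` is closed in `L^2(Ω)`, the closure may be, and is,
taken in `L^2(Ω)`. -/
noncomputable def subBergmanSpace {n : ℕ} (Ω : TopologicalSpace.Opens (Fin n → ℂ)) (p : ℝ≥0∞) :
    Submodule ℂ (Lp ℂ 2 (volume.restrict (Ω : Set (Fin n → ℂ)))) :=
  Submodule.topologicalClosure
    { carrier := {f | f ∈ bergman Ω 2 ∧ MemLp f p (volume.restrict (Ω : Set (Fin n → ℂ)))}
      add_mem' := fun {f g} hf hg => ⟨add_mem hf.1 hg.1,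
        (memLp_congr_ae (Lp.coeFn_add f g)).2 (hf.2.add hg.2)⟩
      zero_mem' := ⟨zero_mem _, (memLp_congr_ae (Lp.coeFn_zero _ _ _)).2 MemLp.zero⟩
      smul_mem' := fun c f hf => ⟨Submodule.smul_mem _ c hf.1,
        (memLp_congr_ae (Lp.coeFn_smul c f)).2 (hf.2.const_smul c)⟩ }

theorem subBergmanSpace_le {n : ℕ} (Ω : TopologicalSpace.Opens (Fin n → ℂ)) (p : ℝ≥0∞) :
    subBergmanSpace Ω p ≤ bergman Ω 2 :=
  Submodule.topologicalClosure_minimal _ (fun _ hf => hf.1) (isClosed_bergman Ω 2)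

noncomputable instance {n : ℕ} (Ω : TopologicalSpace.Opens (Fin n → ℂ)) (p : ℝ≥0∞) :
    CompleteSpace (subBergmanSpace Ω p) :=
  (Submodule.isClosed_topologicalClosure _).completeSpace_coe

/-- Evaluation at `z` on the sub-Bergman space. -/
noncomputable def subEvalL {n : ℕ} (Ω : TopologicalSpace.Opens (Fin n → ℂ)) (p : ℝ≥0∞)
    (z : Fin n → ℂ) : StrongDual ℂ (subBergmanSpace Ω p) :=
  (evalL Ω 2 z).comp
    ((Submodule.subtypeL (subBergmanSpace Ω p)).codRestrict (bergman Ω 2)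
      fun f => subBergmanSpace_le Ω p f.2)

/-- The element `k_z` of the sub-Bergman space with `⟪k_z, f⟫ = f z` for all `f` in that space. -/
noncomputable def subBergmanVec {n : ℕ} (Ω : TopologicalSpace.Opens (Fin n → ℂ)) (p : ℝ≥0∞)
    (z : Fin n → ℂ) : subBergmanSpace Ω p :=
  (InnerProductSpace.toDual ℂ (subBergmanSpace Ω p)).symm (subEvalL Ω p z)

/-- The `L^p` sub-Bergman kernel: the representing kernel `K(z,w) = conj (k_z w)` of the orthogonal
projection of `L^2(Ω)` onto the sub-Bergman space; see `subBergmanProj_eq_integral`. -/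
noncomputable def subBergmanKernel {n : ℕ} (Ω : TopologicalSpace.Opens (Fin n → ℂ)) (p : ℝ≥0∞)
    (z w : Fin n → ℂ) : ℂ :=
  conj (holoFn (⟨(subBergmanVec Ω p z).1, subBergmanSpace_le Ω p (subBergmanVec Ω p z).2⟩ :
    bergman Ω 2) w)

/-- The `L^p` sub-Bergman projection of `L^2(Ω)` is the integral operator with the `L^p`
sub-Bergman kernel. -/
theorem subBergmanProj_eq_integral {n : ℕ} (Ω : TopologicalSpace.Opens (Fin n → ℂ)) (p : ℝ≥0∞)
    (f : Lp ℂ 2 (volume.restrict (Ω : Set (Fin n → ℂ)))) (z : Fin n → ℂ) :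
    holoFn (⟨((subBergmanSpace Ω p).orthogonalProjectionOnto f).1,
        subBergmanSpace_le Ω p ((subBergmanSpace Ω p).orthogonalProjectionOnto f).2⟩ : bergman Ω 2) z
      = ∫ w in (Ω : Set (Fin n → ℂ)), subBergmanKernel Ω p z w * f w := by
  have h1 : inner ℂ (subBergmanVec Ω p z) ((subBergmanSpace Ω p).orthogonalProjectionOnto f)
      = subEvalL Ω p z ((subBergmanSpace Ω p).orthogonalProjectionOnto f) :=
    InnerProductSpace.toDual_symm_apply
  have h2 : inner ℂ (subBergmanVec Ω p z) ((subBergmanSpace Ω p).orthogonalProjectionOnto f)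
      = inner ℂ (subBergmanVec Ω p z).1 f := by
    rw [Submodule.inner_orthogonalProjectionOnto_eq_of_mem_left]
  refine h1.symm.trans (h2.trans ?_)
  rw [L2.inner_def]
  refine integral_congr_ae ?_
  filter_upwards [coeFn_ae_eq_holoFn (⟨(subBergmanVec Ω p z).1,
    subBergmanSpace_le Ω p (subBergmanVec Ω p z).2⟩ : bergman Ω 2)] with w hw
  rw [hw, RCLike.inner_apply, subBergmanKernel, mul_comm]

/-- The operator `|P|` with kernel `|K(z,w)|` over `Ω` is bounded on `L^p(Ω)`. -/
def AbsKernelBounded {n : ℕ} (Ω : TopologicalSpace.Opens (Fin n → ℂ)) (p : ℝ≥0∞)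
    (K : (Fin n → ℂ) → (Fin n → ℂ) → ℂ) : Prop :=
  ∃ C : NNReal, ∀ f : (Fin n → ℂ) → ℂ, MemLp f p (volume.restrict (Ω : Set (Fin n → ℂ))) →
    eLpNorm (fun z => ∫ w in (Ω : Set (Fin n → ℂ)), (‖K z w‖ : ℂ) * f w) p
        (volume.restrict (Ω : Set (Fin n → ℂ)))
      ≤ C * eLpNorm f p (volume.restrict (Ω : Set (Fin n → ℂ)))

/-- `Ω` is invariant under the rotations of all the coordinates. -/
def IsReinhardt {n : ℕ} (Ω : Set (Fin n → ℂ)) : Prop :=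
  ∀ z ∈ Ω, ∀ θ : Fin n → ℝ, (fun j => Complex.exp (θ j * Complex.I) * z j) ∈ Ω

/-- The monomial `e_α(z) = z_1 ^ α_1 ⋯ z_n ^ α_n`, for `α ∈ ℤ^n`. -/
noncomputable def monomialFn {n : ℕ} (α : Fin n → ℤ) (z : Fin n → ℂ) : ℂ :=
  ∏ j, z j ^ α j

/-- The `L^p`-allowable multi-indices of `Ω`: those `α` with `e_α ∈ A^p(Ω)`. -/
def allowable {n : ℕ} (Ω : TopologicalSpace.Opens (Fin n → ℂ)) (p : ℝ≥0∞) : Set (Fin n → ℤ) :=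
  {α | DifferentiableOn ℂ (monomialFn α) Ω ∧
    MemLp (monomialFn α) p (volume.restrict (Ω : Set (Fin n → ℂ)))}

/-- The closed linear span in `A^p(Ω)` of the monomials with exponents in `A`. -/
noncomputable def monomialSpan {n : ℕ} (Ω : TopologicalSpace.Opens (Fin n → ℂ)) (p : ℝ≥0∞)
    [Fact (1 ≤ p)] (A : Set (Fin n → ℤ)) : Submodule ℂ (bergman Ω p) :=
  (Submodule.span ℂ {f : bergman Ω p | ∃ α ∈ A, Set.EqOn (holoFn f) (monomialFn α) Ω}
    ).topologicalClosure

/-- `∑ c_α e_α`, over `α ∈ ℤ^n`, converges to `F` uniformly on the compact subsets of `Ω`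
(that is, locally uniformly, `Ω` being open). -/
def HasLaurentExpansion {n : ℕ} (Ω : TopologicalSpace.Opens (Fin n → ℂ)) (F : (Fin n → ℂ) → ℂ)
    (c : (Fin n → ℤ) → ℂ) : Prop :=
  HasSumLocallyUniformlyOn (fun α z => c α * monomialFn α z) F (Ω : Set (Fin n → ℂ))

open Classical in
/-- The Laurent coefficient `a_α(F)`. -/
noncomputable def laurentCoeff {n : ℕ} (Ω : TopologicalSpace.Opens (Fin n → ℂ))
    (F : (Fin n → ℂ) → ℂ) (α : Fin n → ℤ) : ℂ :=
  if h : ∃ c, HasLaurentExpansion Ω F c then h.choose α else 0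

/-- `a` is the coefficient functional `f ↦ a_α(f)` on `A^p(Ω)`. -/
def IsCoeffFunctional {n : ℕ} (Ω : TopologicalSpace.Opens (Fin n → ℂ)) (p : ℝ≥0∞)
    [Fact (1 ≤ p)] (α : Fin n → ℤ) (a : StrongDual ℂ (bergman Ω p)) : Prop :=
  ∀ f : bergman Ω p, a f = laurentCoeff Ω (holoFn f) α

/-- The closed linear span in `A^p(Ω)'` of the coefficient functionals `a_α` with `α ∈ A`. -/
noncomputable def coeffSpan {n : ℕ} (Ω : TopologicalSpace.Opens (Fin n → ℂ)) (p : ℝ≥0∞)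
    [Fact (1 ≤ p)] (A : Set (Fin n → ℤ)) : Submodule ℂ (StrongDual ℂ (bergman Ω p)) :=
  (Submodule.span ℂ {a | ∃ α ∈ A, IsCoeffFunctional Ω p α a}).topologicalClosure

theorem integrable_mul_conj_holoFn {n : ℕ} {Ω : TopologicalSpace.Opens (Fin n → ℂ)} {p q : ℝ≥0∞}
    [ENNReal.HolderConjugate p q] (g : bergman Ω q) (f : bergman Ω p) :
    Integrable (fun z => holoFn f z * conj (holoFn g z))
      (volume.restrict (Ω : Set (Fin n → ℂ))) :=
  (memLp_holoFn f).integrable_mul (memLp_holoFn g).star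

theorem norm_integral_mul_conj_holoFn_le {n : ℕ} {Ω : TopologicalSpace.Opens (Fin n → ℂ)}
    {p q : ℝ≥0∞} [Fact (1 ≤ p)] [Fact (1 ≤ q)] [ENNReal.HolderConjugate p q]
    (g : bergman Ω q) (f : bergman Ω p) :
    ‖∫ z in (Ω : Set (Fin n → ℂ)), holoFn f z * conj (holoFn g z)‖ ≤ 1 * ‖g‖ * ‖f‖ := by
  have hf := memLp_holoFn f
  have hg := memLp_holoFn g
  have h1 : eLpNorm (fun z => holoFn f z * conj (holoFn g z)) 1
      (volume.restrict (Ω : Set (Fin n → ℂ))) ≤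
      eLpNorm (holoFn f) p (volume.restrict (Ω : Set (Fin n → ℂ))) *
      eLpNorm (holoFn g) q (volume.restrict (Ω : Set (Fin n → ℂ))) := by
    have := eLpNorm_le_eLpNorm_mul_eLpNorm_of_nnnorm (p := p) (q := q) (r := 1) hf.1 hg.1
      (fun a b : ℂ => a * conj b) 1 (Eventually.of_forall fun z => by simp)
    simpa using this
  have h2 := ENNReal.toReal_mono (ENNReal.mul_ne_top hf.2.ne hg.2.ne) h1
  rw [ENNReal.toReal_mul, ← norm_eq_eLpNorm_holoFn, ← norm_eq_eLpNorm_holoFn] at h2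
  rw [one_mul, mul_comm]
  refine (norm_integral_le_integral_norm _).trans (le_trans (le_of_eq ?_) h2)
  rw [integral_norm_eq_lintegral_enorm (integrable_mul_conj_holoFn g f).1,
    eLpNorm_one_eq_lintegral_enorm]

/-- The conjugate-linear map `Φ_p : A^q(Ω) → A^p(Ω)'`, `Φ_p(g)(f) = ∫_Ω f conj(g) dV`. -/
noncomputable def Phi {n : ℕ} (Ω : TopologicalSpace.Opens (Fin n → ℂ)) (p q : ℝ≥0∞)
    [Fact (1 ≤ p)] [Fact (1 ≤ q)] [ENNReal.HolderConjugate p q] :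
    bergman Ω q →SL[starRingEnd ℂ] StrongDual ℂ (bergman Ω p) :=
  LinearMap.mkContinuous₂
    (LinearMap.mk₂'ₛₗ (starRingEnd ℂ) (RingHom.id ℂ)
      (fun (g : bergman Ω q) (f : bergman Ω p) =>
        ∫ z in (Ω : Set (Fin n → ℂ)), holoFn f z * conj (holoFn g z))
      (fun g₁ g₂ f => by
        rw [← integral_add (integrable_mul_conj_holoFn g₁ f) (integrable_mul_conj_holoFn g₂ f)]
        simp [holoFn_add, mul_add])
      (fun c g f => by
        rw [smul_eq_mul, ← integral_const_mul]
        simp [holoFn_smul, mul_left_comm])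
      (fun g f₁ f₂ => by
        rw [← integral_add (integrable_mul_conj_holoFn g f₁) (integrable_mul_conj_holoFn g f₂)]
        simp [holoFn_add, add_mul])
      (fun c g f => by
        rw [RingHom.id_apply, smul_eq_mul, ← integral_const_mul]
        simp [holoFn_smul, mul_assoc]))
    1 norm_integral_mul_conj_holoFn_le

theorem Phi_apply {n : ℕ} (Ω : TopologicalSpace.Opens (Fin n → ℂ)) (p q : ℝ≥0∞)
    [Fact (1 ≤ p)] [Fact (1 ≤ q)] [ENNReal.HolderConjugate p q]
    (g : bergman Ω q) (f : bergman Ω p) :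
    Phi Ω p q g f = ∫ z in (Ω : Set (Fin n → ℂ)), holoFn f z * conj (holoFn g z) :=
  rfl

end ReinhardtDuality

open ReinhardtDuality

/-! Everything rests on the torus acting on `L^r`, `r < ∞`, by rotation of the coordinates. The
action is isometric and strongly continuous, so each `f` has Fourier components, and Hahn–Banach
puts `f` in their closed linear span (`mem_closure_span_mFourierCoeff`). For `f ∈ A^r` the component
of index `α` is `a_α(f) e_α`, because a holomorphic function that transforms like `e_α` is a
multiple of it (`exists_eq_const_mul_monomialFn`). Hence `a_α` is bounded, and a nonzero value of
`a_α` on `A^r` forces `α` to be `L^r`-allowable (`allowable_of_coeffL_ne_zero`). Closed spans of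
monomials are therefore described by vanishing coefficients. The component projections are
self-adjoint for the pairing of `L^q` with `L^p`, so for `L^p`-allowable `α` the number
`Φ_p(g)(e_α)` is a nonzero multiple of `conj a_α(g)`. This gives both `ker Φ_p = N^{q,p}` and the
injectivity of `Φ_p` on `G^{q,p}`.

Surjectivity is the analytic point. A functional on `A^p` has the form `f ↦ ∫ f conj(u)` with `u ∈
L^q` (`exists_pairing_eq_of_two_le`), where `u` need not be holomorphic. For `u ∈ L^2`, replacing
`u` by its sub-Bergman projection leaves the functional unchanged, since `A^p` lies in the range of
the projection. The hypothesis on the absolute kernel bounds the projection in the `L^p` norm, and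
self-adjointness turns this into an `L^q` bound on `L^2` (`norm_projIncl_le`). As `L^2` is dense in
`L^q`, a limit handles all `u` and stays in `G^{q,p}`. The open mapping theorem gives the
homeomorphisms, and the conjugation `g ↦ conj (g (conj z))` makes one of them linear.

For the decomposition, `Φ_p` followed by the inverse of its restriction to `G^{q,p}` is a bounded
projection `Q` of `A^q` onto `G^{q,p}`. Its adjoint is a bounded idempotent of the dual of `A^q`,
and the two summands are its range and kernel. Functionals on `A^q` are represented by some `h ∈
L^p`. Projecting `h` yields an `F ∈ A^p` with the same values on `G^{q,p}`, which identifies the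
range. Approximating `h` in `L^p` by combinations of its components yields norm approximation by
coefficient functionals, which identifies the kernel. -/

namespace ReinhardtDuality

/-- Normalized Haar measure on the unit circle, as used for Fourier coefficients. -/
@[reducible] noncomputable def circleMeasureSpace : MeasureSpace UnitAddCircle :=
  ⟨AddCircle.haarAddCircle⟩

attribute [local instance] circleMeasureSpace

theorem circle_isAddHaarMeasure : Measure.IsAddHaarMeasure (volume : Measure UnitAddCircle) :=
  inferInstanceAs (Measure.IsAddHaarMeasure AddCircle.haarAddCircle)

theorem circle_isProbabilityMeasure : IsProbabilityMeasure (volume : Measure UnitAddCircle) :=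
  inferInstanceAs (IsProbabilityMeasure AddCircle.haarAddCircle)

attribute [local instance] circle_isAddHaarMeasure circle_isProbabilityMeasure

open UnitAddTorus

/-! ### Fourier coefficients of vector-valued functions on the torus -/

section Fourier

variable {d : Type*} [Fintype d] {X Y : Type*} [NormedAddCommGroup X] [NormedSpace ℂ X]
  [NormedAddCommGroup Y] [NormedSpace ℂ Y]

/-- Hahn–Banach in the normed quotient by `V`, where the class of `x` is nonzero. -/
theorem exists_dual_of_notMem_of_isClosed {V : Submodule ℂ X} (hV : IsClosed (V : Set X)) {x : X}
    (hx : x ∉ V) : ∃ φ : StrongDual ℂ X, (∀ v ∈ V, φ v = 0) ∧ φ x ≠ 0 := by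
  have : IsClosed (V : Set X) := hV
  have h : V.mkQ x ≠ 0 := by simpa using hx
  obtain ⟨φ, hφ⟩ := SeparatingDual.exists_ne_zero (R := ℂ) h
  refine ⟨φ.comp V.mkQL, fun v hv => ?_, hφ⟩
  have : V.mkQ v = 0 := by simpa using hv
  simp [this]

omit [NormedSpace ℂ X] in
theorem integrable_torus {F : UnitAddTorus d → X} (hF : Continuous F) :
    Integrable F (volume : Measure (UnitAddTorus d)) :=
  hF.integrable_of_hasCompactSupport (HasCompactSupport.of_compactSpace F)

theorem integrable_mFourier_smul {F : UnitAddTorus d → X} (hF : Continuous F) (α : d → ℤ) :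
    Integrable (fun t => mFourier α t • F t) (volume : Measure (UnitAddTorus d)) :=
  integrable_torus ((map_continuous _).smul hF)

theorem map_mFourierCoeff [CompleteSpace X] [CompleteSpace Y] (φ : X →L[ℂ] Y)
    {F : UnitAddTorus d → X} (hF : Continuous F) (α : d → ℤ) :
    φ (mFourierCoeff F α) = mFourierCoeff (fun t => φ (F t)) α := by
  unfold mFourierCoeff
  rw [← ContinuousLinearMap.integral_comp_comm _ (integrable_mFourier_smul hF _)]
  simp

theorem norm_mFourierCoeff_le {F : UnitAddTorus d → X} {C : ℝ} (hF : ∀ t, ‖F t‖ ≤ C)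
    (α : d → ℤ) : ‖mFourierCoeff F α‖ ≤ C := by
  unfold mFourierCoeff
  refine (norm_integral_le_of_norm_le_const (C := C) (Eventually.of_forall fun t => ?_)).trans ?_
  · rw [norm_smul]
    have h1 : ‖mFourier (-α) t‖ ≤ 1 := ((mFourier (-α)).norm_coe_le_norm t).trans mFourier_norm.le
    calc _ ≤ 1 * ‖F t‖ := by gcongr
      _ ≤ C := by simpa using hF t
  · simp

theorem mFourierCoeff_add {F G : UnitAddTorus d → X} (hF : Continuous F) (hG : Continuous G)
    (α : d → ℤ) :
    mFourierCoeff (fun t => F t + G t) α = mFourierCoeff F α + mFourierCoeff G α := by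
  unfold mFourierCoeff
  rw [← integral_add (integrable_mFourier_smul hF _) (integrable_mFourier_smul hG _)]
  simp only [smul_add]

theorem mFourierCoeff_const_smul (c : ℂ) (F : UnitAddTorus d → X) (α : d → ℤ) :
    mFourierCoeff (fun t => c • F t) α = c • mFourierCoeff F α := by
  unfold mFourierCoeff
  rw [← integral_smul]
  simp only [smul_comm c]

/-- The values of a continuous function on the torus lie in the closed linear span of its
Fourier coefficients. -/
theorem mem_closure_span_mFourierCoeff [CompleteSpace X] {F : UnitAddTorus d → X}
    (hF : Continuous F) (t : UnitAddTorus d) :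
    F t ∈ (Submodule.span ℂ (Set.range (mFourierCoeff F))).topologicalClosure := by
  by_contra h
  obtain ⟨φ, hφ, hne⟩ :=
    exists_dual_of_notMem_of_isClosed (Submodule.isClosed_topologicalClosure _) h
  -- The scalar function `φ ∘ F` has only zero Fourier coefficients. They are trivially summable, so
  -- its Fourier series converges to it pointwise and it vanishes, against `φ (F t) ≠ 0`.
  have h0 : ∀ α, mFourierCoeff (fun s => φ (F s)) α = 0 := fun α => by
    rw [← map_mFourierCoeff φ hF]
    exact hφ _ (Submodule.le_topologicalClosure _ (Submodule.subset_span ⟨α, rfl⟩))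
  let f : C(UnitAddTorus d, ℂ) := ⟨fun s => φ (F s), by fun_prop⟩
  have h1 : mFourierCoeff f = 0 := funext h0
  have h2 := hasSum_mFourier_series_apply_of_summable (f := f) (by rw [h1]; exact summable_zero) t
  rw [h1] at h2
  simp only [Pi.zero_apply, zero_smul] at h2
  exact hne (h2.unique hasSum_zero)

theorem mFourier_add_apply (α : d → ℤ) (s t : UnitAddTorus d) :
    mFourier α (s + t) = mFourier α s * mFourier α t := by
  simp [mFourier, fourier_apply, AddCircle.toCircle_add, smul_add, Finset.prod_mul_distrib]

theorem mFourier_neg_apply (α : d → ℤ) (t : UnitAddTorus d) :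
    mFourier (-α) t = mFourier α (-t) := by
  simp [mFourier, fourier_apply]

theorem mFourier_apply_zero (α : d → ℤ) : mFourier α (0 : UnitAddTorus d) = 1 := by
  simp [mFourier]

/-- Invariance of Haar measure. This is what makes a Fourier component transform under rotations by
the character `α`. -/
theorem mFourierCoeff_translate (F : UnitAddTorus d → X) (s : UnitAddTorus d) (α : d → ℤ) :
    mFourierCoeff (fun t => F (t + s)) α = mFourier α s • mFourierCoeff F α := by
  unfold mFourierCoeff
  rw [← integral_add_right_eq_self (fun t => mFourier (-α) t • F t) s, ← integral_smul]
  congr 1 with t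
  rw [smul_smul, mFourier_add_apply, ← mul_assoc, mul_right_comm, mFourier_neg_apply _ s,
    ← mFourier_add_apply α s (-s)]
  simp [mFourier_apply_zero]

theorem mFourierCoeff_mFourier_smul [CompleteSpace X] (x : X) (α β : d → ℤ) :
    mFourierCoeff (fun t => mFourier β t • x) α = if α = β then x else 0 := by
  unfold mFourierCoeff
  have h1 := orthonormal_iff_ite.1 (orthonormal_mFourier (d := d)) α β
  have h2 : ∫ t : UnitAddTorus d, mFourier (-α) t * mFourier β t = if α = β then 1 else 0 := by
    rw [← h1, ContinuousMap.inner_toLp]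
    simp only [← mFourier_neg, mul_comm]
  simp only [smul_smul]
  rw [integral_smul_const, h2]
  split_ifs <;> simp

end Fourier

/-! ### The pairing of `L^q` with `L^p`, and inclusions between `L^r` spaces -/

section Pairing

variable {X : Type*} [MeasurableSpace X] {μ : Measure X} {p q : ℝ≥0∞}

theorem norm_integral_mul_conj_le [ENNReal.HolderConjugate p q] {f h : X → ℂ}
    (hf : MemLp f p μ) (hh : MemLp h q μ) :
    ‖∫ x, f x * conj (h x) ∂μ‖ ≤ (eLpNorm f p μ).toReal * (eLpNorm h q μ).toReal := by
  have h1 : eLpNorm (fun x => f x * conj (h x)) 1 μ ≤ eLpNorm f p μ * eLpNorm h q μ := by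
    have := eLpNorm_le_eLpNorm_mul_eLpNorm_of_nnnorm (p := p) (q := q) (r := 1) hf.1 hh.1
      (fun a b : ℂ => a * conj b) 1 (Eventually.of_forall fun z => by simp)
    simpa using this
  have h2 := ENNReal.toReal_mono (ENNReal.mul_ne_top hf.2.ne hh.2.ne) h1
  rw [ENNReal.toReal_mul] at h2
  refine (norm_integral_le_integral_norm _).trans (le_trans (le_of_eq ?_) h2)
  have h3 : Integrable (fun x => f x * conj (h x)) μ := hf.integrable_mul hh.star
  rw [integral_norm_eq_lintegral_enorm h3.1, eLpNorm_one_eq_lintegral_enorm]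

theorem integrable_mul_conj [ENNReal.HolderConjugate p q] {f h : X → ℂ}
    (hf : MemLp f p μ) (hh : MemLp h q μ) : Integrable (fun x => f x * conj (h x)) μ :=
  hf.integrable_mul hh.star

variable (μ p q) in
/-- The conjugate-linear pairing `h ↦ (f ↦ ∫ f conj(h) dμ)` of `L^q` into the dual of `L^p`. -/
noncomputable def pairing [Fact (1 ≤ p)] [Fact (1 ≤ q)] [ENNReal.HolderConjugate p q] :
    Lp ℂ q μ →SL[starRingEnd ℂ] StrongDual ℂ (Lp ℂ p μ) :=
  LinearMap.mkContinuous₂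
    (LinearMap.mk₂'ₛₗ (starRingEnd ℂ) (RingHom.id ℂ)
      (fun (h : Lp ℂ q μ) (f : Lp ℂ p μ) => ∫ x, f x * conj (h x) ∂μ)
      (fun h₁ h₂ f => by
        rw [← integral_add (integrable_mul_conj (Lp.memLp f) (Lp.memLp h₁))
          (integrable_mul_conj (Lp.memLp f) (Lp.memLp h₂))]
        refine integral_congr_ae ?_
        filter_upwards [Lp.coeFn_add h₁ h₂] with x hx
        rw [hx, Pi.add_apply, map_add, mul_add])
      (fun c h f => by
        rw [smul_eq_mul, ← integral_const_mul]
        refine integral_congr_ae ?_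
        filter_upwards [Lp.coeFn_smul c h] with x hx
        simp [hx, mul_left_comm])
      (fun h f₁ f₂ => by
        rw [← integral_add (integrable_mul_conj (Lp.memLp f₁) (Lp.memLp h))
          (integrable_mul_conj (Lp.memLp f₂) (Lp.memLp h))]
        refine integral_congr_ae ?_
        filter_upwards [Lp.coeFn_add f₁ f₂] with x hx
        rw [hx, Pi.add_apply, add_mul])
      (fun c h f => by
        rw [RingHom.id_apply, smul_eq_mul, ← integral_const_mul]
        refine integral_congr_ae ?_
        filter_upwards [Lp.coeFn_smul c f] with x hx
        simp [hx, mul_assoc]))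
    1 (fun h f => by
      rw [one_mul, mul_comm]
      exact norm_integral_mul_conj_le (Lp.memLp f) (Lp.memLp h))

theorem pairing_apply [Fact (1 ≤ p)] [Fact (1 ≤ q)] [ENNReal.HolderConjugate p q]
    (h : Lp ℂ q μ) (f : Lp ℂ p μ) : pairing μ p q h f = ∫ x, f x * conj (h x) ∂μ := rfl

theorem pairing_conj [Fact (1 ≤ p)] [Fact (1 ≤ q)] [ENNReal.HolderConjugate p q]
    [ENNReal.HolderConjugate q p] (h : Lp ℂ q μ) (f : Lp ℂ p μ) :
    pairing μ q p f h = conj (pairing μ p q h f) := by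
  rw [pairing_apply, pairing_apply, ← integral_conj]
  congr 1 with x
  simp [mul_comm]

/-- `x ↦ |x|^(s-2) x`, the duality map of exponent `s`. -/
noncomputable def dualPow (s : ℝ) (x : ℂ) : ℂ := ((‖x‖ ^ (s - 2) : ℝ) : ℂ) * x

theorem norm_dualPow {s : ℝ} (hs : 1 < s) (x : ℂ) : ‖dualPow s x‖ = ‖x‖ ^ (s - 1) := by
  rcases eq_or_ne x 0 with rfl | hx
  · simp [dualPow, Real.zero_rpow (by linarith : s - 1 ≠ 0)]
  have hx' : 0 < ‖x‖ := norm_pos_iff.2 hx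
  rw [dualPow, norm_mul, Complex.norm_real, Real.norm_of_nonneg (by positivity)]
  nth_rw 2 [← Real.rpow_one ‖x‖]
  rw [← Real.rpow_add hx']
  congr 1; ring

theorem dualPow_mul_conj {s : ℝ} (hs : 1 < s) (x : ℂ) :
    dualPow s x * conj x = ((‖x‖ ^ s : ℝ) : ℂ) := by
  rcases eq_or_ne x 0 with rfl | hx
  · simp [dualPow, Real.zero_rpow (by linarith : s ≠ 0)]
  have hx' : 0 < ‖x‖ := norm_pos_iff.2 hx
  rw [dualPow, mul_assoc, Complex.mul_conj, Complex.normSq_eq_norm_sq, ← Complex.ofReal_mul,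
    ← Real.rpow_natCast ‖x‖ 2, ← Real.rpow_add hx']
  congr 2; norm_num

theorem measurable_dualPow (s : ℝ) : Measurable (dualPow s) := by
  unfold dualPow; fun_prop

theorem one_lt_toReal_of_holderConjugate [h : ENNReal.HolderConjugate p q] (hp : p ≠ ⊤)
    (hq : q ≠ ⊤) : 1 < p.toReal := by
  have h1 : 1 < p := (ENNReal.HolderConjugate.lt_top_iff_one_lt q p).1 hq.lt_top
  simpa using (ENNReal.toReal_lt_toReal ENNReal.one_ne_top hp).2 h1

theorem toReal_holderConjugate [h : ENNReal.HolderConjugate p q] (hp : p ≠ ⊤) (hq : q ≠ ⊤) :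
    p.toReal.HolderConjugate q.toReal :=
  ENNReal.HolderConjugate.toReal (one_lt_toReal_of_holderConjugate hp hq)

theorem integral_norm_rpow_eq {h : X → ℂ} (hh : MemLp h p μ) (hp0 : p ≠ 0) (hp : p ≠ ⊤) :
    ∫ x, ‖h x‖ ^ p.toReal ∂μ = (eLpNorm h p μ).toReal ^ p.toReal := by
  have h0 : 0 ≤ ∫ x, ‖h x‖ ^ p.toReal ∂μ := integral_nonneg fun x => by positivity
  rw [hh.eLpNorm_eq_integral_rpow_norm hp0 hp, ENNReal.toReal_ofReal (by positivity),
    ← Real.rpow_mul h0, inv_mul_cancel₀ (ENNReal.toReal_ne_zero.2 ⟨hp0, hp⟩), Real.rpow_one]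

theorem memLp_dualPow [ENNReal.HolderConjugate p q] (hp : p ≠ ⊤) (hq : q ≠ ⊤) {h : X → ℂ}
    (hh : MemLp h p μ) : MemLp (fun x => dualPow p.toReal (h x)) q μ := by
  have hpq := toReal_holderConjugate hp hq
  have h1 : AEStronglyMeasurable (fun x => dualPow p.toReal (h x)) μ :=
    ((measurable_dualPow _).comp_aemeasurable hh.1.aemeasurable).aestronglyMeasurable
  have hp0 : p ≠ 0 := ENNReal.HolderConjugate.ne_zero p q
  have hq0 : q ≠ 0 := ENNReal.HolderConjugate.ne_zero q p
  rw [← integrable_norm_rpow_iff h1 hq0 hq]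
  refine (hh.integrable_norm_rpow hp0 hp).congr (Eventually.of_forall fun x => ?_)
  simp only
  rw [norm_dualPow hpq.lt, ← Real.rpow_mul (norm_nonneg _), hpq.sub_one_mul_conj]

/-- Since `(p - 1) q = p`, the integral of the `q`-th power of `dualPow` is that of the `p`-th power
of `h`; the exponent comes from `p / q = p - 1`. -/
theorem toReal_eLpNorm_dualPow [ENNReal.HolderConjugate p q] (hp : p ≠ ⊤) (hq : q ≠ ⊤)
    {h : X → ℂ} (hh : MemLp h p μ) :
    (eLpNorm (fun x => dualPow p.toReal (h x)) q μ).toReal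
      = (eLpNorm h p μ).toReal ^ (p.toReal - 1) := by
  have hpq := toReal_holderConjugate hp hq
  have hp0 : p ≠ 0 := ENNReal.HolderConjugate.ne_zero p q
  have hq0 : q ≠ 0 := ENNReal.HolderConjugate.ne_zero q p
  have h1 := integral_norm_rpow_eq (memLp_dualPow hp hq hh) hq0 hq
  have h2 := integral_norm_rpow_eq hh hp0 hp
  have h3 : ∀ x, ‖dualPow p.toReal (h x)‖ ^ q.toReal = ‖h x‖ ^ p.toReal := fun x => by
    rw [norm_dualPow hpq.lt, ← Real.rpow_mul (norm_nonneg _), hpq.sub_one_mul_conj]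
  simp only [h3] at h1
  rw [h2] at h1
  have h4 := congrArg (fun t : ℝ => t ^ q.toReal⁻¹) h1
  rw [Real.rpow_rpow_inv ENNReal.toReal_nonneg hpq.symm.ne_zero,
    ← Real.rpow_mul ENNReal.toReal_nonneg] at h4
  rw [← h4]
  congr 1
  have h5 := hpq.div_conj_eq_sub_one
  rw [div_eq_mul_inv] at h5
  exact h5

theorem integral_dualPow_mul_conj [ENNReal.HolderConjugate p q] (hp : p ≠ ⊤) (hq : q ≠ ⊤)
    {h : X → ℂ} (hh : MemLp h p μ) :
    ∫ x, dualPow p.toReal (h x) * conj (h x) ∂μ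
      = (((eLpNorm h p μ).toReal ^ p.toReal : ℝ) : ℂ) := by
  have hp1 := one_lt_toReal_of_holderConjugate (q := q) hp hq
  rw [← integral_norm_rpow_eq hh (ENNReal.HolderConjugate.ne_zero p q) hp,
    ← integral_complex_ofReal]
  congr 1 with x
  exact dualPow_mul_conj hp1 _

/-- If the duality function of `h` satisfies the estimate of a norming functional, then the
norm of `h` is bounded accordingly. -/
theorem toReal_eLpNorm_le_of_dualPow [ENNReal.HolderConjugate p q] (hp : p ≠ ⊤) (hq : q ≠ ⊤)
    {h : X → ℂ} (hh : MemLp h p μ) {C : ℝ}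
    (hC0 : 0 ≤ C)
    (hC : ‖∫ x, dualPow p.toReal (h x) * conj (h x) ∂μ‖
      ≤ C * (eLpNorm (fun x => dualPow p.toReal (h x)) q μ).toReal) :
    (eLpNorm h p μ).toReal ≤ C := by
  have hp1 := one_lt_toReal_of_holderConjugate (q := q) hp hq
  rw [integral_dualPow_mul_conj hp hq hh, toReal_eLpNorm_dualPow hp hq hh, Complex.norm_real,
    Real.norm_of_nonneg (by positivity)] at hC
  set N := (eLpNorm h p μ).toReal with hN
  have hN0 : 0 ≤ N := ENNReal.toReal_nonneg
  rcases hN0.eq_or_lt with h0 | h0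
  · rw [← h0]; exact hC0
  -- The hypothesis now reads `N ^ p ≤ C * N ^ (p - 1)` with `N > 0`, so the common factor cancels.
  have : N ^ p.toReal = N * N ^ (p.toReal - 1) := by
    rw [← Real.rpow_one_add' hN0 (by linarith)]; congr 1; ring
  rw [this] at hC
  exact le_of_mul_le_mul_right hC (by positivity)

/-- The converse of Hölder's inequality: it suffices to test against bounded functions. -/
theorem eLpNorm_le_of_forall_bounded [IsFiniteMeasure μ] [ENNReal.HolderConjugate p q]
    (hp : p ≠ ⊤) (hq : q ≠ ⊤) {h : X → ℂ} (hh : AEStronglyMeasurable h μ) {C : ℝ} (hC0 : 0 ≤ C)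
    (hC : ∀ u : X → ℂ, MemLp u ⊤ μ → ‖∫ x, u x * conj (h x) ∂μ‖ ≤ C * (eLpNorm u q μ).toReal) :
    eLpNorm h p μ ≤ ENNReal.ofReal C := by
  wlog hm : StronglyMeasurable h generalizing h
  · rw [eLpNorm_congr_ae hh.ae_eq_mk]
    refine this hh.stronglyMeasurable_mk.aestronglyMeasurable (fun u hu => ?_)
      hh.stronglyMeasurable_mk
    convert hC u hu using 2
    refine integral_congr_ae ?_
    filter_upwards [hh.ae_eq_mk] with x hx
    rw [hx]
  have hp1 := one_lt_toReal_of_holderConjugate (q := q) hp hq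
  -- Truncation: `g m` is `h` where `‖h‖ ≤ m` and `0` elsewhere. Its duality function is bounded,
  -- hence an admissible test function, and Fatou's lemma carries the uniform bound over to `h`.
  let E : ℕ → Set X := fun m => {x | ‖h x‖ ≤ m}
  have hE : ∀ m, MeasurableSet (E m) := fun m =>
    measurableSet_le hm.norm.measurable measurable_const
  let g : ℕ → X → ℂ := fun m => (E m).indicator h
  have hg_meas : ∀ m, AEStronglyMeasurable (g m) μ := fun m => (hm.indicator (hE m)).aestronglyMeasurable
  have hg_bd : ∀ m x, ‖g m x‖ ≤ m := by
    intro m x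
    by_cases hx : x ∈ E m
    · have : ‖h x‖ ≤ m := hx
      simpa [g, hx] using this
    · simp [g, hx]
  have hg : ∀ m (r : ℝ≥0∞), MemLp (g m) r μ := fun m r =>
    MemLp.of_bound (hg_meas m) m (Eventually.of_forall (hg_bd m))
  have hle : ∀ m, eLpNorm (g m) p μ ≤ ENNReal.ofReal C := by
    intro m
    rw [← ENNReal.toReal_le_toReal (hg m p).2.ne ENNReal.ofReal_ne_top, ENNReal.toReal_ofReal hC0]
    refine toReal_eLpNorm_le_of_dualPow hp hq (hg m p) hC0 ?_
    have hu : MemLp (fun x => dualPow p.toReal (g m x)) ⊤ μ := by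
      refine MemLp.of_bound ((measurable_dualPow _).comp_aemeasurable
        (hg_meas m).aemeasurable).aestronglyMeasurable ((m : ℝ) ^ (p.toReal - 1))
        (Eventually.of_forall fun x => ?_)
      rw [norm_dualPow hp1]
      exact Real.rpow_le_rpow (norm_nonneg _) (hg_bd m x) (by linarith)
    -- The test function vanishes off `E m`, so pairing it with `g m` or with `h` gives the same
    -- integral.
    convert hC _ hu using 4 with x
    by_cases hx : x ∈ E m
    · simp [g, hx]
    · simp [g, hx, dualPow]
  have hlim := Lp.eLpNorm_lim_le_liminf_eLpNorm (p := p) hg_meas h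
    (Eventually.of_forall fun x => by
      refine tendsto_const_nhds.congr' ?_
      obtain ⟨N, hN⟩ := exists_nat_ge ‖h x‖
      filter_upwards [eventually_ge_atTop N] with m hm'
      have hx : x ∈ E m := hN.trans (by exact_mod_cast hm')
      simp [g, hx])
  refine hlim.trans ?_
  refine liminf_le_of_le (by isBoundedDefault) fun b hb => ?_
  obtain ⟨m, hm'⟩ := hb.exists
  exact hm'.trans (hle m)

/-- On a finite measure space, the inclusion of `L^r` into `L^s` for `s ≤ r`. -/
noncomputable def lpIncl (μ : Measure X) [IsFiniteMeasure μ] (r s : ℝ≥0∞) [Fact (1 ≤ r)]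
    [Fact (1 ≤ s)] (hsr : s ≤ r) : Lp ℂ r μ →L[ℂ] Lp ℂ s μ :=
  LinearMap.mkContinuousOfExistsBound
    { toFun := fun f => ((Lp.memLp f).mono_exponent hsr).toLp f
      map_add' := fun f g => by
        rw [← MemLp.toLp_add]
        exact MemLp.toLp_congr _ _ (Lp.coeFn_add f g)
      map_smul' := fun c f => by
        rw [RingHom.id_apply, ← MemLp.toLp_const_smul]
        exact MemLp.toLp_congr _ _ (Lp.coeFn_smul c f) }
    ⟨(μ Set.univ ^ (1 / s.toReal - 1 / r.toReal)).toReal, fun f => by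
      have hs : s ≠ 0 := (zero_lt_one.trans_le Fact.out).ne'
      have h1 := eLpNorm_le_eLpNorm_mul_rpow_measure_univ hsr (Lp.aestronglyMeasurable f)
      have hfin : μ Set.univ ^ (1 / s.toReal - 1 / r.toReal) ≠ ⊤ := by
        refine ENNReal.rpow_ne_top_of_nonneg ?_ (measure_ne_top _ _)
        rcases eq_or_ne r ⊤ with rfl | hr
        · simp
        · have h3 : s.toReal ≤ r.toReal := ENNReal.toReal_mono hr hsr
          have h4 : 0 < s.toReal := ENNReal.toReal_pos hs (ne_top_of_le_ne_top hr hsr)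
          exact sub_nonneg.2 (one_div_le_one_div_of_le h4 h3)
      have h2 := ENNReal.toReal_mono (ENNReal.mul_ne_top (Lp.memLp f).2.ne hfin) h1
      rw [ENNReal.toReal_mul, mul_comm] at h2
      refine (Lp.norm_toLp f ((Lp.memLp f).mono_exponent hsr)).trans_le ?_
      rw [Lp.norm_def]
      exact h2⟩

theorem lpIncl_ae_eq [IsFiniteMeasure μ] (r s : ℝ≥0∞) [Fact (1 ≤ r)]
    [Fact (1 ≤ s)] (hsr : s ≤ r) (f : Lp ℂ r μ) : lpIncl μ r s hsr f =ᵐ[μ] f :=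
  MemLp.coeFn_toLp ((Lp.memLp f).mono_exponent hsr)

/-- On a finite measure space the simple functions, dense in `L^s`, already lie in `L^r`. -/
theorem denseRange_lpIncl [IsFiniteMeasure μ] (r s : ℝ≥0∞) [Fact (1 ≤ r)]
    [Fact (1 ≤ s)] (hsr : s ≤ r) (hs : s ≠ ⊤) : DenseRange (lpIncl μ r s hsr) := by
  refine (Lp.simpleFunc.dense (E := ℂ) (μ := μ) hs).mono ?_
  rintro f hf
  obtain ⟨g, rfl⟩ : ∃ g : Lp.simpleFunc ℂ s μ, (g : Lp ℂ s μ) = f := ⟨⟨f, hf⟩, rfl⟩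
  have hg : MemLp (Lp.simpleFunc.toSimpleFunc g) r μ := SimpleFunc.memLp_of_isFiniteMeasure _ _ _
  refine ⟨hg.toLp _, Lp.ext ?_⟩
  exact ((lpIncl_ae_eq r s hsr _).trans hg.coeFn_toLp).trans (Lp.simpleFunc.toSimpleFunc_eq_toFun g)

end Pairing

/-! ### Riesz representation on subspaces of `L^p` -/

section Riesz

/-- Clarkson's inequality for complex numbers. -/
theorem clarkson_complex {P : ℝ} (hP : 2 ≤ P) (a b : ℂ) :
    ‖(1 / 2 : ℝ) • (a + b)‖ ^ P + ‖(1 / 2 : ℝ) • (a - b)‖ ^ P ≤ (‖a‖ ^ P + ‖b‖ ^ P) / 2 := by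
  have hs : 1 ≤ P / 2 := by linarith
  have key : ∀ x : ℂ, ‖x‖ ^ P = (‖x‖ ^ 2) ^ (P / 2) := fun x => by
    rw [← Real.rpow_natCast, ← Real.rpow_mul (norm_nonneg _)]; congr 1; push_cast; ring
  have hpar : ‖(1 / 2 : ℝ) • (a + b)‖ ^ 2 + ‖(1 / 2 : ℝ) • (a - b)‖ ^ 2
      = 1 / 2 * ‖a‖ ^ 2 + 1 / 2 * ‖b‖ ^ 2 := by
    have := parallelogram_law_with_norm ℝ a b
    rw [norm_smul, norm_smul, Real.norm_of_nonneg (by norm_num : (0 : ℝ) ≤ 1 / 2)]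
    nlinarith
  rw [key, key, key a, key b]
  -- With `s = P / 2 ≥ 1`: superadditivity of `t ↦ t ^ s`, the parallelogram law, and convexity of
  -- `t ↦ t ^ s`.
  calc _ ≤ (‖(1 / 2 : ℝ) • (a + b)‖ ^ 2 + ‖(1 / 2 : ℝ) • (a - b)‖ ^ 2) ^ (P / 2) :=
        Real.add_rpow_le_rpow_add (by positivity) (by positivity) hs
    _ ≤ 1 / 2 * (‖a‖ ^ 2) ^ (P / 2) + 1 / 2 * (‖b‖ ^ 2) ^ (P / 2) := by
        rw [hpar]
        exact (convexOn_rpow hs).2 (Set.mem_Ici.2 (by positivity)) (Set.mem_Ici.2 (by positivity))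
          (by norm_num) (by norm_num) (by norm_num)
    _ = _ := by ring

variable {X : Type*} [MeasurableSpace X] {μ : Measure X} {p q : ℝ≥0∞}

theorem norm_rpow_eq_integral [Fact (1 ≤ p)] (hp : p ≠ ⊤) (f : Lp ℂ p μ) :
    ‖f‖ ^ p.toReal = ∫ x, ‖f x‖ ^ p.toReal ∂μ := by
  rw [integral_norm_rpow_eq (Lp.memLp f) (zero_lt_one.trans_le Fact.out).ne' hp, Lp.norm_def]

theorem integrable_norm_rpow_Lp [Fact (1 ≤ p)] (hp : p ≠ ⊤) (f : Lp ℂ p μ) :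
    Integrable (fun x => ‖f x‖ ^ p.toReal) μ :=
  (Lp.memLp f).integrable_norm_rpow (zero_lt_one.trans_le Fact.out).ne' hp

/-- Clarkson's inequality for `L^p`, `2 ≤ p < ∞`. -/
theorem clarkson_Lp [Fact (1 ≤ p)] (hp2 : 2 ≤ p) (hp : p ≠ ⊤) (f g : Lp ℂ p μ) :
    ‖(1 / 2 : ℝ) • (f + g)‖ ^ p.toReal + ‖(1 / 2 : ℝ) • (f - g)‖ ^ p.toReal
      ≤ (‖f‖ ^ p.toReal + ‖g‖ ^ p.toReal) / 2 := by
  have h2 : 2 ≤ p.toReal := by simpa using ENNReal.toReal_mono hp hp2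
  simp only [norm_rpow_eq_integral hp]
  rw [← integral_add (integrable_norm_rpow_Lp hp _) (integrable_norm_rpow_Lp hp _),
    ← integral_add (integrable_norm_rpow_Lp hp _) (integrable_norm_rpow_Lp hp _),
    ← integral_div]
  refine integral_mono_ae ((integrable_norm_rpow_Lp hp _).add (integrable_norm_rpow_Lp hp _))
    (((integrable_norm_rpow_Lp hp _).add (integrable_norm_rpow_Lp hp _)).div_const 2) ?_
  filter_upwards [Lp.coeFn_smul (1 / 2 : ℝ) (f + g), Lp.coeFn_smul (1 / 2 : ℝ) (f - g),
    Lp.coeFn_add f g, Lp.coeFn_sub f g] with x h3 h4 h5 h6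
  simp only [Pi.add_apply, h3, h4, Pi.smul_apply, h5, h6, Pi.sub_apply]
  exact clarkson_complex h2 _ _

/-- In a space satisfying Clarkson's inequality, `‖f‖^P / P - φ f` attains its minimum. -/
theorem exists_forall_rpow_sub_le {E : Type*} [NormedAddCommGroup E] [NormedSpace ℝ E]
    [CompleteSpace E] {P : ℝ} (hP : 1 < P)
    (hcl : ∀ f g : E, ‖(1 / 2 : ℝ) • (f + g)‖ ^ P + ‖(1 / 2 : ℝ) • (f - g)‖ ^ P
      ≤ (‖f‖ ^ P + ‖g‖ ^ P) / 2) (φ : E →L[ℝ] ℝ) :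
    ∃ f, ∀ g, ‖f‖ ^ P / P - φ f ≤ ‖g‖ ^ P / P - φ g := by
  have hP0 : 0 < P := by linarith
  set J : E → ℝ := fun f => ‖f‖ ^ P / P - φ f with hJ
  have hJc : Continuous J := by
    have : Continuous fun f : E => ‖f‖ ^ P :=
      continuous_norm.rpow_const fun _ => Or.inr hP0.le
    exact (this.div_const P).sub φ.continuous
  -- Young's inequality absorbs `φ f ≤ ‖f‖ ‖φ‖` into `‖f‖ ^ P / P` plus a constant.
  have hbdd : BddBelow (Set.range J) := by
    have hc := Real.HolderConjugate.conjExponent hP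
    refine ⟨-(‖φ‖ ^ P.conjExponent / P.conjExponent), ?_⟩
    rintro _ ⟨f, rfl⟩
    have h1 := (le_abs_self _).trans (φ.le_opNorm f)
    have h2 := Real.young_inequality_of_nonneg (norm_nonneg f) (norm_nonneg φ) hc
    simp only [hJ]
    linarith [mul_comm ‖φ‖ ‖f‖]
  set I := ⨅ f, J f with hI
  have hIle : ∀ f, I ≤ J f := fun f => ciInf_le hbdd f
  have hex : ∀ k : ℕ, ∃ f, J f < I + 1 / ((k : ℝ) + 1) := fun k =>
    exists_lt_of_ciInf_lt (lt_add_of_pos_right _ Nat.one_div_pos_of_nat)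
  choose f hf using hex
  -- Clarkson's inequality at the midpoint: the linear term cancels, `J` at the midpoint is at least
  -- the infimum `I`, and both `J (f k)` and `J (f l)` exceed `I` by at most `1 / (N + 1)`. The
  -- minimizing sequence is therefore Cauchy.
  have hdiff : ∀ N k l : ℕ, N ≤ k → N ≤ l →
      ‖(1 / 2 : ℝ) • (f k - f l)‖ ^ P ≤ P * (1 / ((N : ℝ) + 1)) := by
    intro N k l hk hl
    have h1 := hcl (f k) (f l)
    have h2 := hIle ((1 / 2 : ℝ) • (f k + f l))
    have h3 := (hf k).le.trans (add_le_add le_rfl (Nat.one_div_le_one_div (α := ℝ) hk))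
    have h4 := (hf l).le.trans (add_le_add le_rfl (Nat.one_div_le_one_div (α := ℝ) hl))
    simp only [hJ, map_smul, map_add, smul_eq_mul] at h2 h3 h4
    have h5 : ‖(1 / 2 : ℝ) • (f k - f l)‖ ^ P / P ≤ 1 / ((N : ℝ) + 1) := by
      have h6 : ‖(1 / 2 : ℝ) • (f k + f l)‖ ^ P / P + ‖(1 / 2 : ℝ) • (f k - f l)‖ ^ P / P
          ≤ (‖f k‖ ^ P / P + ‖f l‖ ^ P / P) / 2 := by
        rw [← add_div, ← add_div, div_right_comm]
        gcongr
      linarith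
    rw [div_le_iff₀ hP0] at h5
    linarith
  have hcau : CauchySeq f := by
    refine Metric.cauchySeq_iff.2 fun ε hε => ?_
    obtain ⟨N, hN⟩ := exists_nat_one_div_lt (K := ℝ)
      (show 0 < (ε / 2) ^ P / P by positivity)
    refine ⟨N, fun k hk l hl => ?_⟩
    have h1 := hdiff N k l hk hl
    rw [lt_div_iff₀ hP0, mul_comm] at hN
    have h2 := (Real.rpow_lt_rpow_iff (norm_nonneg _) (by positivity) hP0).1 (h1.trans_lt hN)
    rw [norm_smul, Real.norm_of_nonneg (by norm_num)] at h2
    rw [dist_eq_norm]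
    linarith
  obtain ⟨g, hg⟩ := cauchySeq_tendsto_of_complete hcau
  refine ⟨g, fun u => le_trans ?_ (hIle u)⟩
  have h1 : Tendsto (fun k => J (f k)) atTop (𝓝 (J g)) := (hJc.tendsto g).comp hg
  have h2 : Tendsto (fun k : ℕ => I + 1 / ((k : ℝ) + 1)) atTop (𝓝 (I + 0)) :=
    tendsto_one_div_add_atTop_nhds_zero_nat.const_add I
  rw [add_zero] at h2
  exact le_of_tendsto_of_tendsto' h1 h2 fun k => (hf k).le

/-- Differentiation under the integral sign; for `|t| < 1` the integrable function `p (|f| + |h|) ^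
p` dominates the derivatives. It supplies the Euler–Lagrange equation of the minimization problem.
-/
theorem hasDerivAt_integral_norm_rpow [Fact (1 ≤ p)] (hp1 : 1 < p.toReal) (hp : p ≠ ⊤)
    (f h : Lp ℂ p μ) :
    HasDerivAt (fun t : ℝ => ∫ x, ‖f x + (t : ℂ) * h x‖ ^ p.toReal ∂μ)
      (∫ x, p.toReal * (h x * conj (dualPow p.toReal (f x))).re ∂μ) 0 := by
  set P := p.toReal with hPdef
  have hp0 : p ≠ 0 := (zero_lt_one.trans_le Fact.out).ne'
  have hd : ∀ (a b : ℂ) (t : ℝ), HasDerivAt (fun t : ℝ => ‖a + (t : ℂ) * b‖ ^ P)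
      (P * (b * conj (dualPow P (a + (t : ℂ) * b))).re) t := by
    intro a b t
    have h1 : HasDerivAt (fun t : ℝ => a + (t : ℂ) * b) b t := by
      simpa using ((Complex.ofRealCLM.hasDerivAt (x := t)).mul_const b).const_add a
    have h2 := (hasFDerivAt_norm_rpow (a + (t : ℂ) * b) hp1).comp_hasDerivAt t h1
    refine h2.congr_deriv ?_
    simp only [dualPow, _root_.smul_apply, innerSL_apply_apply, smul_eq_mul,
      Complex.inner, map_mul, Complex.conj_ofReal]
    rw [mul_left_comm b, Complex.re_ofReal_mul, mul_assoc, mul_comm b]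
  have hbound : Integrable (fun x => P * (‖f x‖ + ‖h x‖) ^ P) μ := by
    have h1 : MemLp (fun x => ‖f x‖ + ‖h x‖) p μ := (Lp.memLp f).norm.add (Lp.memLp h).norm
    refine ((h1.integrable_norm_rpow hp0 hp).const_mul P).congr (Eventually.of_forall fun x => ?_)
    simp only
    rw [Real.norm_of_nonneg (by positivity)]
  have hmeas : ∀ t : ℝ, AEStronglyMeasurable (fun x => f x + (t : ℂ) * h x) μ := fun t =>
    (Lp.aestronglyMeasurable f).add ((Lp.aestronglyMeasurable h).const_mul _)
  have := hasDerivAt_integral_of_dominated_loc_of_deriv_le (𝕜 := ℝ) (E := ℝ) (μ := μ)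
    (x₀ := (0 : ℝ)) (s := ball 0 1)
    (F := fun (t : ℝ) x => ‖f x + (t : ℂ) * h x‖ ^ P)
    (F' := fun (t : ℝ) x => P * (h x * conj (dualPow P (f x + (t : ℂ) * h x))).re)
    (bound := fun x => P * (‖f x‖ + ‖h x‖) ^ P) (ball_mem_nhds (0 : ℝ) one_pos)
    (Eventually.of_forall fun t => ((hmeas t).norm.aemeasurable.pow_const P).aestronglyMeasurable)
    (by simpa using integrable_norm_rpow_Lp hp f)
    (by
      have h1 : AEMeasurable (fun x => h x * conj (dualPow P (f x + ((0 : ℝ) : ℂ) * h x))) μ :=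
        (Lp.aestronglyMeasurable h).aemeasurable.mul (Complex.continuous_conj.measurable.comp_aemeasurable
          ((measurable_dualPow P).comp_aemeasurable (hmeas 0).aemeasurable))
      exact ((Complex.measurable_re.comp_aemeasurable h1).const_mul P).aestronglyMeasurable)
    (Eventually.of_forall fun x t ht => by
      have ht' : |t| ≤ 1 := by simpa using (mem_ball_zero_iff.1 ht).le
      rw [norm_mul, Real.norm_of_nonneg (by linarith : 0 ≤ P)]
      refine mul_le_mul_of_nonneg_left ?_ (by linarith)
      refine (Complex.abs_re_le_norm _).trans ?_
      rw [norm_mul, RCLike.norm_conj, norm_dualPow hp1]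
      have h1 : ‖f x + (t : ℂ) * h x‖ ≤ ‖f x‖ + ‖h x‖ := by
        refine (norm_add_le _ _).trans (add_le_add le_rfl ?_)
        rw [norm_mul, Complex.norm_real, Real.norm_eq_abs]
        exact mul_le_of_le_one_left (norm_nonneg _) ht'
      have h0 : 0 ≤ ‖f x‖ + ‖h x‖ := by positivity
      calc ‖h x‖ * ‖f x + (t : ℂ) * h x‖ ^ (P - 1)
          ≤ (‖f x‖ + ‖h x‖) * (‖f x‖ + ‖h x‖) ^ (P - 1) := by
            refine mul_le_mul (by linarith [norm_nonneg (f x)])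
              (Real.rpow_le_rpow (norm_nonneg _) h1 (by linarith)) (by positivity) h0
        _ = (‖f x‖ + ‖h x‖) ^ P := by
            rw [← Real.rpow_one_add' h0 (by linarith)]; congr 1; ring)
    hbound
    (Eventually.of_forall fun x t _ => hd (f x) (h x) t)
  simpa using this.2

/-- The Riesz representation theorem on a closed subspace of `L^p`, `2 ≤ p < ∞`. -/
theorem exists_pairing_eq_of_two_le [Fact (1 ≤ p)] [Fact (1 ≤ q)] [ENNReal.HolderConjugate p q]
    (hp2 : 2 ≤ p) (hp : p ≠ ⊤) (hq : q ≠ ⊤) {V : Submodule ℂ (Lp ℂ p μ)}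
    (hV : IsClosed (V : Set (Lp ℂ p μ))) (φ : StrongDual ℂ V) :
    ∃ h : Lp ℂ q μ, ∀ f : V, φ f = pairing μ p q h f := by
  have h2 : 2 ≤ p.toReal := by simpa using ENNReal.toReal_mono hp hp2
  have hP1 : 1 < p.toReal := by linarith
  have : CompleteSpace V := hV.completeSpace_coe
  obtain ⟨f, hf⟩ := exists_forall_rpow_sub_le (E := V) hP1
    (fun f g => by
      have := clarkson_Lp hp2 hp (f : Lp ℂ p μ) g
      exact this)
    (Complex.reCLM.comp (φ.restrictScalars ℝ))
  have hu := memLp_dualPow (q := q) hp hq (Lp.memLp (f : Lp ℂ p μ))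
  have hre : ∀ g : V, (φ g).re = (pairing μ p q (hu.toLp _) g).re := by
    intro g
    have hpair : pairing μ p q (hu.toLp _) g
        = ∫ x, g.1 x * conj (dualPow p.toReal (f.1 x)) ∂μ := by
      rw [pairing_apply]
      refine integral_congr_ae ?_
      filter_upwards [hu.coeFn_toLp] with x hx
      rw [hx]
    have hd := hasDerivAt_integral_norm_rpow hP1 hp (f : Lp ℂ p μ) g
    have hd2 : HasDerivAt (fun t : ℝ =>
        (∫ x, ‖f.1 x + (t : ℂ) * g.1 x‖ ^ p.toReal ∂μ) / p.toReal - t * (φ g).re)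
        ((∫ x, p.toReal * (g.1 x * conj (dualPow p.toReal (f.1 x))).re ∂μ) / p.toReal
          - 1 * (φ g).re) 0 :=
      (hd.div_const _).sub ((hasDerivAt_id (0 : ℝ)).mul_const _)
    -- The minimizer `f` is tested along the real line `f + t g`. The vanishing derivative says that
    -- `dualPow f` represents the real part of `φ`.
    have hmin : IsLocalMin (fun t : ℝ =>
        (∫ x, ‖f.1 x + (t : ℂ) * g.1 x‖ ^ p.toReal ∂μ) / p.toReal - t * (φ g).re) 0 := by
      refine Eventually.of_forall fun t => ?_
      have key : ∀ t : ℝ, ∫ x, ‖f.1 x + (t : ℂ) * g.1 x‖ ^ p.toReal ∂μ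
          = ‖f + (t : ℂ) • g‖ ^ p.toReal := by
        intro t
        rw [Submodule.coe_norm, norm_rpow_eq_integral hp]
        refine integral_congr_ae ?_
        filter_upwards [Lp.coeFn_add f.1 ((t : ℂ) • g.1), Lp.coeFn_smul (t : ℂ) g.1] with x h1 h3
        rw [Submodule.coe_add, Submodule.coe_smul, h1, Pi.add_apply, h3, Pi.smul_apply,
          smul_eq_mul]
      have := hf (f + (t : ℂ) • g)
      simp only [key]
      simp at this ⊢
      linarith
    have h0 := hmin.hasDerivAt_eq_zero hd2
    rw [integral_const_mul, mul_div_cancel_left₀ _ (by linarith : p.toReal ≠ 0), one_mul,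
      sub_eq_zero] at h0
    rw [← h0, hpair]
    exact integral_re (integrable_mul_conj (Lp.memLp g.1) hu)
  refine ⟨hu.toLp _, fun g => Complex.ext (hre g) ?_⟩
  -- Complex linearity recovers the imaginary parts from the real parts at `i g`.
  have := hre (Complex.I • g)
  rw [map_smul, Submodule.coe_smul, map_smul] at this
  simpa using this

/-- The Riesz representation theorem on a subspace of `L^q`, `1 < q ≤ 2`. -/
theorem exists_pairing_eq_of_le_two [IsFiniteMeasure μ] [Fact (1 ≤ p)] [Fact (1 ≤ q)]
    [ENNReal.HolderConjugate q p] [ENNReal.HolderConjugate p q]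
    (hq2 : q ≤ 2) (hp : p ≠ ⊤) (hq : q ≠ ⊤) {V : Submodule ℂ (Lp ℂ q μ)} (φ : StrongDual ℂ V) :
    ∃ h : Lp ℂ p μ, ∀ f : V, φ f = pairing μ q p h f := by
  obtain ⟨ψ, hψ, -⟩ := exists_extension_norm_eq V φ
  -- The Hahn–Banach extension to `L^q` restricts to `L^2`, where the Hilbert space representation
  -- supplies `h`.
  let χ : StrongDual ℂ (Lp ℂ 2 μ) := ψ.comp (lpIncl μ 2 q hq2)
  let h := (InnerProductSpace.toDual ℂ (Lp ℂ 2 μ)).symm χ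
  have hrep : ∀ u : Lp ℂ 2 μ, ψ (lpIncl μ 2 q hq2 u) = ∫ x, u x * conj (h x) ∂μ := by
    intro u
    have h1 : inner ℂ h u = χ u := InnerProductSpace.toDual_symm_apply
    rw [L2.inner_def] at h1
    exact h1.symm
  -- Bounded functions lie in `L^2`, and on them the integral against `conj h` is at most `‖ψ‖`
  -- times the `L^q` norm; the converse of Hölder's inequality applies.
  have hh : MemLp h p μ := by
    refine ⟨Lp.aestronglyMeasurable h, lt_of_le_of_lt (eLpNorm_le_of_forall_bounded (q := q) hp hq
      (Lp.aestronglyMeasurable h) (norm_nonneg ψ) fun u hu => ?_) ENNReal.ofReal_lt_top⟩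
    have hu2 : MemLp u 2 μ := hu.mono_exponent le_top
    have h1 := hrep (hu2.toLp u)
    have h2 : ∫ x, hu2.toLp u x * conj (h x) ∂μ = ∫ x, u x * conj (h x) ∂μ := by
      refine integral_congr_ae ?_
      filter_upwards [hu2.coeFn_toLp] with x hx
      rw [hx]
    rw [h2] at h1
    rw [← h1]
    refine (ψ.le_opNorm _).trans (le_of_eq ?_)
    rw [Lp.norm_def, eLpNorm_congr_ae ((lpIncl_ae_eq 2 q hq2 _).trans hu2.coeFn_toLp)]
  refine ⟨hh.toLp h, fun f => ?_⟩
  rw [← hψ]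
  have : (ψ : Lp ℂ q μ → ℂ) = pairing μ q p (hh.toLp h) := by
    refine (denseRange_lpIncl 2 q hq2 hq).equalizer ψ.continuous
      (pairing μ q p (hh.toLp h)).continuous (funext fun u => ?_)
    simp only [Function.comp_apply]
    rw [hrep, pairing_apply]
    refine integral_congr_ae ?_
    filter_upwards [lpIncl_ae_eq 2 q hq2 u, hh.coeFn_toLp] with x h1 h2
    rw [h1, h2]
  exact congrFun this _

end Riesz

/-! ### The torus action and its isotypic components -/

section Rotations

variable {n : ℕ}

/-- The action of the torus on `ℂ^n`. -/
noncomputable def rotate (θ : UnitAddTorus (Fin n)) (z : Fin n → ℂ) : Fin n → ℂ :=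
  fun j => (AddCircle.toCircle (θ j) : ℂ) * z j

theorem continuous_rotate_uncurry :
    Continuous fun x : UnitAddTorus (Fin n) × (Fin n → ℂ) => rotate x.1 x.2 := by
  unfold rotate
  refine continuous_pi fun j => Continuous.mul ?_ (by fun_prop)
  exact continuous_subtype_val.comp (AddCircle.continuous_toCircle.comp (by fun_prop))

theorem continuous_rotate_left (z : Fin n → ℂ) : Continuous fun θ => rotate θ z :=
  continuous_rotate_uncurry.comp (by fun_prop : Continuous fun θ : UnitAddTorus (Fin n) => (θ, z))

theorem rotate_zero (z : Fin n → ℂ) : rotate 0 z = z := by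
  ext j; simp [rotate]

theorem rotate_add (s t : UnitAddTorus (Fin n)) (z : Fin n → ℂ) :
    rotate (s + t) z = rotate s (rotate t z) := by
  ext j; simp [rotate, AddCircle.toCircle_add, mul_assoc]

theorem monomialFn_mul (α : Fin n → ℤ) (w z : Fin n → ℂ) :
    monomialFn α (fun j => w j * z j) = monomialFn α w * monomialFn α z := by
  simp [monomialFn, mul_zpow, Finset.prod_mul_distrib]

theorem monomialFn_rotate (α : Fin n → ℤ) (θ : UnitAddTorus (Fin n)) (z : Fin n → ℂ) :
    monomialFn α (rotate θ z) = mFourier α θ * monomialFn α z := by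
  unfold rotate
  rw [monomialFn_mul]
  simp [monomialFn, mFourier, fourier_apply, AddCircle.toCircle_zsmul]

theorem differentiable_rotate (θ : UnitAddTorus (Fin n)) : Differentiable ℂ (rotate θ) := by
  unfold rotate; fun_prop

variable {R : TopologicalSpace.Opens (Fin n → ℂ)} (hR : IsReinhardt (R : Set (Fin n → ℂ)))

include hR in
theorem rotate_mem {z : Fin n → ℂ} (hz : z ∈ R) (θ : UnitAddTorus (Fin n)) : rotate θ z ∈ R := by
  have : ∀ j, ∃ x : ℝ, (x : UnitAddCircle) = θ j := fun j => QuotientAddGroup.mk_surjective _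
  choose x hx using this
  have h1 := hR z hz fun j => 2 * Real.pi * x j
  have h2 : rotate θ z = fun j => Complex.exp ((2 * Real.pi * x j : ℝ) * Complex.I) * z j := by
    ext j
    simp [rotate, ← hx, AddCircle.toCircle_apply_mk, Circle.coe_exp]
  rw [h2]
  exact h1

include hR in
theorem rotate_mem_iff {z : Fin n → ℂ} (θ : UnitAddTorus (Fin n)) : rotate θ z ∈ R ↔ z ∈ R := by
  refine ⟨fun h => ?_, fun h => rotate_mem hR h θ⟩
  have := rotate_mem hR h (-θ)
  rwa [← rotate_add, neg_add_cancel, rotate_zero] at this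

theorem measurePreserving_rotate_volume (θ : UnitAddTorus (Fin n)) :
    MeasurePreserving (rotate θ) volume volume := by
  have h1 : ∀ j, MeasurePreserving (fun x : ℂ => (AddCircle.toCircle (θ j) : ℂ) * x)
      volume volume := fun j => (rotation (AddCircle.toCircle (θ j))).measurePreserving
  exact volume_preserving_pi h1

include hR in
theorem measurePreserving_rotate (θ : UnitAddTorus (Fin n)) :
    MeasurePreserving (rotate θ) (volume.restrict (R : Set (Fin n → ℂ)))
      (volume.restrict (R : Set (Fin n → ℂ))) := by
  have h := (measurePreserving_rotate_volume θ).restrict_preimage R.isOpen.measurableSet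
  have h2 : rotate θ ⁻¹' (R : Set (Fin n → ℂ)) = R := Set.ext fun z => rotate_mem_iff hR θ
  rwa [h2] at h

variable (r : ℝ≥0∞) [Fact (1 ≤ r)]

/-- The action of the torus on `L^r`. -/
noncomputable def lpRotate (θ : UnitAddTorus (Fin n)) :
    Lp ℂ r (volume.restrict (R : Set (Fin n → ℂ))) →ₗᵢ[ℂ]
      Lp ℂ r (volume.restrict (R : Set (Fin n → ℂ))) :=
  Lp.compMeasurePreservingₗᵢ ℂ (rotate θ) (measurePreserving_rotate hR θ)

theorem lpRotate_ae_eq (θ : UnitAddTorus (Fin n))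
    (f : Lp ℂ r (volume.restrict (R : Set (Fin n → ℂ)))) :
    lpRotate hR r θ f =ᵐ[volume.restrict (R : Set (Fin n → ℂ))] f ∘ rotate θ :=
  Lp.coeFn_compMeasurePreserving f (measurePreserving_rotate hR θ)

variable {r} (hr : r ≠ ⊤)

include hr in
-- Strong continuity of the action, which needs `r < ∞`; it gives meaning to the vector-valued
-- Fourier coefficients.
theorem continuous_lpRotate (f : Lp ℂ r (volume.restrict (R : Set (Fin n → ℂ)))) :
    Continuous fun θ => lpRotate hR r θ f := by
  let g : C(UnitAddTorus (Fin n), C(Fin n → ℂ, Fin n → ℂ)) :=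
    ContinuousMap.curry ⟨_, continuous_rotate_uncurry⟩
  exact Continuous.compMeasurePreservingLp (f := fun _ => f) (g := g) continuous_const g.continuous
    (fun θ => measurePreserving_rotate hR θ) hr

/-- The `α`-isotypic component of an element of `L^r`. -/
noncomputable def lpComponent (α : Fin n → ℤ) :
    Lp ℂ r (volume.restrict (R : Set (Fin n → ℂ))) →L[ℂ]
      Lp ℂ r (volume.restrict (R : Set (Fin n → ℂ))) :=
  LinearMap.mkContinuous
    { toFun := fun f => mFourierCoeff (fun θ => lpRotate hR r θ f) α
      map_add' := fun f g => by
        simp only [map_add]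
        exact mFourierCoeff_add (continuous_lpRotate hR hr f) (continuous_lpRotate hR hr g) α
      map_smul' := fun c f => by
        simp only [map_smul, RingHom.id_apply]
        exact mFourierCoeff_const_smul c _ α }
    1 fun f => by
      rw [one_mul]
      exact norm_mFourierCoeff_le (fun θ => ((lpRotate hR r θ).norm_map f).le) α

theorem lpComponent_apply (α : Fin n → ℤ) (f : Lp ℂ r (volume.restrict (R : Set (Fin n → ℂ)))) :
    lpComponent hR hr α f = mFourierCoeff (fun θ => lpRotate hR r θ f) α := rfl

/-- The action of the torus on `A^r`. -/
noncomputable def bergmanRotate (θ : UnitAddTorus (Fin n)) (f : bergman R r) : bergman R r :=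
  ⟨lpRotate hR r θ f.1, fun z => holoFn f (rotate θ z),
    (differentiableOn_holoFn f).comp (differentiable_rotate θ).differentiableOn
      fun _ hz => rotate_mem hR hz θ,
    (lpRotate_ae_eq hR r θ f.1).trans
      ((measurePreserving_rotate hR θ).quasiMeasurePreserving.ae_eq_comp
        (coeFn_ae_eq_holoFn f))⟩

omit [Fact (1 ≤ r)] in
theorem holoFn_of_notMem (f : bergman R r) {z : Fin n → ℂ} (hz : z ∉ R) : holoFn f z = 0 :=
  Set.indicator_of_notMem hz _

omit [Fact (1 ≤ r)] in
theorem holoFn_eqOn_of_ae_eq {f : bergman R r} {F : (Fin n → ℂ) → ℂ}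
    (hF : DifferentiableOn ℂ F R) (h : f.1 =ᵐ[volume.restrict (R : Set (Fin n → ℂ))] F) :
    Set.EqOn (holoFn f) F R := fun z hz => by
  rw [holoFn_eq_of_ae_eq hF h, Set.indicator_of_mem hz]

omit [Fact (1 ≤ r)] in
theorem bergman_ext {f g : bergman R r} (h : Set.EqOn (holoFn f) (holoFn g) R) : f = g := by
  refine Subtype.ext (Lp.ext ?_)
  refine (coeFn_ae_eq_holoFn f).trans (EventuallyEq.trans ?_ (coeFn_ae_eq_holoFn g).symm)
  filter_upwards [ae_restrict_mem R.isOpen.measurableSet] with z hz using h hz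

theorem holoFn_bergmanRotate (θ : UnitAddTorus (Fin n)) (f : bergman R r) (z : Fin n → ℂ) :
    holoFn (bergmanRotate hR θ f) z = holoFn f (rotate θ z) := by
  by_cases hz : z ∈ R
  · exact holoFn_eqOn_of_ae_eq
      ((differentiableOn_holoFn f).comp (differentiable_rotate θ).differentiableOn
      fun _ hz => rotate_mem hR hz θ) ((lpRotate_ae_eq hR r θ f.1).trans
      ((measurePreserving_rotate hR θ).quasiMeasurePreserving.ae_eq_comp
        (coeFn_ae_eq_holoFn f))) hz
  · rw [holoFn_of_notMem _ hz, holoFn_of_notMem _ (fun h => hz ((rotate_mem_iff hR θ).1 h))]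

instance : CompleteSpace (bergman R r) := (isClosed_bergman R r).completeSpace_coe

include hr in
theorem continuous_bergmanRotate (f : bergman R r) : Continuous fun θ => bergmanRotate hR θ f :=
  (continuous_lpRotate hR hr f.1).subtype_mk _

/-- `A^r` is closed and invariant under the rotations, so the integral defining the component may be
computed inside `A^r`. -/
theorem lpComponent_coe (α : Fin n → ℤ) (f : bergman R r) :
    lpComponent hR hr α f.1 = (mFourierCoeff (fun θ => bergmanRotate hR θ f) α : bergman R r) := by
  exact (map_mFourierCoeff (bergman R r).subtypeL (continuous_bergmanRotate hR hr f) α).symm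

/-- The `α`-isotypic component of an element of `A^r`. -/
noncomputable def bergmanComponent (α : Fin n → ℤ) : bergman R r →L[ℂ] bergman R r :=
  ((lpComponent hR hr α).comp (bergman R r).subtypeL).codRestrict (bergman R r) fun f => by
    simp only [ContinuousLinearMap.comp_apply, Submodule.subtypeL_apply, lpComponent_coe]
    exact Subtype.prop _

theorem coe_bergmanComponent (α : Fin n → ℤ) (f : bergman R r) :
    (bergmanComponent hR hr α f : Lp ℂ r (volume.restrict (R : Set (Fin n → ℂ))))
      = lpComponent hR hr α f.1 := rfl

theorem bergmanComponent_apply (α : Fin n → ℤ) (f : bergman R r) :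
    bergmanComponent hR hr α f = mFourierCoeff (fun θ => bergmanRotate hR θ f) α :=
  Subtype.ext (lpComponent_coe hR hr α f)

theorem holoFn_bergmanComponent (α : Fin n → ℤ) (f : bergman R r) (z : Fin n → ℂ) :
    holoFn (bergmanComponent hR hr α f) z = mFourierCoeff (fun θ => holoFn f (rotate θ z)) α := by
  have := map_mFourierCoeff (evalL R r z) (continuous_bergmanRotate hR hr f) α
  rw [← bergmanComponent_apply hR hr] at this
  refine Eq.trans this ?_
  congr 1 with θ
  exact holoFn_bergmanRotate hR θ f z

theorem holoFn_bergmanComponent_rotate (α : Fin n → ℤ) (f : bergman R r) (z : Fin n → ℂ)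
    (s : UnitAddTorus (Fin n)) :
    holoFn (bergmanComponent hR hr α f) (rotate s z)
      = mFourier α s * holoFn (bergmanComponent hR hr α f) z := by
  simp only [holoFn_bergmanComponent, ← rotate_add]
  exact mFourierCoeff_translate (fun θ => holoFn f (rotate θ z)) s α

theorem norm_bergmanComponent_le (α : Fin n → ℤ) (f : bergman R r) :
    ‖bergmanComponent hR hr α f‖ ≤ ‖f‖ :=
  norm_mFourierCoeff_le (fun θ => ((lpRotate hR r θ).norm_map f.1).le) α

theorem lpRotate_zero (f : Lp ℂ r (volume.restrict (R : Set (Fin n → ℂ)))) :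
    lpRotate hR r 0 f = f := by
  refine Lp.ext ((lpRotate_ae_eq hR r 0 f).trans (Eventually.of_forall fun z => ?_))
  simp [rotate_zero]

/-- Every element of `L^r` lies in the closed span of its isotypic components. -/
theorem lp_mem_closure_span (f : Lp ℂ r (volume.restrict (R : Set (Fin n → ℂ)))) :
    f ∈ (Submodule.span ℂ (Set.range fun α => lpComponent hR hr α f)).topologicalClosure := by
  have := mem_closure_span_mFourierCoeff (continuous_lpRotate hR hr f) 0
  rwa [lpRotate_zero] at this

theorem bergman_mem_closure_span (f : bergman R r) :
    f ∈ (Submodule.span ℂ (Set.range fun α => bergmanComponent hR hr α f)).topologicalClosure := by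
  have := mem_closure_span_mFourierCoeff (continuous_bergmanRotate hR hr f) 0
  have h0 : bergmanRotate hR 0 f = f := Subtype.ext (lpRotate_zero hR f.1)
  rw [h0] at this
  have h1 : (fun α => bergmanComponent hR hr α f) = mFourierCoeff fun θ => bergmanRotate hR θ f :=
    funext fun α => bergmanComponent_apply hR hr α f
  rw [h1]
  exact this

variable {p q : ℝ≥0∞} [Fact (1 ≤ p)] [Fact (1 ≤ q)] [ENNReal.HolderConjugate p q]

/-- Change of variables: rotations preserve the measure on `R`. -/
theorem pairing_lpRotate (θ : UnitAddTorus (Fin n))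
    (h : Lp ℂ q (volume.restrict (R : Set (Fin n → ℂ))))
    (f : Lp ℂ p (volume.restrict (R : Set (Fin n → ℂ)))) :
    pairing _ p q (lpRotate hR q θ h) (lpRotate hR p θ f) = pairing _ p q h f := by
  rw [pairing_apply, pairing_apply]
  have hmp := measurePreserving_rotate hR θ
  have h1 : AEStronglyMeasurable (fun z => f z * conj (h z))
      ((volume.restrict (R : Set (Fin n → ℂ))).map (rotate θ)) := by
    rw [hmp.map_eq]
    exact (integrable_mul_conj (Lp.memLp f) (Lp.memLp h)).1
  have h2 := integral_map hmp.measurable.aemeasurable h1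
  rw [hmp.map_eq] at h2
  rw [h2]
  refine integral_congr_ae ?_
  filter_upwards [lpRotate_ae_eq hR q θ h, lpRotate_ae_eq hR p θ f] with z h3 h4
  rw [h3, h4]; rfl

theorem lpRotate_add (s t : UnitAddTorus (Fin n))
    (f : Lp ℂ r (volume.restrict (R : Set (Fin n → ℂ)))) :
    lpRotate hR r (s + t) f = lpRotate hR r t (lpRotate hR r s f) := by
  refine Lp.ext ((lpRotate_ae_eq hR r _ f).trans ?_)
  refine EventuallyEq.trans ?_ (lpRotate_ae_eq hR r t _).symm
  refine EventuallyEq.trans ?_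
    ((measurePreserving_rotate hR t).quasiMeasurePreserving.ae_eq_comp (lpRotate_ae_eq hR r s f)).symm
  exact Eventually.of_forall fun z => by simp [rotate_add]

/-- The projections onto the isotypic components are self-adjoint. -/
theorem pairing_lpComponent (hp : p ≠ ⊤) (hq : q ≠ ⊤) (α : Fin n → ℤ)
    (h : Lp ℂ q (volume.restrict (R : Set (Fin n → ℂ))))
    (f : Lp ℂ p (volume.restrict (R : Set (Fin n → ℂ)))) :
    pairing _ p q (lpComponent hR hq α h) f = pairing _ p q h (lpComponent hR hp α f) := by
  have h1 : pairing _ p q h (lpComponent hR hp α f)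
      = ∫ θ, mFourier (-α) θ * pairing _ p q h (lpRotate hR p θ f) := by
    rw [lpComponent_apply, map_mFourierCoeff _ (continuous_lpRotate hR hp f)]
    rfl
  have h2 : pairing _ p q (lpComponent hR hq α h) f
      = conj (∫ θ, mFourier (-α) θ * pairing _ q p f (lpRotate hR q θ h)) := by
    rw [← Complex.conj_conj (pairing _ p q (lpComponent hR hq α h) f), ← pairing_conj,
      lpComponent_apply, map_mFourierCoeff _ (continuous_lpRotate hR hq h)]
    rfl
  have : (volume : Measure UnitAddCircle).IsNegInvariant :=
    inferInstanceAs (Measure.IsNegInvariant AddCircle.haarAddCircle)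
  have : (volume : Measure (UnitAddTorus (Fin n))).IsNegInvariant :=
    inferInstanceAs (Measure.IsNegInvariant (Measure.pi fun _ => (volume : Measure UnitAddCircle)))
  -- The substitution `θ ↦ -θ` matches the two integrals, since rotating one argument of the pairing
  -- amounts to rotating the other one back.
  rw [h1, h2, ← integral_conj, ← integral_neg_eq_self]
  congr 1 with θ
  rw [map_mul, ← mFourier_neg, neg_neg, pairing_conj (p := p), Complex.conj_conj,
    ← pairing_lpRotate hR θ (lpRotate hR q (-θ) h) f, ← lpRotate_add, neg_add_cancel,
    lpRotate_zero, mFourier_neg_apply]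

end Rotations

/-! ### Holomorphic functions that transform like a monomial -/

section Eigenfunctions

variable {n : ℕ}

/-- The identity theorem for holomorphic functions of several variables. -/
theorem eqOn_zero_of_eventuallyEq_zero {U : Set (Fin n → ℂ)} (hU : IsOpen U)
    (hconn : IsPreconnected U) {D : (Fin n → ℂ) → ℂ} (hD : DifferentiableOn ℂ D U)
    {z₀ : Fin n → ℂ} (hz₀ : z₀ ∈ U) (h0 : D =ᶠ[𝓝 z₀] 0) : Set.EqOn D 0 U := by
  -- The set of points near which `D` vanishes is open; by connectedness it remains to see that it
  -- is relatively closed in `U`.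
  have hsub : U ⊆ {z | D =ᶠ[𝓝 z] 0} := by
    refine hconn.subset_of_closure_inter_subset isOpen_setOfPred_eventually_nhds ⟨z₀, hz₀, h0⟩ ?_
    rintro w ⟨hw, hwU⟩
    obtain ⟨ε, hε, hball⟩ := Metric.isOpen_iff.1 hU w hwU
    obtain ⟨z', hz', hz'w⟩ := Metric.mem_closure_iff.1 hw ε hε
    have hz'b : z' ∈ ball w ε := by rwa [mem_ball, dist_comm]
    filter_upwards [ball_mem_nhds w hε] with z hz
    -- The complex line through `z'` and `z` meets the ball in a convex set, and `D` vanishes on it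
    -- near `z'`; the one-variable identity theorem reaches `z`.
    let L : ℂ → Fin n → ℂ := fun t => z' + t • (z - z')
    have hL : Differentiable ℂ L := by fun_prop
    have hV : IsOpen (L ⁻¹' ball w ε) := isOpen_ball.preimage hL.continuous
    have hVc : IsPreconnected (L ⁻¹' ball w ε) := by
      refine Convex.isPreconnected ?_
      intro x hx y hy a b ha hb hab
      have h1 := (convex_ball w ε) hx hy ha hb hab
      have h2 : a • L x + b • L y = L (a • x + b • y) := by
        have hab' : (a : ℂ) + b = 1 := by exact_mod_cast hab
        ext j
        simp only [L, Pi.add_apply, Pi.smul_apply, Complex.real_smul, smul_eq_mul, Pi.sub_apply]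
        linear_combination (z' j) * hab'
      rwa [h2] at h1
    have hf : DifferentiableOn ℂ (fun t => D (L t)) (L ⁻¹' ball w ε) :=
      hD.comp hL.differentiableOn fun t ht => hball ht
    have h00 : (fun t => D (L t)) =ᶠ[𝓝 0] 0 := by
      have hL0 : L 0 = z' := by simp [L]
      have := hL.continuous.tendsto 0
      rw [hL0] at this
      exact this.eventually hz'
    have h1 := (hf.analyticOnNhd hV).eqOn_zero_of_preconnected_of_eventuallyEq_zero hVc
      (show (0 : ℂ) ∈ _ by simpa [L] using hz'b) h00
      (show (1 : ℂ) ∈ _ by simpa [L] using hz)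
    simpa [L] using h1
  exact fun z hz => (hsub hz).self_of_nhds

/-- The vanishing coordinates in `A` can be perturbed away without leaving an open set. -/
theorem eventually_perturb_mem {U : Set (Fin n → ℂ)} (hU : IsOpen U) {w : Fin n → ℂ} (hw : w ∈ U)
    (A : Set (Fin n)) [DecidablePred (· ∈ A)] :
    Tendsto (fun ε : ℂ => fun j => if w j = 0 ∧ j ∈ A then ε else w j) (𝓝[≠] 0) (𝓝 w) ∧
    ∀ᶠ ε : ℂ in 𝓝[≠] 0, ε ≠ 0 ∧ (fun j => if w j = 0 ∧ j ∈ A then ε else w j) ∈ U := by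
  have h1 : Tendsto (fun ε : ℂ => fun j => if w j = 0 ∧ j ∈ A then ε else w j) (𝓝 0) (𝓝 w) := by
    rw [tendsto_pi_nhds]
    intro j
    by_cases h : w j = 0 ∧ j ∈ A
    · simp only [h, and_self, if_true]; exact tendsto_id
    · simp only [h, if_false]; exact tendsto_const_nhds
  have h2 := h1.mono_left (nhdsWithin_le_nhds (s := {0}ᶜ))
  exact ⟨h2, (eventually_mem_nhdsWithin (a := (0 : ℂ)) (s := {0}ᶜ)).and
    (h2.eventually (hU.mem_nhds hw))⟩

theorem exists_mem_forall_ne_zero {U : Set (Fin n → ℂ)} (hU : IsOpen U) (hne : U.Nonempty) :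
    ∃ z ∈ U, ∀ j, z j ≠ 0 := by
  classical
  obtain ⟨w, hw⟩ := hne
  obtain ⟨ε, hε, h⟩ := (eventually_perturb_mem hU hw Set.univ).2.exists
  refine ⟨_, h, fun j => ?_⟩
  by_cases hj : w j = 0 <;> simp [hj, hε]

theorem differentiableAt_monomialFn {α : Fin n → ℤ} {z : Fin n → ℂ}
    (h : ∀ j, α j < 0 → z j ≠ 0) : DifferentiableAt ℂ (monomialFn α) z := by
  have h1 : ∀ j, DifferentiableAt ℂ (fun z : Fin n → ℂ => z j ^ α j) z := fun j => by
    have h2 : DifferentiableAt ℂ (fun z : Fin n → ℂ => z j) z := by fun_prop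
    refine h2.zpow ?_
    rcases lt_or_ge (α j) 0 with hj | hj
    · exact Or.inl (h j hj)
    · exact Or.inr hj
  have h3 : ∀ s : Finset (Fin n), DifferentiableAt ℂ (fun z : Fin n → ℂ => ∏ j ∈ s, z j ^ α j) z := by
    classical
    intro s
    induction s using Finset.induction_on with
    | empty => simp
    | insert j s hj ih =>
      simp only [Finset.prod_insert hj]
      exact (h1 j).mul ih
  exact h3 Finset.univ

theorem monomialFn_ne_zero {α : Fin n → ℤ} {z : Fin n → ℂ} (h : ∀ j, z j = 0 → α j = 0) :
    monomialFn α z ≠ 0 := by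
  unfold monomialFn
  refine Finset.prod_ne_zero_iff.2 fun j _ => ?_
  by_cases hz : z j = 0
  · simp [h j hz]
  · exact zpow_ne_zero _ hz

theorem monomialFn_mul_negPart {α : Fin n → ℤ} {z : Fin n → ℂ} (h : ∀ j, α j < 0 → z j ≠ 0) :
    monomialFn α z * monomialFn (fun j => max (-α j) 0) z = monomialFn (fun j => max (α j) 0) z := by
  unfold monomialFn
  rw [← Finset.prod_mul_distrib]
  refine Finset.prod_congr rfl fun j _ => ?_
  beta_reduce
  rcases lt_or_ge (α j) 0 with hj | hj
  · rw [← zpow_add₀ (h j hj), max_eq_left (by omega), max_eq_right (by omega)]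
    simp
  · rw [max_eq_right (by omega : -α j ≤ 0), max_eq_left hj]
    simp

variable {R : TopologicalSpace.Opens (Fin n → ℂ)}

/-- Differentiating `H` along the rotation of the `j`-th coordinate gives `2πi z_j ∂_j H = 0`, and
`z_j ≠ 0`. -/
theorem fderiv_eq_zero_of_rotate_invariant {H : (Fin n → ℂ) → ℂ} {z : Fin n → ℂ}
    (hz0 : ∀ j, z j ≠ 0) (hd : DifferentiableAt ℂ H z)
    (hH : ∀ θ, H (rotate θ z) = H z) : fderiv ℂ H z = 0 := by
  have key : ∀ j, fderiv ℂ H z (Pi.single j 1) = 0 := by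
    intro j
    let c : Fin n → ℂ := Pi.single j (2 * Real.pi * Complex.I)
    let γ : ℝ → Fin n → ℂ := fun t k => Complex.exp (c k * t) * z k
    have hγ : ∀ t, γ t = rotate (fun k => ((if k = j then t else 0 : ℝ) : UnitAddCircle)) z := by
      intro t
      ext k
      by_cases hk : k = j
      · subst hk
        simp [γ, c, rotate, AddCircle.toCircle_apply_mk, Circle.coe_exp]
        left; ring_nf
      · simp [γ, c, rotate, hk]
    have hγ0 : γ 0 = z := by ext k; simp [γ]
    have hder : HasDerivAt γ ((2 * Real.pi * Complex.I * z j) • Pi.single j (1 : ℂ)) 0 := by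
      rw [hasDerivAt_pi]
      intro k
      have h1 : HasDerivAt (fun t : ℝ => Complex.exp (c k * t) * z k) (c k * z k) 0 := by
        have h2 : HasDerivAt (fun t : ℝ => c k * (t : ℂ)) (c k) 0 := by
          simpa using (Complex.ofRealCLM.hasDerivAt (x := (0 : ℝ))).const_mul (c k)
        simpa using (h2.cexp.mul_const (z k))
      refine h1.congr_deriv ?_
      by_cases hk : k = j
      · subst hk; simp [c]
      · simp [c, hk]
    have h1 : HasDerivAt (fun t => H (γ t))
        (fderiv ℂ H z ((2 * Real.pi * Complex.I * z j) • Pi.single j (1 : ℂ))) 0 := by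
      have hf : HasFDerivAt H (fderiv ℂ H z) (γ 0) := by rw [hγ0]; exact hd.hasFDerivAt
      exact (hf.restrictScalars ℝ).comp_hasDerivAt 0 hder
    have h2 : (fun t => H (γ t)) = fun _ => H z := by
      ext t; rw [hγ, hH]
    rw [h2] at h1
    have h3 := h1.unique (hasDerivAt_const _ _)
    rw [map_smul, smul_eq_mul] at h3
    refine (mul_eq_zero.1 h3).resolve_left ?_
    have := hz0 j
    simp [Real.pi_ne_zero, this]
  refine ContinuousLinearMap.coe_injective (LinearMap.pi_ext' fun j => LinearMap.ext_ring ?_)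
  simpa using key j

/-- A holomorphic function that transforms under the rotations like `e_α` is a multiple
of `e_α`; if it is not zero, then `e_α` is holomorphic. -/
theorem exists_eq_const_mul_monomialFn (hconn : IsConnected (R : Set (Fin n → ℂ)))
    {G : (Fin n → ℂ) → ℂ} (hG : DifferentiableOn ℂ G R) {α : Fin n → ℤ}
    (hα : ∀ z ∈ R, ∀ θ, G (rotate θ z) = mFourier α θ * G z) :
    ∃ c : ℂ, (∀ z ∈ R, G z = c * monomialFn α z) ∧
      (c ≠ 0 → DifferentiableOn ℂ (monomialFn α) R) := by
  classical
  obtain ⟨z₀, hz₀, hz₀ne⟩ := exists_mem_forall_ne_zero R.isOpen hconn.nonempty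
  -- near `z₀`
  have hnear : ∃ c, ∀ᶠ z in 𝓝 z₀, (∀ j, z j ≠ 0) ∧ G z = c * monomialFn α z := by
    have hne : ∀ᶠ z in 𝓝 z₀, z ∈ R ∧ ∀ j, z j ≠ 0 :=
      (show ∀ᶠ z in 𝓝 z₀, z ∈ R from R.isOpen.mem_nhds hz₀).and (eventually_all.2 fun j =>
        (continuous_apply j).continuousAt.eventually_ne (hz₀ne j))
    obtain ⟨ε, hε, hball⟩ := Metric.eventually_nhds_iff_ball.1 hne
    -- The characters of `G` and of `e_{-α}` cancel, so `H` is rotation invariant and hence constant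
    -- on the ball.
    let H : (Fin n → ℂ) → ℂ := fun z => G z * monomialFn (-α) z
    have hdH : ∀ z ∈ ball z₀ ε, DifferentiableAt ℂ H z := fun z hz =>
      ((hG z (hball z hz).1).differentiableAt (R.isOpen.mem_nhds (hball z hz).1)).mul
        (differentiableAt_monomialFn fun j _ => (hball z hz).2 j)
    have hf : ∀ z ∈ ball z₀ ε, fderiv ℂ H z = 0 := fun z hz => by
      refine fderiv_eq_zero_of_rotate_invariant (hball z hz).2 (hdH z hz)
        fun θ => ?_
      simp only [H]
      rw [hα z (hball z hz).1, monomialFn_rotate, mul_mul_mul_comm, ← mFourier_add]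
      simp [mFourier_zero]
    refine ⟨H z₀, ?_⟩
    filter_upwards [ball_mem_nhds z₀ hε] with z hz
    refine ⟨(hball z hz).2, ?_⟩
    have h1 := isOpen_ball.is_const_of_fderiv_eq_zero (convex_ball z₀ ε).isPreconnected
      (fun z hz => (hdH z hz).differentiableWithinAt) (fun z hz => hf z hz)
      (mem_ball_self hε) hz
    rw [h1]
    have h2 : monomialFn (-α) z * monomialFn α z = 1 := by
      unfold monomialFn
      rw [← Finset.prod_mul_distrib]
      refine Finset.prod_eq_one fun j _ => ?_
      rw [← zpow_add₀ ((hball z hz).2 j)]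
      simp
    simp only [H]
    rw [mul_assoc, h2, mul_one]
  obtain ⟨c, hc⟩ := hnear
  set αp : Fin n → ℤ := fun j => max (α j) 0 with hαp
  set αm : Fin n → ℤ := fun j => max (-α j) 0 with hαm
  -- Clearing denominators, with `α = α⁺ - α⁻`, makes both sides holomorphic on all of `R`,
  -- including where coordinates vanish, so the identity theorem spreads the local relation.
  have hglobal : ∀ z ∈ R, G z * monomialFn αm z = c * monomialFn αp z := by
    have hdiff : DifferentiableOn ℂ (fun z => G z * monomialFn αm z - c * monomialFn αp z) R := by
      refine (hG.mul fun z _ => ?_).sub (DifferentiableOn.const_mul (fun z _ => ?_) c)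
      · exact (differentiableAt_monomialFn fun j hj => absurd hj
          (not_lt.2 (le_max_right _ _))).differentiableWithinAt
      · exact (differentiableAt_monomialFn fun j hj => absurd hj
          (not_lt.2 (le_max_right _ _))).differentiableWithinAt
    have h0 : (fun z => G z * monomialFn αm z - c * monomialFn αp z) =ᶠ[𝓝 z₀] 0 := by
      filter_upwards [hc] with z hz
      rw [hz.2, mul_assoc, monomialFn_mul_negPart fun j _ => hz.1 j]
      simp [hαp]
    intro z hz
    exact sub_eq_zero.1 (eqOn_zero_of_eventuallyEq_zero R.isOpen hconn.isPreconnected hdiff hz₀ h0 hz)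
  by_cases hc0 : c = 0
  -- `G` vanishes at points with no zero coordinate. These accumulate at every `w ∈ R`, and `G` is
  -- continuous.
  · refine ⟨0, fun w hw => ?_, fun h => absurd rfl h⟩
    rw [zero_mul]
    obtain ⟨h1, h2⟩ := eventually_perturb_mem R.isOpen hw Set.univ
    have h3 : Tendsto G (𝓝[R] w) (𝓝 (G w)) := hG.continuousOn w hw
    rw [R.isOpen.nhdsWithin_eq hw] at h3
    refine tendsto_nhds_unique (h3.comp h1) (tendsto_const_nhds.congr' ?_)
    filter_upwards [h2] with ε hε
    have h4 := hglobal _ hε.2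
    rw [hc0, zero_mul] at h4
    refine ((mul_eq_zero.1 h4).resolve_right (monomialFn_ne_zero fun j hj => ?_)).symm
    by_cases hj' : w j = 0 <;> simp [hj', hε.1] at hj
  -- If `α_j < 0` and `w_j = 0`, moving only the other vanishing coordinates off zero makes the left
  -- side of `hglobal` zero and the right side nonzero, because `α⁺_j = 0`. So `R` avoids the poles
  -- of `e_α`.
  · have hne : ∀ j, α j < 0 → ∀ w ∈ R, w j ≠ 0 := by
      intro j hj w hw hwj
      obtain ⟨-, h2⟩ := eventually_perturb_mem R.isOpen hw {j}ᶜ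
      obtain ⟨ε, hε, hmem⟩ := h2.exists
      have h3 := hglobal _ hmem
      have h4 : monomialFn αm (fun k => if w k = 0 ∧ k ∈ ({j} : Set (Fin n))ᶜ then ε else w k)
          = 0 := by
        unfold monomialFn
        refine Finset.prod_eq_zero (Finset.mem_univ j) ?_
        have : αm j ≠ 0 := by simp only [hαm]; omega
        simp [hwj, zero_zpow _ this]
      rw [h4, mul_zero] at h3
      refine (mul_ne_zero hc0 (monomialFn_ne_zero fun k hk => ?_)) h3.symm
      by_cases hkj : k = j
      · simp only [hαp, hkj]; omega
      · by_cases hk' : w k = 0 <;> simp [hk', hkj, hε] at hk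
    refine ⟨c, fun z hz => ?_, fun _ z hz =>
      (differentiableAt_monomialFn fun j hj => hne j hj z hz).differentiableWithinAt⟩
    have h1 := hglobal z hz
    have h2 := monomialFn_mul_negPart (α := α) fun j hj => hne j hj z hz
    have h3 : monomialFn αm z ≠ 0 := monomialFn_ne_zero fun j hj => by
      simp only [hαm]
      by_contra h
      exact hne j (by omega) z hz hj
    refine mul_right_cancel₀ h3 ?_
    rw [h1, mul_assoc, h2]

end Eigenfunctions

/-! ### Laurent expansions and the coefficient functionals -/

section Laurent

variable {n : ℕ}

theorem summable_pow_natAbs {x : ℝ} (hx0 : 0 ≤ x) (hx1 : x < 1) :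
    Summable fun k : ℤ => x ^ k.natAbs := by
  refine Summable.of_nat_of_neg ?_ ?_ <;>
  simpa using summable_geometric_of_lt_one hx0 hx1

/-- A finite set of multi-indices lies in a box, over which the sum factors into one-variable
geometric sums. -/
theorem summable_prod_pow_natAbs {x : ℝ} (hx0 : 0 ≤ x) (hx1 : x < 1) :
    Summable fun α : Fin n → ℤ => ∏ j, x ^ (α j).natAbs := by
  classical
  have hs := summable_pow_natAbs hx0 hx1
  set g : ℤ → ℝ := fun k => x ^ k.natAbs with hg
  have hg0 : ∀ k, 0 ≤ g k := fun k => pow_nonneg hx0 _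
  change Summable fun α : Fin n → ℤ => ∏ j, g (α j)
  clear_value g
  refine summable_of_sum_le (c := ∏ _j : Fin n, ∑' k : ℤ, g k)
    (fun α => Finset.prod_nonneg fun j _ => hg0 _) fun u => ?_
  let t : Fin n → Finset ℤ := fun j => u.image (fun α => α j)
  calc ∑ α ∈ u, ∏ j, g (α j)
      ≤ ∑ α ∈ Fintype.piFinset t, ∏ j, g (α j) := by
        refine Finset.sum_le_sum_of_subset_of_nonneg (fun α hα => ?_)
          fun α _ _ => Finset.prod_nonneg fun j _ => hg0 _
        exact Fintype.mem_piFinset.2 fun j => Finset.mem_image_of_mem (fun α => α j) hα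
    _ = ∏ j, ∑ k ∈ t j, g k := (Finset.prod_univ_sum t fun _ k => g k).symm
    _ ≤ _ := Finset.prod_le_prod (fun j _ => Finset.sum_nonneg fun k _ => hg0 k)
        fun j _ => hs.sum_le_tsum (t j) fun k _ => hg0 k

variable {R : TopologicalSpace.Opens (Fin n → ℂ)} (hR : IsReinhardt (R : Set (Fin n → ℂ)))
  {r : ℝ≥0∞} [Fact (1 ≤ r)]

include hR in
theorem continuous_comp_rotate {F : (Fin n → ℂ) → ℂ} (hF : ContinuousOn F R) {z : Fin n → ℂ}
    (hz : z ∈ R) : Continuous fun θ => F (rotate θ z) :=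
  hF.comp_continuous (continuous_rotate_left z) fun θ => rotate_mem hR hz θ

include hR in
/-- The coefficients of a Laurent expansion are the Fourier coefficients on the tori. -/
theorem mFourierCoeff_eq_of_hasLaurentExpansion {F : (Fin n → ℂ) → ℂ} (hF : ContinuousOn F R)
    {c : (Fin n → ℤ) → ℂ} (h : HasLaurentExpansion R F c) {z : Fin n → ℂ} (hz : z ∈ R)
    (β : Fin n → ℤ) :
    mFourierCoeff (fun θ => F (rotate θ z)) β = c β * monomialFn β z := by
  classical
  have hK : IsCompact (Set.range fun θ => rotate θ z) := isCompact_range (continuous_rotate_left z)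
  have hKR : (Set.range fun θ => rotate θ z) ⊆ (R : Set (Fin n → ℂ)) := by
    rintro _ ⟨θ, rfl⟩; exact rotate_mem hR hz θ
  have hu := (tendstoLocallyUniformlyOn_iff_tendstoUniformlyOn_of_compact hK).1
    (HasSumLocallyUniformlyOn.mono h hKR)
  let S : Finset (Fin n → ℤ) → UnitAddTorus (Fin n) → ℂ :=
    fun s θ => ∑ α ∈ s, mFourier α θ • (c α * monomialFn α z)
  have hS : ∀ s, Continuous (S s) := fun s => by fun_prop
  have hSc : ∀ s, mFourierCoeff (S s) β = if β ∈ s then c β * monomialFn β z else 0 := by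
    intro s
    induction s using Finset.induction_on with
    | empty => simp [S, mFourierCoeff]
    | insert a s ha ih =>
      have h1 : S (insert a s) = fun θ => mFourier a θ • (c a * monomialFn a z) + S s θ := by
        ext θ; simp only [S, Finset.sum_insert ha]
      rw [h1, mFourierCoeff_add (by fun_prop) (hS s), ih, mFourierCoeff_mFourier_smul]
      by_cases hb : β = a
      · subst hb; simp [ha]
      · simp [hb]
  have hFc := continuous_comp_rotate hR hF hz
  -- Convergence is uniform on the torus orbit of `z`, which is compact, so Fourier coefficients
  -- pass to the limit; those of the partial sums are constant once `β` is included.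
  have hlim : Tendsto (fun s => mFourierCoeff (S s) β) atTop
      (𝓝 (mFourierCoeff (fun θ => F (rotate θ z)) β)) := by
    rw [Metric.tendsto_nhds]
    intro ε hε
    filter_upwards [Metric.tendstoUniformlyOn_iff.1 hu (ε / 2) (by positivity)] with s hs
    have h1 : mFourierCoeff (fun θ => F (rotate θ z)) β
        = mFourierCoeff (fun θ => F (rotate θ z) - S s θ) β + mFourierCoeff (S s) β := by
      have h2 := mFourierCoeff_add (F := fun θ => F (rotate θ z) - S s θ) (hFc.sub (hS s)) (hS s) β
      simpa using h2
    rw [dist_comm, dist_eq_norm, h1, add_sub_cancel_right]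
    refine (norm_mFourierCoeff_le (C := ε / 2) (fun θ => ?_) β).trans_lt (by linarith)
    have h2 := (hs _ ⟨θ, rfl⟩).le
    have h3 : S s θ = ∑ α ∈ s, c α * monomialFn α (rotate θ z) :=
      Finset.sum_congr rfl fun α _ => by rw [monomialFn_rotate, smul_eq_mul]; ring
    rw [h3]
    rwa [dist_eq_norm] at h2
  refine tendsto_nhds_unique hlim (tendsto_const_nhds.congr' ?_)
  filter_upwards [eventually_ge_atTop {β}] with s hs
  rw [hSc, if_pos (hs (Finset.mem_singleton_self β))]

variable (hconn : IsConnected (R : Set (Fin n → ℂ))) (hr : r ≠ ⊤)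

/-- The Laurent coefficient functionals on `A^r`. -/
noncomputable def coeffL (α : Fin n → ℤ) : StrongDual ℂ (bergman R r) :=
  (monomialFn α (exists_mem_forall_ne_zero R.isOpen hconn.nonempty).choose)⁻¹ •
    (evalL R r (exists_mem_forall_ne_zero R.isOpen hconn.nonempty).choose).comp
      (bergmanComponent hR hr α)

/-- The component transforms by the character `α`, so it is a multiple of `e_α`. Evaluating at the
base point of `coeffL`, which has no zero coordinate, identifies the factor. -/
theorem holoFn_bergmanComponent_eq (α : Fin n → ℤ) (f : bergman R r) {z : Fin n → ℂ}
    (hz : z ∈ R) :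
    holoFn (bergmanComponent hR hr α f) z = coeffL hR hconn hr α f * monomialFn α z ∧
      (coeffL hR hconn hr α f ≠ 0 → DifferentiableOn ℂ (monomialFn α) R) := by
  obtain ⟨c, hc, hd⟩ := exists_eq_const_mul_monomialFn hconn
    (differentiableOn_holoFn (bergmanComponent hR hr α f)) (α := α)
    fun z _ θ => holoFn_bergmanComponent_rotate hR hr α f z θ
  set z₀ := (exists_mem_forall_ne_zero R.isOpen hconn.nonempty).choose with hz₀
  have h0 := (exists_mem_forall_ne_zero R.isOpen hconn.nonempty).choose_spec
  rw [← hz₀] at h0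
  have hcc : coeffL hR hconn hr α f = c := by
    have h1 : coeffL hR hconn hr α f
        = (monomialFn α z₀)⁻¹ * holoFn (bergmanComponent hR hr α f) z₀ := rfl
    rw [h1, hc z₀ h0.1, mul_left_comm, inv_mul_cancel₀, mul_one]
    exact monomialFn_ne_zero fun j hj => absurd hj (h0.2 j)
  rw [hcc]
  exact ⟨hc z hz, hd⟩

/-- If the coefficient is nonzero, `e_α` is a scalar multiple of the component of `f`, which lies in
`A^r`. This links the coefficients to the allowable indices. -/
theorem allowable_of_coeffL_ne_zero {α : Fin n → ℤ} {f : bergman R r}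
    (h : coeffL hR hconn hr α f ≠ 0) : α ∈ allowable R r := by
  obtain ⟨z, hz⟩ := hconn.nonempty
  refine ⟨(holoFn_bergmanComponent_eq hR hconn hr α f hz).2 h, ?_⟩
  have h1 := (memLp_holoFn (bergmanComponent hR hr α f)).const_mul (coeffL hR hconn hr α f)⁻¹
  refine (memLp_congr_ae ?_).1 h1
  filter_upwards [ae_restrict_mem R.isOpen.measurableSet] with z hz
  rw [(holoFn_bergmanComponent_eq hR hconn hr α f hz).1, inv_mul_cancel_left₀ h]

/-- Multiplying the coordinates by suitable factors shows that the terms of the Laurent series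
decay geometrically, locally uniformly. -/
theorem exists_norm_coeffL_mul_le (w : Fin n → ℂ) (hw : w ∈ R) :
    ∃ δ > 0, ∃ x : ℝ, 0 ≤ x ∧ x < 1 ∧ ∃ C : ℝ, ball w δ ⊆ R ∧ ∀ (f : bergman R r), ∀ z ∈ ball w δ,
      ∀ α, ‖coeffL hR hconn hr α f * monomialFn α z‖ ≤ C * ‖f‖ * ∏ j, x ^ (α j).natAbs := by
  obtain ⟨ε, hε, hεR⟩ := nhds_basis_closedBall.mem_iff.1 (R.isOpen.mem_nhds hw)
  set δ := ε / 3 with hδdef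
  have hδ : 0 < δ := by positivity
  obtain ⟨C, hC0, hC⟩ := exists_norm_le_eLpNorm n (Fact.out : 1 ≤ r) hδ
  -- Scaling the coordinates of a point `z` of `ball w δ` by factors within `κ` of `1` moves it by
  -- at most `δ`. The ball of radius `δ` about the result then stays within `3 δ = ε` of `w`.
  set κ : ℝ := δ / (‖w‖ + δ + 1) with hκ
  have hκ0 : 0 < κ := by positivity
  set ρ : ℝ := 1 + κ with hρ
  have hρ1 : 1 < ρ := by linarith
  have hρ0 : 0 < ρ := by linarith
  have hinv1 : ρ⁻¹ < 1 := inv_lt_one_of_one_lt₀ hρ1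
  refine ⟨δ, hδ, ρ⁻¹, by positivity, hinv1, C, ?_, ?_⟩
  · exact (ball_subset_closedBall.trans (closedBall_subset_closedBall (by linarith))).trans hεR
  intro f z hz α
  -- Each coordinate is stretched or shrunk according to the sign of `α_j`, so that `e_α` grows by
  -- `ρ ^ |α_j|` in every factor.
  let s : Fin n → ℂ := fun j => ((if 0 ≤ α j then ρ else ρ⁻¹ : ℝ) : ℂ)
  have hs : ∀ j, ‖s j - 1‖ ≤ κ := by
    intro j
    simp only [s]
    rw [← Complex.ofReal_one, ← Complex.ofReal_sub, Complex.norm_real, Real.norm_eq_abs]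
    split_ifs
    · rw [abs_of_pos (by linarith)]; linarith
    · rw [abs_of_neg (by linarith)]
      have : ρ⁻¹ * ρ = 1 := inv_mul_cancel₀ hρ0.ne'
      nlinarith
  have hzw : ‖z‖ ≤ ‖w‖ + δ := by
    have h1 := norm_le_norm_add_norm_sub' z w
    have h2 : ‖z - w‖ < δ := by rwa [← dist_eq_norm, ← mem_ball]
    linarith
  set z' : Fin n → ℂ := fun j => s j * z j with hz'
  have hz'z : dist z' z ≤ δ := by
    rw [dist_eq_norm]
    refine (pi_norm_le_iff_of_nonneg hδ.le).2 fun j => ?_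
    have h1 : (z' - z) j = (s j - 1) * z j := by simp [hz']; ring
    rw [h1, norm_mul]
    calc ‖s j - 1‖ * ‖z j‖ ≤ κ * (‖w‖ + δ + 1) := by
          refine mul_le_mul (hs j) ?_ (norm_nonneg _) hκ0.le
          linarith [norm_le_pi_norm z j]
      _ = δ := by rw [hκ]; field_simp
  have hz'b : closedBall z' δ ⊆ (R : Set (Fin n → ℂ)) := by
    refine (closedBall_subset_closedBall' ?_).trans hεR
    have h1 := dist_triangle z' z w
    have h2 := (mem_ball.1 hz).le
    linarith
  have h1 := hC R (holoFn (bergmanComponent hR hr α f)) z' hz'b (differentiableOn_holoFn _)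
    (memLp_holoFn _)
  rw [← norm_eq_eLpNorm_holoFn] at h1
  have hz'R : z' ∈ R := hz'b (mem_closedBall_self hδ.le)
  have h2 : ‖coeffL hR hconn hr α f * monomialFn α z'‖ ≤ C * ‖f‖ := by
    rw [← (holoFn_bergmanComponent_eq hR hconn hr α f hz'R).1]
    exact h1.trans (mul_le_mul_of_nonneg_left (norm_bergmanComponent_le hR hr α f) hC0)
  have h3 : ‖monomialFn α s‖ = ∏ j, ρ ^ (α j).natAbs := by
    unfold monomialFn
    rw [norm_prod]
    refine Finset.prod_congr rfl fun j _ => ?_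
    rw [norm_zpow]
    simp only [s, Complex.norm_real, Real.norm_eq_abs]
    split_ifs with hj
    · rw [abs_of_pos hρ0]
      conv_lhs => rw [← Int.natAbs_of_nonneg hj]
      exact zpow_natCast _ _
    · rw [abs_of_pos (by positivity), inv_zpow, ← zpow_neg, ← zpow_natCast,
        Int.ofNat_natAbs_of_nonpos (by omega)]
  have h4 : monomialFn α z' = monomialFn α s * monomialFn α z := monomialFn_mul α s z
  have h5 : (∏ j, ρ ^ (α j).natAbs) * ∏ j, ρ⁻¹ ^ (α j).natAbs = 1 := by
    rw [← Finset.prod_mul_distrib]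
    refine Finset.prod_eq_one fun j _ => ?_
    rw [← mul_pow, mul_inv_cancel₀ hρ0.ne', one_pow]
  have h6 : 0 ≤ ∏ j, ρ⁻¹ ^ (α j).natAbs := Finset.prod_nonneg fun j _ => by positivity
  rw [h4, mul_left_comm, norm_mul, h3] at h2
  calc ‖coeffL hR hconn hr α f * monomialFn α z‖
      = ((∏ j, ρ ^ (α j).natAbs) * ‖coeffL hR hconn hr α f * monomialFn α z‖)
          * ∏ j, ρ⁻¹ ^ (α j).natAbs := by rw [mul_right_comm, h5, one_mul]
    _ ≤ C * ‖f‖ * ∏ j, ρ⁻¹ ^ (α j).natAbs := mul_le_mul_of_nonneg_right h2 h6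

/-- The Laurent expansion of a function in `A^r`. -/
theorem hasLaurentExpansion_holoFn (f : bergman R r) :
    HasLaurentExpansion R (holoFn f) fun α => coeffL hR hconn hr α f := by
  refine hasSumLocallyUniformlyOn_of_of_forall_exists_nhds fun w hw => ?_
  obtain ⟨δ, hδ, x, hx0, hx1, C, hb, hbound⟩ := exists_norm_coeffL_mul_le hR hconn hr w hw
  have hsum : Summable fun α : Fin n → ℤ => C * ‖f‖ * ∏ j, x ^ (α j).natAbs :=
    (summable_prod_pow_natAbs hx0 hx1).mul_left _
  refine ⟨ball w δ, mem_nhdsWithin_of_mem_nhds (ball_mem_nhds w hδ), ?_⟩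
  refine (HasSumUniformlyOn.of_norm_le_summable hsum
    fun α z hz => hbound f z hz α).congr_right fun z hz => ?_
  -- The Laurent series at `z` is the Fourier series of `f` on the orbit of `z`, taken at angle
  -- zero. The geometric bound makes it summable, so its sum is `f z`.
  let g : C(UnitAddTorus (Fin n), ℂ) := ⟨fun θ => holoFn f (rotate θ z),
    continuous_comp_rotate hR (differentiableOn_holoFn f).continuousOn (hb hz)⟩
  have hg : mFourierCoeff g = fun α => coeffL hR hconn hr α f * monomialFn α z := by
    ext α
    rw [← (holoFn_bergmanComponent_eq hR hconn hr α f (hb hz)).1, holoFn_bergmanComponent]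
    rfl
  have hgs : Summable (mFourierCoeff g) := by
    rw [hg]
    exact Summable.of_norm_bounded hsum fun α => hbound f z hz α
  have h1 := hasSum_mFourier_series_apply_of_summable hgs 0
  simp only [hg, mFourier_apply_zero, smul_eq_mul, mul_one] at h1
  have h2 : g 0 = holoFn f z := by simp [g, rotate_zero]
  rw [h2] at h1
  exact h1.tsum_eq

/-- `laurentCoeff` chooses some expansion; the Fourier coefficients on one orbit without zero
coordinates determine it uniquely. -/
theorem laurentCoeff_holoFn (f : bergman R r) (α : Fin n → ℤ) :
    laurentCoeff R (holoFn f) α = coeffL hR hconn hr α f := by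
  have h : ∃ c, HasLaurentExpansion R (holoFn f) c := ⟨_, hasLaurentExpansion_holoFn hR hconn hr f⟩
  obtain ⟨z, hz, hz0⟩ := exists_mem_forall_ne_zero R.isOpen hconn.nonempty
  have hF := (differentiableOn_holoFn f).continuousOn
  have h1 := mFourierCoeff_eq_of_hasLaurentExpansion hR hF h.choose_spec hz α
  have h2 := mFourierCoeff_eq_of_hasLaurentExpansion hR hF
    (hasLaurentExpansion_holoFn hR hconn hr f) hz α
  rw [h1] at h2
  rw [laurentCoeff, dif_pos h]
  exact mul_right_cancel₀ (monomialFn_ne_zero fun j hj => absurd hj (hz0 j)) h2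

theorem isCoeffFunctional_coeffL (α : Fin n → ℤ) :
    IsCoeffFunctional R r α (coeffL hR hconn hr α) := fun f =>
  (laurentCoeff_holoFn hR hconn hr f α).symm

theorem eq_coeffL_of_isCoeffFunctional {α : Fin n → ℤ} {a : StrongDual ℂ (bergman R r)}
    (h : IsCoeffFunctional R r α a) : a = coeffL hR hconn hr α := by
  ext f
  rw [h f, laurentCoeff_holoFn hR hconn hr]

end Laurent

/-! ### Monomials, their closed spans, and the kernel of `Φ_p` -/

section Monomials

variable {n : ℕ} {R : TopologicalSpace.Opens (Fin n → ℂ)}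

/-- The element of `A^r` represented by a holomorphic function. -/
noncomputable def bergmanMk {r : ℝ≥0∞} (F : (Fin n → ℂ) → ℂ) (hF : DifferentiableOn ℂ F R)
    (hm : MemLp F r (volume.restrict (R : Set (Fin n → ℂ)))) : bergman R r :=
  ⟨hm.toLp F, F, hF, hm.coeFn_toLp⟩

theorem holoFn_bergmanMk {r : ℝ≥0∞} {F : (Fin n → ℂ) → ℂ} (hF : DifferentiableOn ℂ F R)
    (hm : MemLp F r (volume.restrict (R : Set (Fin n → ℂ)))) :
    Set.EqOn (holoFn (bergmanMk F hF hm)) F R :=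
  holoFn_eqOn_of_ae_eq hF hm.coeFn_toLp

/-- The monomial `e_α` as an element of `A^r`. -/
noncomputable def mono {r : ℝ≥0∞} {α : Fin n → ℤ} (hα : α ∈ allowable R r) : bergman R r :=
  bergmanMk (monomialFn α) hα.1 hα.2

theorem holoFn_mono {r : ℝ≥0∞} {α : Fin n → ℤ} (hα : α ∈ allowable R r) :
    Set.EqOn (holoFn (mono hα)) (monomialFn α) R :=
  holoFn_bergmanMk hα.1 hα.2

theorem allowable_anti {p q : ℝ≥0∞} [IsFiniteMeasure (volume.restrict (R : Set (Fin n → ℂ)))]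
    (h : q ≤ p) : allowable R p ⊆ allowable R q :=
  fun _ hα => ⟨hα.1, hα.2.mono_exponent h⟩

variable (hR : IsReinhardt (R : Set (Fin n → ℂ))) (hconn : IsConnected (R : Set (Fin n → ℂ)))
  {r : ℝ≥0∞} [Fact (1 ≤ r)] (hr : r ≠ ⊤)

theorem mFourierCoeff_holoFn_rotate (α : Fin n → ℤ) (f : bergman R r) {z : Fin n → ℂ}
    (hz : z ∈ R) :
    mFourierCoeff (fun θ => holoFn f (rotate θ z)) α
      = coeffL hR hconn hr α f * monomialFn α z := by
  rw [← holoFn_bergmanComponent hR hr, (holoFn_bergmanComponent_eq hR hconn hr α f hz).1]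

theorem coeffL_of_eqOn {β : Fin n → ℤ} {f : bergman R r}
    (h : Set.EqOn (holoFn f) (monomialFn β) R) (α : Fin n → ℤ) :
    coeffL hR hconn hr α f = if α = β then 1 else 0 := by
  obtain ⟨z, hz, hz0⟩ := exists_mem_forall_ne_zero R.isOpen hconn.nonempty
  have h1 := mFourierCoeff_holoFn_rotate hR hconn hr α f hz
  have h2 : (fun θ => holoFn f (rotate θ z)) = fun θ => mFourier β θ • monomialFn β z := by
    ext θ
    rw [h (rotate_mem hR hz θ), monomialFn_rotate, smul_eq_mul]
  rw [h2, mFourierCoeff_mFourier_smul] at h1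
  have hne : monomialFn α z ≠ 0 := monomialFn_ne_zero fun j hj => absurd hj (hz0 j)
  split_ifs at h1 ⊢ with hab
  · subst hab
    exact (mul_eq_right₀ hne).1 h1.symm
  · exact (mul_eq_zero.1 h1.symm).resolve_right hne

theorem bergmanComponent_eq_smul_mono {α : Fin n → ℤ} (hα : α ∈ allowable R r)
    (f : bergman R r) :
    bergmanComponent hR hr α f = coeffL hR hconn hr α f • mono hα := by
  refine bergman_ext fun z hz => ?_
  rw [(holoFn_bergmanComponent_eq hR hconn hr α f hz).1, holoFn_smul, Pi.smul_apply,
    holoFn_mono hα hz, smul_eq_mul]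

theorem bergmanComponent_eq_zero {α : Fin n → ℤ} {f : bergman R r}
    (h : coeffL hR hconn hr α f = 0) : bergmanComponent hR hr α f = 0 := by
  refine bergman_ext fun z hz => ?_
  have h0 : holoFn (0 : bergman R r) z = 0 := by
    simpa using congrFun (holoFn_smul (0 : ℂ) (0 : bergman R r)) z
  rw [(holoFn_bergmanComponent_eq hR hconn hr α f hz).1, h, zero_mul, h0]

include hR hconn hr in
-- `f` lies in the closed span of its components, and each component is zero or a multiple of a
-- monomial that occurs in `f`.
theorem mem_of_forall_smul_mono_mem {W : Submodule ℂ (bergman R r)}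
    (hW : IsClosed (W : Set (bergman R r))) {f : bergman R r}
    (h : ∀ α (hα : α ∈ allowable R r), coeffL hR hconn hr α f ≠ 0 → mono hα ∈ W) : f ∈ W := by
  refine Submodule.topologicalClosure_minimal _ (Submodule.span_le.2 ?_) hW
    (bergman_mem_closure_span hR hr f)
  rintro _ ⟨α, rfl⟩
  by_cases h0 : coeffL hR hconn hr α f = 0
  · simp only [bergmanComponent_eq_zero hR hconn hr h0, SetLike.mem_coe, zero_mem]
  · have hα := allowable_of_coeffL_ne_zero hR hconn hr h0
    simp only [bergmanComponent_eq_smul_mono hR hconn hr hα]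
    exact W.smul_mem _ (h α hα h0)

/-- The coefficients are continuous, so they still vanish on the closure; conversely only monomials
with exponents in `A` occur in `f`. -/
theorem mem_monomialSpan_iff {A : Set (Fin n → ℤ)} {f : bergman R r} :
    f ∈ monomialSpan R r A ↔ ∀ α ∉ A, coeffL hR hconn hr α f = 0 := by
  constructor
  · intro hf α hα
    have : monomialSpan R r A ≤ (coeffL hR hconn hr α).ker := by
      refine Submodule.topologicalClosure_minimal _ (Submodule.span_le.2 ?_)
        (ContinuousLinearMap.isClosed_ker _)
      rintro g ⟨β, hβ, hg⟩
      rw [SetLike.mem_coe, LinearMap.mem_ker]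
      refine (coeffL_of_eqOn hR hconn hr hg α).trans (if_neg ?_)
      rintro rfl
      exact hα hβ
    exact this hf
  · intro h
    refine mem_of_forall_smul_mono_mem hR hconn hr (Submodule.isClosed_topologicalClosure _)
      fun α hα h0 => Submodule.le_topologicalClosure _ (Submodule.subset_span ?_)
    exact ⟨α, by by_contra hA; exact h0 (h α hA), holoFn_mono hα⟩

theorem mono_mem_monomialSpan {α : Fin n → ℤ} (hα : α ∈ allowable R r) {A : Set (Fin n → ℤ)}
    (hA : α ∈ A) : mono hα ∈ monomialSpan R r A :=
  Submodule.le_topologicalClosure _ (Submodule.subset_span ⟨α, hA, holoFn_mono hα⟩)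

include hR hconn hr in
theorem eq_zero_of_forall_coeffL_eq_zero {f : bergman R r}
    (h : ∀ α, coeffL hR hconn hr α f = 0) : f = 0 := by
  have : f ∈ (⊥ : Submodule ℂ (bergman R r)) :=
    mem_of_forall_smul_mono_mem hR hconn hr isClosed_singleton fun α _ h0 => absurd (h α) h0
  simpa using this

variable {p q : ℝ≥0∞} [Fact (1 ≤ p)] [Fact (1 ≤ q)] [ENNReal.HolderConjugate p q]

theorem Phi_eq_pairing (g : bergman R q) (f : bergman R p) :
    Phi R p q g f = pairing _ p q g.1 f.1 := by
  rw [Phi_apply, pairing_apply]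
  refine integral_congr_ae ?_
  filter_upwards [coeFn_ae_eq_holoFn g, coeFn_ae_eq_holoFn f] with z h1 h2
  rw [h1, h2]

include hconn in
-- The value is the integral of `|e_α|^2`. Were it zero, continuity would force `e_α = 0` on `R`,
-- yet `e_α` is nonzero where no coordinate vanishes.
theorem Phi_mono_mono_ne_zero {α : Fin n → ℤ} (hp : α ∈ allowable R p)
    (hq : α ∈ allowable R q) : Phi R p q (mono hq) (mono hp) ≠ 0 := by
  have h1 : ∀ᵐ z ∂(volume.restrict (R : Set (Fin n → ℂ))),
      holoFn (mono hp) z * conj (holoFn (mono hq) z) = ((‖monomialFn α z‖ ^ 2 : ℝ) : ℂ) := by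
    filter_upwards [ae_restrict_mem R.isOpen.measurableSet] with z hz
    rw [holoFn_mono hp hz, holoFn_mono hq hz, Complex.mul_conj, Complex.normSq_eq_norm_sq]
  have hint : Integrable (fun z => ‖monomialFn α z‖ ^ 2)
      (volume.restrict (R : Set (Fin n → ℂ))) := by
    exact ((integrable_congr h1).1 (integrable_mul_conj_holoFn (mono hq) (mono hp))).re
  intro h0
  rw [Phi_apply, integral_congr_ae h1, integral_complex_ofReal, Complex.ofReal_eq_zero,
    integral_eq_zero_iff_of_nonneg (fun z => by positivity) hint] at h0
  have h2 : monomialFn α =ᵐ[volume.restrict (R : Set (Fin n → ℂ))] 0 := by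
    filter_upwards [h0] with z hz
    simpa using hz
  have h3 := Measure.eqOn_open_of_ae_eq h2 R.isOpen hp.1.continuousOn continuousOn_const
  obtain ⟨z, hz, hz0⟩ := exists_mem_forall_ne_zero R.isOpen hconn.nonempty
  exact monomialFn_ne_zero (fun j hj => absurd hj (hz0 j)) (h3 hz)

/-- `e_α` is its own `α`-component, and self-adjointness moves the component projection onto `g`. -/
theorem Phi_mono_right (hp_top : p ≠ ⊤) (hq_top : q ≠ ⊤) {α : Fin n → ℤ}
    (hp : α ∈ allowable R p) (hq : α ∈ allowable R q) (g : bergman R q) :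
    Phi R p q g (mono hp)
      = conj (coeffL hR hconn hq_top α g) * Phi R p q (mono hq) (mono hp) := by
  have h1 : bergmanComponent hR hp_top α (mono hp) = mono hp := by
    rw [bergmanComponent_eq_smul_mono hR hconn hp_top hp,
      coeffL_of_eqOn hR hconn hp_top (holoFn_mono hp), if_pos rfl, one_smul]
  have h2 : Phi R p q (bergmanComponent hR hq_top α g) (mono hp) = Phi R p q g (mono hp) := by
    rw [Phi_eq_pairing, coe_bergmanComponent, pairing_lpComponent hR hp_top hq_top,
      ← coe_bergmanComponent, h1, ← Phi_eq_pairing]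
  rw [← h2, bergmanComponent_eq_smul_mono hR hconn hq_top hq, map_smulₛₗ]
  rfl

/-- A continuous functional on `A^p` is determined by its values on monomials, and these are nonzero
multiples of the conjugated coefficients of `g`. -/
theorem Phi_eq_zero_iff (hp_top : p ≠ ⊤) (hq_top : q ≠ ⊤)
    (hpq : allowable R p ⊆ allowable R q) {g : bergman R q} :
    Phi R p q g = 0 ↔ ∀ α ∈ allowable R p, coeffL hR hconn hq_top α g = 0 := by
  have key : ∀ α (hα : α ∈ allowable R p),
      Phi R p q g (mono hα) = 0 ↔ coeffL hR hconn hq_top α g = 0 := by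
    intro α hα
    rw [Phi_mono_right hR hconn hp_top hq_top hα (hpq hα), mul_eq_zero,
      or_iff_left (Phi_mono_mono_ne_zero hconn hα (hpq hα)), map_eq_zero]
  constructor
  · intro h α hα
    rw [← key α hα, h, _root_.zero_apply]
  · intro h
    ext f
    have : f ∈ (Phi R p q g).ker :=
      mem_of_forall_smul_mono_mem hR hconn hp_top (ContinuousLinearMap.isClosed_ker _)
        fun α hα _ => (key α hα).2 (h α hα)
    exact this

include hR hconn in
-- Coefficients outside the `L^q`-allowable indices vanish automatically, so membership in the span
-- only constrains those in `allowable R p`.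
theorem ker_Phi (hp_top : p ≠ ⊤) (hq_top : q ≠ ⊤) (hpq : allowable R p ⊆ allowable R q) :
    (Phi R p q).ker = monomialSpan R q (allowable R q \ allowable R p) := by
  ext g
  rw [mem_monomialSpan_iff hR hconn hq_top, LinearMap.mem_ker]
  refine (Phi_eq_zero_iff hR hconn hp_top hq_top hpq).trans ⟨fun h α hα => ?_, fun h α hα => ?_⟩
  · by_contra h0
    exact hα ⟨allowable_of_coeffL_ne_zero hR hconn hq_top h0, fun h1 => h0 (h α h1)⟩
  · exact h α fun h1 => h1.2 hα

include hR hconn in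
theorem eq_zero_of_mem_monomialSpan_of_Phi_eq_zero (hp_top : p ≠ ⊤) (hq_top : q ≠ ⊤)
    (hpq : allowable R p ⊆ allowable R q) {g : bergman R q}
    (hg : g ∈ monomialSpan R q (allowable R p)) (h : Phi R p q g = 0) : g = 0 := by
  refine eq_zero_of_forall_coeffL_eq_zero hR hconn hq_top fun α => ?_
  by_cases hα : α ∈ allowable R p
  · exact (Phi_eq_zero_iff hR hconn hp_top hq_top hpq).1 h α hα
  · exact (mem_monomialSpan_iff hR hconn hq_top).1 hg α hα

end Monomials

/-! ### The sub-Bergman projection on `L^p` and `L^q` -/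

section Projection

variable {n : ℕ} {R : TopologicalSpace.Opens (Fin n → ℂ)}

/-- Laurent coefficients depend only on the function, not on the exponent of the space in which it
is considered. -/
theorem coeffL_congr (hR : IsReinhardt (R : Set (Fin n → ℂ)))
    (hconn : IsConnected (R : Set (Fin n → ℂ))) {r s : ℝ≥0∞} [Fact (1 ≤ r)] [Fact (1 ≤ s)]
    (hr : r ≠ ⊤) (hs : s ≠ ⊤) {f : bergman R r} {g : bergman R s}
    (h : Set.EqOn (holoFn f) (holoFn g) R) (α : Fin n → ℤ) :
    coeffL hR hconn hr α f = coeffL hR hconn hs α g := by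
  have : holoFn f = holoFn g := by
    ext z
    by_cases hz : z ∈ R
    · exact h hz
    · rw [holoFn_of_notMem f hz, holoFn_of_notMem g hz]
  rw [← laurentCoeff_holoFn hR hconn hr, ← laurentCoeff_holoFn hR hconn hs, this]

/-- The projection onto the sub-Bergman space maps into the functions whose Laurent coefficients
vanish off the `L^p`-allowable multi-indices. -/
theorem coeffL_eq_zero_of_mem_subBergmanSpace (hR : IsReinhardt (R : Set (Fin n → ℂ)))
    (hconn : IsConnected (R : Set (Fin n → ℂ))) {p : ℝ≥0∞} [Fact (1 ≤ p)] (hp : p ≠ ⊤)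
    {α : Fin n → ℤ} (hα : α ∉ allowable R p) {f : bergman R 2}
    (hf : f.1 ∈ subBergmanSpace R p) : coeffL hR hconn ENNReal.ofNat_ne_top α f = 0 := by
  have h2 : (2 : ℝ≥0∞) ≠ ⊤ := ENNReal.ofNat_ne_top
  -- The generators also lie in `A^p`, where a non-allowable coefficient is zero. Continuity of the
  -- component projection on `L^2` extends this to the closure.
  have : subBergmanSpace R p ≤ (lpComponent hR h2 α).ker := by
    refine Submodule.topologicalClosure_minimal _ ?_ (ContinuousLinearMap.isClosed_ker _)
    rintro g ⟨hg, hgp⟩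
    have hm : MemLp (holoFn (⟨g, hg⟩ : bergman R 2)) p (volume.restrict (R : Set (Fin n → ℂ))) :=
      (memLp_congr_ae (coeFn_ae_eq_holoFn (⟨g, hg⟩ : bergman R 2))).1 hgp
    have h0 : coeffL hR hconn h2 α ⟨g, hg⟩ = 0 := by
      rw [← coeffL_congr hR hconn hp h2 (holoFn_bergmanMk (differentiableOn_holoFn _) hm)]
      by_contra h0
      exact hα (allowable_of_coeffL_ne_zero hR hconn hp h0)
    exact congrArg Subtype.val (bergmanComponent_eq_zero hR hconn h2 h0)
  have h0 : bergmanComponent hR h2 α f = 0 := Subtype.ext (this hf)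
  rw [coeffL]
  simp only [_root_.smul_apply, ContinuousLinearMap.comp_apply, h0, map_zero, smul_zero]

theorem inner_eq_integral_Lp {X : Type*} [MeasurableSpace X] {μ : Measure X} (f g : Lp ℂ 2 μ) :
    inner ℂ f g = ∫ x, g x * conj (f x) ∂μ := by
  rw [L2.inner_def]
  rfl

/-- Pointwise, the projection of `u` is dominated by the absolute-kernel operator applied to `|u|`,
which has the same `L^p` norm as `u`. -/
theorem eLpNorm_orthogonalProjectionOnto_le {p : ℝ≥0∞} {C : NNReal}
    (hC : ∀ f : (Fin n → ℂ) → ℂ, MemLp f p (volume.restrict (R : Set (Fin n → ℂ))) →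
      eLpNorm (fun z => ∫ w in (R : Set (Fin n → ℂ)), (‖subBergmanKernel R p z w‖ : ℂ) * f w) p
        (volume.restrict (R : Set (Fin n → ℂ)))
      ≤ C * eLpNorm f p (volume.restrict (R : Set (Fin n → ℂ))))
    (u : Lp ℂ 2 (volume.restrict (R : Set (Fin n → ℂ))))
    (hu : MemLp u p (volume.restrict (R : Set (Fin n → ℂ)))) :
    eLpNorm ((subBergmanSpace R p).orthogonalProjectionOnto u).1 p
        (volume.restrict (R : Set (Fin n → ℂ)))
      ≤ C * eLpNorm u p (volume.restrict (R : Set (Fin n → ℂ))) := by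
  have h1 := hC (fun w => (‖u w‖ : ℂ)) hu.norm.ofReal
  have h2 : eLpNorm (fun w => (‖u w‖ : ℂ)) p (volume.restrict (R : Set (Fin n → ℂ)))
      = eLpNorm u p (volume.restrict (R : Set (Fin n → ℂ))) :=
    eLpNorm_congr_norm_ae (Eventually.of_forall fun w => by simp)
  rw [h2] at h1
  refine (eLpNorm_mono_ae ?_).trans h1
  filter_upwards [coeFn_ae_eq_holoFn (⟨((subBergmanSpace R p).orthogonalProjectionOnto u).1,
    subBergmanSpace_le R p ((subBergmanSpace R p).orthogonalProjectionOnto u).2⟩ :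
      bergman R 2)] with z hz
  rw [hz, subBergmanProj_eq_integral]
  refine (norm_integral_le_integral_norm _).trans (le_of_eq ?_)
  have h3 : ∀ w, (‖subBergmanKernel R p z w‖ : ℂ) * (‖u w‖ : ℂ)
      = ((‖subBergmanKernel R p z w * u w‖ : ℝ) : ℂ) := fun w => by rw [norm_mul]; push_cast; rfl
  simp only [h3]
  rw [integral_complex_ofReal, Complex.norm_real, Real.norm_of_nonneg]
  exact integral_nonneg fun w => norm_nonneg _

variable [IsFiniteMeasure (volume.restrict (R : Set (Fin n → ℂ)))]

/-- The inclusion `A^r ⊆ A^s` for `s ≤ r`. -/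
noncomputable def bergmanIncl (R : TopologicalSpace.Opens (Fin n → ℂ))
    [IsFiniteMeasure (volume.restrict (R : Set (Fin n → ℂ)))] (r s : ℝ≥0∞) [Fact (1 ≤ r)]
    [Fact (1 ≤ s)] (h : s ≤ r) : bergman R r →L[ℂ] bergman R s :=
  ((lpIncl _ r s h).comp (bergman R r).subtypeL).codRestrict (bergman R s) fun f =>
    ⟨holoFn f, differentiableOn_holoFn f, (lpIncl_ae_eq r s h f.1).trans (coeFn_ae_eq_holoFn f)⟩

theorem holoFn_bergmanIncl {r s : ℝ≥0∞} [Fact (1 ≤ r)] [Fact (1 ≤ s)] (h : s ≤ r)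
    (f : bergman R r) : Set.EqOn (holoFn (bergmanIncl R r s h f)) (holoFn f) R :=
  holoFn_eqOn_of_ae_eq (differentiableOn_holoFn f)
    ((lpIncl_ae_eq r s h f.1).trans (coeFn_ae_eq_holoFn f))

theorem coe_bergmanIncl {r s : ℝ≥0∞} [Fact (1 ≤ r)] [Fact (1 ≤ s)] (h : s ≤ r)
    (f : bergman R r) : (bergmanIncl R r s h f).1 = lpIncl _ r s h f.1 := rfl

variable {p q : ℝ≥0∞} [Fact (1 ≤ p)] [Fact (1 ≤ q)]

theorem bergmanIncl_mem_subBergmanSpace (h : 2 ≤ p) (f : bergman R p) :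
    (bergmanIncl R p 2 h f).1 ∈ subBergmanSpace R p :=
  Submodule.le_topologicalClosure _ ⟨(bergmanIncl R p 2 h f).2,
    (memLp_congr_ae (lpIncl_ae_eq p 2 h f.1)).2 (Lp.memLp f.1)⟩

/-- The projection onto the sub-Bergman space, as an operator from `L^2` to `A^q`. -/
noncomputable def projIncl (R : TopologicalSpace.Opens (Fin n → ℂ))
    [IsFiniteMeasure (volume.restrict (R : Set (Fin n → ℂ)))] (p q : ℝ≥0∞)
    [Fact (1 ≤ q)] (hq2 : q ≤ 2) :
    Lp ℂ 2 (volume.restrict (R : Set (Fin n → ℂ))) →L[ℂ] bergman R q :=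
  (bergmanIncl R 2 q hq2).comp
    (((subBergmanSpace R p).subtypeL.comp
      (subBergmanSpace R p).orthogonalProjectionOnto).codRestrict (bergman R 2)
        fun _ => subBergmanSpace_le R p (Subtype.prop _))

omit [Fact (1 ≤ p)] in
theorem coe_projIncl (hq2 : q ≤ 2) (u : Lp ℂ 2 (volume.restrict (R : Set (Fin n → ℂ)))) :
    (projIncl R p q hq2 u).1
      = lpIncl _ 2 q hq2 ((subBergmanSpace R p).orthogonalProjectionOnto u).1 := rfl

theorem projIncl_mem_monomialSpan (hR : IsReinhardt (R : Set (Fin n → ℂ)))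
    (hconn : IsConnected (R : Set (Fin n → ℂ))) (hp : p ≠ ⊤) (hq : q ≠ ⊤) (hq2 : q ≤ 2)
    (u : Lp ℂ 2 (volume.restrict (R : Set (Fin n → ℂ)))) :
    projIncl R p q hq2 u ∈ monomialSpan R q (allowable R p) := by
  rw [mem_monomialSpan_iff hR hconn hq]
  intro α hα
  refine (coeffL_congr hR hconn hq ENNReal.ofNat_ne_top (holoFn_bergmanIncl hq2 _) α).trans ?_
  exact coeffL_eq_zero_of_mem_subBergmanSpace hR hconn hp hα
    ((subBergmanSpace R p).orthogonalProjectionOnto u).2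

variable [ENNReal.HolderConjugate p q]

theorem pairing_lpIncl {X : Type*} [MeasurableSpace X] {μ : Measure X} [IsFiniteMeasure μ]
    (hp2 : 2 ≤ p) (hq2 : q ≤ 2) (w : Lp ℂ 2 μ) (f : Lp ℂ p μ) :
    pairing μ p q (lpIncl μ 2 q hq2 w) f = inner ℂ w (lpIncl μ p 2 hp2 f) := by
  rw [pairing_apply, inner_eq_integral_Lp]
  refine integral_congr_ae ?_
  filter_upwards [lpIncl_ae_eq 2 q hq2 w, lpIncl_ae_eq p 2 hp2 f] with x h1 h2
  rw [h1, h2]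

/-- For `p ≥ 2` the function `f` lies in the sub-Bergman space, so its inner products with `u` and
with the projection of `u` agree. -/
theorem Phi_projIncl (hp2 : 2 ≤ p) (hq2 : q ≤ 2)
    (u : Lp ℂ 2 (volume.restrict (R : Set (Fin n → ℂ)))) (f : bergman R p) :
    Phi R p q (projIncl R p q hq2 u) f = pairing _ p q (lpIncl _ 2 q hq2 u) f.1 := by
  rw [Phi_eq_pairing, coe_projIncl, pairing_lpIncl hp2, pairing_lpIncl hp2]
  have hmem := bergmanIncl_mem_subBergmanSpace hp2 f
  exact Submodule.inner_orthogonalProjectionOnto_eq_of_mem_right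
    (⟨_, hmem⟩ : subBergmanSpace R p) u

variable [ENNReal.HolderConjugate q p]

/-- The projection is bounded in the `L^q` norm, by duality. -/
theorem norm_projIncl_le (hp : p ≠ ⊤) (hq : q ≠ ⊤) (hp2 : 2 ≤ p) (hq2 : q ≤ 2) {C : NNReal}
    (hC : ∀ f : (Fin n → ℂ) → ℂ, MemLp f p (volume.restrict (R : Set (Fin n → ℂ))) →
      eLpNorm (fun z => ∫ w in (R : Set (Fin n → ℂ)), (‖subBergmanKernel R p z w‖ : ℂ) * f w) p
        (volume.restrict (R : Set (Fin n → ℂ)))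
      ≤ C * eLpNorm f p (volume.restrict (R : Set (Fin n → ℂ))))
    (u : Lp ℂ 2 (volume.restrict (R : Set (Fin n → ℂ)))) :
    ‖projIncl R p q hq2 u‖ ≤ C * ‖lpIncl _ 2 q hq2 u‖ := by
  set g := projIncl R p q hq2 u with hg
  change (eLpNorm g.1 q (volume.restrict (R : Set (Fin n → ℂ)))).toReal ≤ _
  -- The exponents trade roles here: the duality function of `g ∈ L^q` lies in `L^p ⊆ L^2`, where
  -- the projection is available and bounded.
  refine toReal_eLpNorm_le_of_dualPow (q := p) hq hp (Lp.memLp g.1) (by positivity) ?_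
  have hd := memLp_dualPow (q := p) hq hp (Lp.memLp g.1)
  set d : Lp ℂ p (volume.restrict (R : Set (Fin n → ℂ))) := hd.toLp _ with hddef
  set P := (subBergmanSpace R p).orthogonalProjectionOnto with hP
  have hm : MemLp (lpIncl _ p 2 hp2 d) p (volume.restrict (R : Set (Fin n → ℂ))) :=
    (memLp_congr_ae (lpIncl_ae_eq p 2 hp2 d)).2 (Lp.memLp d)
  have hle := eLpNorm_orthogonalProjectionOnto_le hC _ hm
  have hPm : MemLp (P (lpIncl _ p 2 hp2 d)).1 p (volume.restrict (R : Set (Fin n → ℂ))) :=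
    ⟨(Lp.memLp _).1, hle.trans_lt (ENNReal.mul_lt_top ENNReal.coe_lt_top hm.2)⟩
  -- Self-adjointness of the orthogonal projection transfers it from `u` to the norming function
  -- `d`.
  have h1 : ∫ x in (R : Set (Fin n → ℂ)), dualPow q.toReal (g.1 x) * conj (g.1 x)
      = ∫ x in (R : Set (Fin n → ℂ)), (P (lpIncl _ p 2 hp2 d)).1 x * conj (lpIncl _ 2 q hq2 u x) := by
    calc _ = pairing _ p q g.1 d := by
          rw [pairing_apply]
          refine integral_congr_ae ?_
          filter_upwards [hd.coeFn_toLp] with x hx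
          rw [hx]
      _ = inner ℂ (P u).1 (lpIncl _ p 2 hp2 d) := by
          rw [hg, coe_projIncl, pairing_lpIncl hp2]
      _ = inner ℂ u (P (lpIncl _ p 2 hp2 d)).1 := by
          exact (Submodule.inner_orthogonalProjectionOnto_eq_of_mem_left (P u) _).symm.trans
            (Submodule.inner_orthogonalProjectionOnto_eq_of_mem_right _ u)
      _ = _ := by
          rw [inner_eq_integral_Lp]
          refine integral_congr_ae ?_
          filter_upwards [lpIncl_ae_eq 2 q hq2 u] with x hx
          rw [hx]
  rw [h1]
  refine (norm_integral_mul_conj_le hPm (Lp.memLp _)).trans ?_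
  have h2 : (eLpNorm (P (lpIncl _ p 2 hp2 d)).1 p (volume.restrict (R : Set (Fin n → ℂ)))).toReal
      ≤ C * (eLpNorm (fun x => dualPow q.toReal (g.1 x)) p
          (volume.restrict (R : Set (Fin n → ℂ)))).toReal := by
    rw [← eLpNorm_congr_ae hd.coeFn_toLp, ← hddef, ← eLpNorm_congr_ae (lpIncl_ae_eq p 2 hp2 d)]
    have := ENNReal.toReal_mono (ENNReal.mul_ne_top ENNReal.coe_ne_top hm.2.ne) hle
    rwa [ENNReal.toReal_mul, ENNReal.coe_toReal] at this
  rw [mul_right_comm]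
  exact mul_le_mul_of_nonneg_right h2 ENNReal.toReal_nonneg

/-- Every functional on `A^p` is represented by an element of `G^{q,p}`. -/
theorem exists_mem_monomialSpan_Phi_eq (hR : IsReinhardt (R : Set (Fin n → ℂ)))
    (hconn : IsConnected (R : Set (Fin n → ℂ))) (hp : p ≠ ⊤) (hq : q ≠ ⊤) (hp2 : 2 ≤ p)
    (hq2 : q ≤ 2) (hB : AbsKernelBounded R p (subBergmanKernel R p))
    (φ : StrongDual ℂ (bergman R p)) :
    ∃ g ∈ monomialSpan R q (allowable R p), Phi R p q g = φ := by
  obtain ⟨C, hC⟩ := hB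
  obtain ⟨u, hu⟩ := exists_pairing_eq_of_two_le (q := q) hp2 hp hq (isClosed_bergman R p) φ
  obtain ⟨x, hx, hxu⟩ := mem_closure_iff_seq_limit.1
    (denseRange_lpIncl (μ := volume.restrict (R : Set (Fin n → ℂ))) 2 q hq2 hq u)
  choose v hv using hx
  -- The projection has been defined only on `L^2`; its `L^q` bound makes the projections of an
  -- `L^2` approximation of `u` converge in `A^q`.
  have hcau : CauchySeq fun k => projIncl R p q hq2 (v k) := by
    rw [cauchySeq_iff_tendsto_dist_atTop_0]
    have h0 := (cauchySeq_iff_tendsto_dist_atTop_0.1 hxu.cauchySeq).const_mul (C : ℝ)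
    rw [mul_zero] at h0
    refine squeeze_zero (fun _ => dist_nonneg) (fun k => ?_) h0
    rw [dist_eq_norm, dist_eq_norm, ← map_sub, ← hv, ← hv, ← map_sub]
    exact norm_projIncl_le hp hq hp2 hq2 hC _
  obtain ⟨g, hg⟩ := cauchySeq_tendsto_of_complete hcau
  refine ⟨g, (Submodule.isClosed_topologicalClosure _).mem_of_tendsto hg
    (Eventually.of_forall fun k => projIncl_mem_monomialSpan hR hconn hp hq hq2 _), ?_⟩
  ext f
  have h1 : Tendsto (fun k => Phi R p q (projIncl R p q hq2 (v k)) f) atTop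
      (𝓝 (Phi R p q g f)) :=
    ((ContinuousLinearMap.apply ℂ ℂ f).continuous.tendsto _).comp
      (((Phi R p q).continuous.tendsto g).comp hg)
  have h2 : Tendsto (fun k => pairing _ p q (x k) f.1) atTop (𝓝 (pairing _ p q u f.1)) :=
    ((ContinuousLinearMap.apply ℂ ℂ f.1).continuous.tendsto _).comp
      (((pairing (volume.restrict (R : Set (Fin n → ℂ))) p q).continuous.tendsto u).comp hxu)
  rw [hu]
  refine tendsto_nhds_unique h1 (h2.congr fun k => ?_)
  rw [Phi_projIncl hp2, hv]

/-- An element of `L^p` and its projection induce the same functional on `A^p ⊆ A^q`. -/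
theorem exists_Phi_bergmanIncl_eq (hp2 : 2 ≤ p) (hq2 : q ≤ 2)
    (hB : AbsKernelBounded R p (subBergmanKernel R p))
    (h : Lp ℂ p (volume.restrict (R : Set (Fin n → ℂ)))) :
    ∃ F : bergman R p, ∀ f : bergman R p,
      Phi R q p F (bergmanIncl R p q (hq2.trans hp2) f)
        = pairing _ q p h (lpIncl _ p q (hq2.trans hp2) f.1) := by
  obtain ⟨C, hC⟩ := hB
  set P := (subBergmanSpace R p).orthogonalProjectionOnto with hP
  -- The required `F` is this projection of `h`; the `L^p` bound shows that it lies in `A^p`.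
  set k := P (lpIncl _ p 2 hp2 h) with hk
  have hm : MemLp (lpIncl _ p 2 hp2 h) p (volume.restrict (R : Set (Fin n → ℂ))) :=
    (memLp_congr_ae (lpIncl_ae_eq p 2 hp2 h)).2 (Lp.memLp h)
  have hle := eLpNorm_orthogonalProjectionOnto_le hC _ hm
  have hkm : MemLp k.1 p (volume.restrict (R : Set (Fin n → ℂ))) :=
    ⟨(Lp.memLp _).1, hle.trans_lt (ENNReal.mul_lt_top ENNReal.coe_lt_top hm.2)⟩
  have hkb : k.1 ∈ bergman R 2 := subBergmanSpace_le R p k.2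
  have hF : hkm.toLp _ ∈ bergman R p := ⟨holoFn (⟨k.1, hkb⟩ : bergman R 2),
    differentiableOn_holoFn _,
    hkm.coeFn_toLp.trans (coeFn_ae_eq_holoFn (⟨k.1, hkb⟩ : bergman R 2))⟩
  refine ⟨⟨hkm.toLp _, hF⟩, fun f => ?_⟩
  have hincl : ∀ f : bergman R p, lpIncl _ p q (hq2.trans hp2) f.1
      = lpIncl _ 2 q hq2 (bergmanIncl R p 2 hp2 f).1 := fun f => Lp.ext
    ((lpIncl_ae_eq p q _ f.1).trans ((lpIncl_ae_eq 2 q hq2 _).trans (lpIncl_ae_eq p 2 hp2 f.1)).symm)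
  have hk2 : lpIncl _ p 2 hp2 (hkm.toLp _) = k.1 :=
    Lp.ext ((lpIncl_ae_eq p 2 hp2 _).trans hkm.coeFn_toLp)
  rw [Phi_eq_pairing, coe_bergmanIncl, pairing_conj (p := p), pairing_conj (p := p), hincl,
    pairing_lpIncl hp2, pairing_lpIncl hp2, hk2]
  congr 1
  exact Submodule.inner_orthogonalProjectionOnto_eq_of_mem_left
    (⟨_, bergmanIncl_mem_subBergmanSpace hp2 f⟩ : subBergmanSpace R p) _

end Projection

/-! ### Conjugation of Bergman functions on a Reinhardt domain -/

section Conjugation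

variable {n : ℕ} {R : TopologicalSpace.Opens (Fin n → ℂ)}
  (hR : IsReinhardt (R : Set (Fin n → ℂ)))

include hR in
-- Conjugating `z_j` is the same as rotating it by the angle `-2 arg z_j`.
theorem conj_mem {z : Fin n → ℂ} (hz : z ∈ R) : (fun j => conj (z j)) ∈ R := by
  have h := hR z hz fun j => -(2 * Complex.arg (z j))
  have h1 : (fun j => Complex.exp ((-(2 * Complex.arg (z j)) : ℝ) * Complex.I) * z j)
      = fun j => conj (z j) := by
    ext j
    have h2 := Complex.norm_mul_exp_arg_mul_I (z j)
    have h3 : conj (z j) = ‖z j‖ * Complex.exp (-(Complex.arg (z j) * Complex.I)) := by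
      conv_lhs => rw [← h2]
      rw [map_mul, Complex.conj_ofReal, ← Complex.exp_conj, map_mul, Complex.conj_I,
        Complex.conj_ofReal, mul_neg]
    have h4 : ∀ c : ℂ, c * z j = c * (‖z j‖ * Complex.exp (Complex.arg (z j) * Complex.I)) :=
      fun c => by rw [h2]
    rw [h3, h4, mul_left_comm, ← Complex.exp_add]
    congr 2
    push_cast
    ring
  rwa [h1] at h

include hR in
theorem measurePreserving_conj :
    MeasurePreserving (fun (z : Fin n → ℂ) j => conj (z j))
      (volume.restrict (R : Set (Fin n → ℂ))) (volume.restrict (R : Set (Fin n → ℂ))) := by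
  have h1 : MeasurePreserving (fun (z : Fin n → ℂ) j => conj (z j)) volume volume :=
    volume_preserving_pi fun _ : Fin n => Complex.conjLIE.measurePreserving
  have h := h1.restrict_preimage R.isOpen.measurableSet
  have h2 : (fun (z : Fin n → ℂ) j => conj (z j)) ⁻¹' (R : Set (Fin n → ℂ)) = R := by
    ext z
    refine ⟨fun hz => ?_, fun hz => conj_mem hR hz⟩
    have := conj_mem hR hz
    simpa using this
  rwa [h2] at h

theorem differentiableOn_conj_comp_conj {F : (Fin n → ℂ) → ℂ} (hF : DifferentiableOn ℂ F R) :
    ∀ z : Fin n → ℂ, (fun j => conj (z j)) ∈ R →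
      DifferentiableAt ℂ (fun z => conj (F fun j => conj (z j))) z := by
  intro z hz
  have h1 := ((hF _ hz).differentiableAt (R.isOpen.mem_nhds hz)).star_star
  have h2 : star (fun j => conj (z j)) = z := by ext j; simp
  rw [h2] at h1
  exact h1

variable {r : ℝ≥0∞} [Fact (1 ≤ r)]

omit [Fact (1 ≤ r)] in
include hR in
theorem memLp_conj_comp_conj (f : bergman R r) :
    MemLp (fun z => conj (holoFn f fun j => conj (z j))) r
      (volume.restrict (R : Set (Fin n → ℂ))) :=
  ((memLp_holoFn f).comp_measurePreserving (measurePreserving_conj hR)).star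

/-- The conjugation `f ↦ conj (f (conj z))` of `A^r`. -/
noncomputable def bergmanConj (f : bergman R r) : bergman R r :=
  bergmanMk (fun z => conj (holoFn f fun j => conj (z j)))
    (fun z hz => (differentiableOn_conj_comp_conj (differentiableOn_holoFn f) z
      (conj_mem hR hz)).differentiableWithinAt)
    (memLp_conj_comp_conj hR f)

omit [Fact (1 ≤ r)] in
theorem holoFn_bergmanConj (f : bergman R r) {z : Fin n → ℂ} (hz : z ∈ R) :
    holoFn (bergmanConj hR f) z = conj (holoFn f fun j => conj (z j)) :=
  holoFn_bergmanMk _ _ hz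

omit [Fact (1 ≤ r)] in
theorem bergmanConj_bergmanConj (f : bergman R r) : bergmanConj hR (bergmanConj hR f) = f :=
  bergman_ext fun z hz => by
    rw [holoFn_bergmanConj hR _ hz, holoFn_bergmanConj hR _ (conj_mem hR hz)]
    simp

theorem norm_bergmanConj (f : bergman R r) : ‖bergmanConj hR f‖ = ‖f‖ := by
  rw [norm_eq_eLpNorm_holoFn f,
    ← eLpNorm_comp_measurePreserving (memLp_holoFn f).1 (measurePreserving_conj hR)]
  refine congrArg ENNReal.toReal (eLpNorm_congr_norm_ae ?_)
  filter_upwards [(memLp_conj_comp_conj hR f).coeFn_toLp] with z hz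
  refine (congrArg norm hz).trans ?_
  simp

/-- The conjugation as a continuous conjugate-linear map. -/
noncomputable def bergmanConjL : bergman R r →SL[starRingEnd ℂ] bergman R r :=
  LinearMap.mkContinuous
    { toFun := bergmanConj hR
      map_add' := fun f g => bergman_ext fun z hz => by
        simp only [holoFn_add, Pi.add_apply, holoFn_bergmanConj hR _ hz, map_add]
      map_smul' := fun c f => bergman_ext fun z hz => by
        simp only [holoFn_smul, Pi.smul_apply, holoFn_bergmanConj hR _ hz, smul_eq_mul, map_mul] }
    1 fun f => by rw [one_mul]; exact (norm_bergmanConj hR f).le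

/-- The conjugation fixes every monomial and is continuous. -/
theorem bergmanConj_mem_monomialSpan {A : Set (Fin n → ℤ)} {f : bergman R r}
    (hf : f ∈ monomialSpan R r A) : bergmanConj hR f ∈ monomialSpan R r A := by
  have : monomialSpan R r A ≤
      (monomialSpan R r A).comap (bergmanConjL hR (r := r)).toLinearMap := by
    refine Submodule.topologicalClosure_minimal _ (Submodule.span_le.2 ?_)
      ((Submodule.isClosed_topologicalClosure _).preimage (bergmanConjL hR).continuous)
    rintro g ⟨α, hα, hg⟩
    refine Submodule.le_topologicalClosure _ (Submodule.subset_span ⟨α, hα, fun z hz => ?_⟩)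
    refine (holoFn_bergmanConj hR g hz).trans ?_
    rw [hg (conj_mem hR hz)]
    simp [monomialFn]
  exact this hf

end Conjugation

/-! ### The duality theorem and the decomposition of the dual of `A^q` -/

section Duality

/-- The open mapping theorem, in semilinear form so that it serves both the conjugate-linear and the
linear homeomorphism. -/
theorem exists_continuousLinearEquiv_of_bijective {E F : Type*} [NormedAddCommGroup E]
    [NormedSpace ℂ E] [NormedAddCommGroup F] [NormedSpace ℂ F] [CompleteSpace E] [CompleteSpace F]
    {σ : ℂ →+* ℂ} {σ' : ℂ →+* ℂ} [RingHomInvPair σ σ'] [RingHomInvPair σ' σ] [RingHomIsometric σ]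
    [RingHomIsometric σ'] (L : E →SL[σ] F) (hinj : ∀ x, L x = 0 → x = 0)
    (hsurj : Function.Surjective L) : ∃ e : E ≃SL[σ] F, ∀ x, e x = L x :=
  ⟨ContinuousLinearEquiv.ofBijective L (LinearMap.ker_eq_bot'.2 hinj)
    (LinearMap.range_eq_top.2 hsurj), fun _ => rfl⟩

variable {n : ℕ} {R : TopologicalSpace.Opens (Fin n → ℂ)}
  [IsFiniteMeasure (volume.restrict (R : Set (Fin n → ℂ)))]
  (hR : IsReinhardt (R : Set (Fin n → ℂ))) (hconn : IsConnected (R : Set (Fin n → ℂ)))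
  {p q : ℝ≥0∞} [Fact (1 ≤ p)] [Fact (1 ≤ q)] [ENNReal.HolderConjugate p q]
  [ENNReal.HolderConjugate q p]
  (hp : p ≠ ⊤) (hq : q ≠ ⊤) (hp2 : 2 ≤ p) (hq2 : q ≤ 2)
  (hB : AbsKernelBounded R p (subBergmanKernel R p))

include hR hconn hp hq hp2 hq2 hB in
/-- The restriction of `Φ_p` to `G^{q,p}` is a conjugate-linear homeomorphism. -/
theorem exists_continuousLinearEquiv_eq_Phi :
    ∃ E : monomialSpan R q (allowable R p) ≃SL[starRingEnd ℂ] StrongDual ℂ (bergman R p),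
      ∀ g, E g = Phi R p q g := by
  have : CompleteSpace (monomialSpan R q (allowable R p)) :=
    (Submodule.isClosed_topologicalClosure _).completeSpace_coe
  let S : monomialSpan R q (allowable R p) →SL[starRingEnd ℂ] StrongDual ℂ (bergman R p) :=
    (Phi R p q).comp (monomialSpan R q (allowable R p)).subtypeL
  refine exists_continuousLinearEquiv_of_bijective (E := monomialSpan R q (allowable R p))
    (F := StrongDual ℂ (bergman R p)) (σ := starRingEnd ℂ) (σ' := starRingEnd ℂ) S
    (fun g hg => Subtype.ext (eq_zero_of_mem_monomialSpan_of_Phi_eq_zero hR hconn hp hq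
      (allowable_anti (hq2.trans hp2)) g.2 hg)) fun φ => ?_
  obtain ⟨g, hg, hgφ⟩ := exists_mem_monomialSpan_Phi_eq hR hconn hp hq hp2 hq2 hB φ
  exact ⟨⟨g, hg⟩, hgφ⟩

include hR hconn hp hq hp2 hq2 hB in
/-- The bilinear form of `Φ_p` makes `G^{q,p}` linearly homeomorphic to the dual of `A^p`. -/
theorem exists_continuousLinearEquiv_eq_integral :
    ∃ T : monomialSpan R q (allowable R p) ≃L[ℂ] StrongDual ℂ (bergman R p),
      ∀ g f, T g f =
        ∫ z in (R : Set (Fin n → ℂ)), holoFn f z * holoFn g.1 (fun j => conj (z j)) := by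
  have : CompleteSpace (monomialSpan R q (allowable R p)) :=
    (Submodule.isClosed_topologicalClosure _).completeSpace_coe
  -- Composing `Φ_p` with the conjugation of `A^q`, which preserves `G^{q,p}`, composes two
  -- conjugate-linear maps into a linear one.
  let S : monomialSpan R q (allowable R p) →L[ℂ] StrongDual ℂ (bergman R p) :=
    (Phi R p q).comp ((bergmanConjL hR).comp (monomialSpan R q (allowable R p)).subtypeL)
  obtain ⟨T, hT⟩ := exists_continuousLinearEquiv_of_bijective
    (E := monomialSpan R q (allowable R p))
    (F := StrongDual ℂ (bergman R p)) (σ := RingHom.id ℂ) (σ' := RingHom.id ℂ) S (fun g hg => by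
      have h0 := eq_zero_of_mem_monomialSpan_of_Phi_eq_zero hR hconn hp hq
        (allowable_anti (hq2.trans hp2)) (bergmanConj_mem_monomialSpan hR g.2) hg
      rw [← norm_eq_zero, norm_bergmanConj, norm_eq_zero] at h0
      exact Subtype.ext h0) fun φ => by
      obtain ⟨g, hg, hgφ⟩ := exists_mem_monomialSpan_Phi_eq hR hconn hp hq hp2 hq2 hB φ
      refine ⟨⟨_, bergmanConj_mem_monomialSpan hR hg⟩, ?_⟩
      have h1 : Phi R p q (bergmanConj hR (bergmanConj hR g)) = φ := by
        rw [bergmanConj_bergmanConj, hgφ]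
      exact h1
  refine ⟨T, fun g f => ?_⟩
  rw [hT]
  have h1 : Phi R p q (bergmanConj hR g.1) f
      = ∫ z in (R : Set (Fin n → ℂ)), holoFn f z * holoFn g.1 (fun j => conj (z j)) := by
    rw [Phi_apply]
    refine setIntegral_congr_fun R.isOpen.measurableSet fun z hz => ?_
    simp only [holoFn_bergmanConj hR _ hz, Complex.conj_conj]
  exact h1

omit [IsFiniteMeasure (volume.restrict (R : Set (Fin n → ℂ)))] in
theorem Phi_conj (f : bergman R p) (g : bergman R q) :
    Phi R q p f g = conj (Phi R p q g f) := by
  rw [Phi_eq_pairing, Phi_eq_pairing, pairing_conj]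

include hR hconn hp hq in
/-- A functional on `A^q` vanishing on `G^{q,p}` is a limit of combinations of coefficient
functionals. -/
theorem mem_coeffSpan_of_forall_mono (hq2 : q ≤ 2) (hpq : allowable R p ⊆ allowable R q)
    {φ : StrongDual ℂ (bergman R q)}
    (h0 : ∀ α (hα : α ∈ allowable R p), φ (mono (hpq hα)) = 0) :
    φ ∈ coeffSpan R q (allowable R q \ allowable R p) := by
  obtain ⟨h, hh⟩ := exists_pairing_eq_of_le_two (p := p) hq2 hp hq φ
  -- Approximation takes place in `L^p`, where `h` lies in the closed span of its components; the
  -- continuous map `Ψ` carries this to norm approximation in the dual of `A^q`.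
  let Ψ : Lp ℂ p (volume.restrict (R : Set (Fin n → ℂ))) →SL[starRingEnd ℂ]
      StrongDual ℂ (bergman R q) :=
    ((bergman R q).subtypeL.precomp ℂ).comp
      (pairing (volume.restrict (R : Set (Fin n → ℂ))) q p)
  have hΨ : ∀ u g, Ψ u g = pairing _ q p u g.1 := fun u g => rfl
  have hφ : Ψ h = φ := by ext g; rw [hΨ, hh]
  have hmem : (Submodule.span ℂ (Set.range fun α => lpComponent hR hp α h)).topologicalClosure ≤
      (coeffSpan R q (allowable R q \ allowable R p)).comap Ψ.toLinearMap := by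
    refine Submodule.topologicalClosure_minimal _ (Submodule.span_le.2 ?_)
      ((Submodule.isClosed_topologicalClosure _).preimage Ψ.continuous)
    rintro _ ⟨β, rfl⟩
    change Ψ (lpComponent hR hp β h) ∈ coeffSpan R q (allowable R q \ allowable R p)
    -- By self-adjointness the `β`-component of `h` induces `φ` composed with the component
    -- projection: `φ(e_β) a_β` if `β` is `L^q`-allowable, and zero otherwise. The hypothesis on `φ`
    -- removes the `L^p`-allowable `β`.
    have h1 : ∀ g, Ψ (lpComponent hR hp β h) g = φ (bergmanComponent hR hq β g) := fun g => by
      rw [hΨ, pairing_lpComponent hR hq hp, ← coe_bergmanComponent, ← hh]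
    by_cases hβ : β ∈ allowable R q
    · have h2 : Ψ (lpComponent hR hp β h) = φ (mono hβ) • coeffL hR hconn hq β := by
        ext g
        rw [h1, bergmanComponent_eq_smul_mono hR hconn hq hβ, map_smul, _root_.smul_apply,
          smul_eq_mul, smul_eq_mul, mul_comm]
      by_cases hβp : β ∈ allowable R p
      · have h3 : Ψ (lpComponent hR hp β h) = 0 := by
          ext g
          rw [h2, _root_.smul_apply, h0 β hβp, smul_eq_mul, zero_mul, _root_.zero_apply]
        rw [h3]
        exact zero_mem _
      · rw [h2]
        exact Submodule.smul_mem _ _ (Submodule.le_topologicalClosure _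
          (Submodule.subset_span ⟨β, ⟨hβ, hβp⟩, isCoeffFunctional_coeffL hR hconn hq β⟩))
    · have h2 : Ψ (lpComponent hR hp β h) = 0 := by
        ext g
        rw [h1, bergmanComponent_eq_zero hR hconn hq, map_zero, _root_.zero_apply]
        by_contra h3
        exact hβ (allowable_of_coeffL_ne_zero hR hconn hq h3)
      rw [h2]
      exact zero_mem _
  rw [← hφ]
  exact hmem (lp_mem_closure_span hR hp h)

include hR hconn hp hq hp2 hq2 hB in
/-- The decomposition of the dual of `A^q`. -/
theorem isTopCompl_range_Phi_coeffSpan :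
    Submodule.IsTopCompl (Phi R q p).range (coeffSpan R q (allowable R q \ allowable R p)) := by
  obtain ⟨E, hE⟩ := exists_continuousLinearEquiv_eq_Phi hR hconn hp hq hp2 hq2 hB
  have hpq : allowable R p ⊆ allowable R q := allowable_anti (hq2.trans hp2)
  -- `Q g` is the unique element of `G^{q,p}` that induces the same functional on `A^p` as `g`. Two
  -- conjugate-linear maps compose to a linear one, and `Qs` below is its adjoint.
  let Q : bergman R q →L[ℂ] bergman R q :=
    (monomialSpan R q (allowable R p)).subtypeL.comp
      ((E.symm : StrongDual ℂ (bergman R p) →SL[starRingEnd ℂ]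
        monomialSpan R q (allowable R p)).comp (Phi R p q))
  have hQmem : ∀ g, Q g ∈ monomialSpan R q (allowable R p) := fun g => (E.symm (Phi R p q g)).2
  have hQPhi : ∀ g, Phi R p q (Q g) = Phi R p q g := fun g => by
    have := hE (E.symm (Phi R p q g))
    rw [E.apply_symm_apply] at this
    exact this.symm
  have hQG : ∀ g ∈ monomialSpan R q (allowable R p), Q g = g := fun g hg => by
    have h1 : E.symm (Phi R p q g) = ⟨g, hg⟩ := by
      rw [ContinuousLinearEquiv.symm_apply_eq, hE]
    exact congrArg Subtype.val h1
  let Qs : StrongDual ℂ (bergman R q) →L[ℂ] StrongDual ℂ (bergman R q) :=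
    Q.precomp ℂ
  have hQs : ∀ φ g, Qs φ g = φ (Q g) := fun φ g => rfl
  have hidem : IsIdempotentElem Qs := by
    ext φ g
    change φ (Q (Q g)) = φ (Q g)
    rw [hQG _ (hQmem g)]
  have hrange : Qs.range = (Phi R q p).range := by
    apply le_antisymm
    · rintro _ ⟨φ, rfl⟩
      obtain ⟨h, hh⟩ := exists_pairing_eq_of_le_two (p := p) hq2 hp hq φ
      obtain ⟨F, hF⟩ := exists_Phi_bergmanIncl_eq hp2 hq2 hB h
      refine ⟨F, ?_⟩
      -- `Φ_q(F)` and `φ` agree on the monomials of `A^p`, hence on their closed span in `A^q`.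
      have h1 : monomialSpan R q (allowable R p) ≤ (Phi R q p F - φ).ker := by
        refine Submodule.topologicalClosure_minimal _ (Submodule.span_le.2 ?_)
          (ContinuousLinearMap.isClosed_ker _)
        rintro g ⟨α, hα, hg⟩
        have h2 : g = bergmanIncl R p q (hq2.trans hp2) (mono hα) := bergman_ext fun z hz => by
          rw [hg hz, holoFn_bergmanIncl _ _ hz, holoFn_mono hα hz]
        change Phi R q p F g - φ g = 0
        rw [h2, hF, hh, coe_bergmanIncl, sub_self]
      ext g
      have h2 : Phi R q p F (Q g) - φ (Q g) = 0 := h1 (hQmem g)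
      -- Up to conjugation `Φ_q(F)(g)` is `Φ_p(g)(F)`, which is unchanged when `g` is replaced by `Q
      -- g`; there `Φ_q(F)` and `φ` coincide.
      change Phi R q p F g = φ (Q g)
      rw [← sub_eq_zero.1 h2, Phi_conj F g, Phi_conj F (Q g), hQPhi]
    · rintro _ ⟨f, rfl⟩
      refine ⟨Phi R q p f, ?_⟩
      ext g
      change Phi R q p f (Q g) = Phi R q p f g
      rw [Phi_conj f g, Phi_conj f (Q g), hQPhi]
  -- The kernel of the adjoint consists of the functionals that vanish on the range `G^{q,p}` of
  -- `Q`.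
  have hker : Qs.ker = coeffSpan R q (allowable R q \ allowable R p) := by
    apply le_antisymm
    · intro φ hφ
      refine mem_coeffSpan_of_forall_mono hR hconn hp hq hq2 hpq fun α hα => ?_
      have h1 : φ (Q (mono (hpq hα))) = 0 := by
        rw [← hQs, show Qs φ = 0 from hφ, _root_.zero_apply]
      rwa [hQG _ (mono_mem_monomialSpan (hpq hα) hα)] at h1
    · refine Submodule.topologicalClosure_minimal _ (Submodule.span_le.2 ?_)
        (ContinuousLinearMap.isClosed_ker _)
      rintro a ⟨β, hβ, ha⟩
      rw [eq_coeffL_of_isCoeffFunctional hR hconn hq ha]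
      change Qs _ = 0
      ext g
      rw [hQs, (mem_monomialSpan_iff hR hconn hq).1 (hQmem g) β hβ.2, _root_.zero_apply]
  rw [← hrange, ← hker]
  exact ContinuousLinearMap.IsIdempotentElem.isTopCompl hidem

end Duality

end ReinhardtDuality

theorem propositionP {n : ℕ} (R : TopologicalSpace.Opens (Fin n → ℂ))
    (hconn : IsConnected (R : Set (Fin n → ℂ)))
    (hbdd : Bornology.IsBounded (R : Set (Fin n → ℂ)))
    (hR : IsReinhardt (R : Set (Fin n → ℂ)))
    (p q : ℝ≥0∞) [Fact (1 ≤ p)] [Fact (1 ≤ q)] [ENNReal.HolderConjugate p q]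
    (hp : 2 ≤ p) (hp_top : p ≠ ⊤)
    (hB : AbsKernelBounded R p (subBergmanKernel R p)) :
    -- (i)
    (Function.Surjective (Phi R p q) ∧
      (Phi R p q).ker = monomialSpan R q (allowable R q \ allowable R p)) ∧
    -- (ii)
    ((∃ E : monomialSpan R q (allowable R p) ≃SL[starRingEnd ℂ] StrongDual ℂ (bergman R p),
        ∀ g, E g = Phi R p q g) ∧
      ∃ T : monomialSpan R q (allowable R p) ≃L[ℂ] StrongDual ℂ (bergman R p),
        ∀ g f, T g f =
          ∫ z in (R : Set (Fin n → ℂ)), holoFn f z * holoFn g.1 (fun j => conj (z j))) ∧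
    -- (iii)
    ((∀ α ∈ allowable R q, ∃ a, IsCoeffFunctional R q α a) ∧
      Submodule.IsTopCompl (Phi R q p).range
        (coeffSpan R q (allowable R q \ allowable R p))) := by
  -- Boundedness of the domain is used only here; finite measure gives the inclusions `L^p ⊆ L^2 ⊆
  -- L^q`.
  have : IsFiniteMeasure (volume.restrict (R : Set (Fin n → ℂ))) :=
    ⟨by rw [Measure.restrict_apply_univ]; exact hbdd.measure_lt_top⟩
  have : ENNReal.HolderConjugate q p := ENNReal.HolderConjugate.symm
  have hq2 : q ≤ 2 := by
    by_contra! h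
    have h1 : p⁻¹ + q⁻¹ = 1 := ENNReal.HolderConjugate.inv_add_inv_eq_one p q
    have h2 : p⁻¹ + q⁻¹ < 2⁻¹ + 2⁻¹ :=
      ENNReal.add_lt_add_of_le_of_lt (ENNReal.inv_ne_top.2 (zero_lt_two.trans_le hp).ne')
        (ENNReal.inv_le_inv.2 hp) (ENNReal.inv_lt_inv.2 h)
    rw [h1, ENNReal.inv_two_add_inv_two] at h2
    exact lt_irrefl _ h2
  have hq : q ≠ ⊤ := (hq2.trans_lt ENNReal.ofNat_lt_top).ne
  refine ⟨⟨fun φ => ?_, ker_Phi hR hconn hp_top hq (allowable_anti (hq2.trans hp))⟩,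
    ⟨exists_continuousLinearEquiv_eq_Phi hR hconn hp_top hq hp hq2 hB,
      exists_continuousLinearEquiv_eq_integral hR hconn hp_top hq hp hq2 hB⟩,
    fun α _ => ⟨coeffL hR hconn hq α, isCoeffFunctional_coeffL hR hconn hq α⟩,
    isTopCompl_range_Phi_coeffSpan hR hconn hp_top hq hp hq2 hB⟩
  obtain ⟨g, -, hg⟩ := exists_mem_monomialSpan_Phi_eq hR hconn hp_top hq hp hq2 hB φ
  exact ⟨g, hg⟩
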